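/- Let $\mathbf k$ be a field of characteristic zero and let $W=W_0\oplus W_1$ be a finite-dimensional $\mathbb Z_2$-graded vector space over $\mathbf k$. Let $d$ be an odd codifferential on the tensor coalgebra $T(W)=\bigoplus_{n\ge1}W^{\otimes n}$, i.e. odd maps $d_n:W^{\otimes n}\to W$ with $$\sum_{l+m=n+1,\;0\le i\le n-m}(-1)^{w_1+\cdots+w_i}\,d_l(w_1,\dots,w_i,d_m(w_{i+1},\dots,w_{i+m}),w_{i+m+1},\dots,w_n)=0$$ for all $n\ge1$ and all homogeneous $w_1,\dots,w_n$ (an element in an exponent stands for its parity), and suppose $d_1=0$. Let $\langle\cdot,\cdot\rangle$ be a non-degenerate even bilinear form on $W$ with $\langle w_2,w_1\rangle=(-1)^{w_1w_2+1}\langle w_1,w_2\rangle$ which is invariant: $\langle d_n(w_1,\dots,w_n),w_{n+1}\rangle=(-1)^{w_1+1}\langle w_1,d_n(w_2,\dots,w_{n+1})\rangle$. Choose a homogeneous basis $(e_a)$ of $W$ with dual basis $(e^a)$. Put $d_{j_1,\dots,j_n}=\langle d_{n-1}(e_{j_1},\dots,e_{j_{n-1}}),e_{j_n}\rangle$ and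 $C_n=\sum d_{j_1,\dots,j_n}e^{j_1}\otimes\cdots\otimes e^{j_n}$, and $K=\sum k^{ab}e_a\otimes e_b$, where $(k^{ab})$ is determined by $\sum_b k^{ab}\langle e_c,e_b\rangle=\delta^a_c$, so that the coefficient $d^a_{j_1,\dots,j_n}$ of $e_a$ in $d_n(e_{j_1},\dots,e_{j_n})$ is $\sum_b k^{ab}d_{j_1,\dots,j_n,b}$. *Graph complex.* A ribbon graph is a connected graph (loops and multiple edges allowed), all of whose vertices have at least three incident half-edges, with a cyclic order of the half-edges at each vertex. It has a genus $g$ and a number $n$ of boundary circuits, with $V-E+n=2-2g$. An orientation is an ordering of the vertices together with an arrow on each edge. The chain space is spanned over $\mathbf k$ by oriented ribbon graphs. Isomorphic oriented graphs are identified (an isomorphism need not preserve arrows on loops), and exchanging two vertices in the ordering, or reversing one arrow, changes the sign. The boundary of an oriented graph is the sum over its non-loop edges of the contracted graphs with the induced orientation: after reordering the vertices (with the sign of the permutation) so that the head of the arrow on that edge is last, that vertex is removed, and the merged vertex takes the place of the tail; the cyclic orders $(a,x_1,\dots,x_p)$ and $(b,y_1,\dots,y_q)$ at the two ends of the edge with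 half-edges $a,b$ merge to $(x_1,\dots,x_p,y_1,\dots,y_q)$. *The cycle.* For an oriented ribbon graph $\Gamma_{\rm or}$ let $Z(\Gamma_{\rm or})\in\mathbf k$ be the graded contraction, along the graph, of the product of the tensors $C_n$, one for each vertex of valence $n$, in the order of the vertices (indices written in the cyclic order from any starting point), followed by the tensors $K$, one for each edge, in any order (first index at the tail of the arrow, second at its head). The sign is given by the exchange rule: contracting $e^a\otimes e^b\otimes e_b\otimes e_a$ gives sign $1$, contracting $e^a\otimes e^b\otimes e_a\otimes e_b$ gives sign $(-1)^{e_ae_b}$. Then: 1. $Z(\Gamma_{\rm or})$ depends neither on the starting points at the vertices, nor on the order of the edges, nor on the homogeneous basis. It is invariant under isomorphisms preserving the ordering of the vertices and all arrows, and it changes sign when two vertices are exchanged in the ordering or one arrow is reversed. 2. For all $g,n$ there are finitely many isomorphism classes of ribbon graphs of genus $g$ with $n$ boundary circuits, and the chain $$Z=\sum_{[\Gamma]}\frac{Z(\Gamma_{\rm or})}{|\mathrm{Aut}\,\Gamma|}\,\Gamma_{\rm or},$$ summed over these classes, where $\mathrm{Aut}\,\Gamma$ is the automorphism group of the unoriented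 ribbon graph, does not depend on the choice of the oriented representatives $\Gamma_{\rm or}$. 3. The boundary operator $\partial$ is well defined on the chain space, and $\partial Z=0$, i.e. $Z$ is a cycle. -/

import Mathlib

/-- The sign `(-1)^i` for a parity `i : ZMod 2`, as an element of the coefficient field. -/
def paritySign (k : Type*) [Field k] (i : ZMod 2) : k := (-1) ^ i.val

/-- An `A∞` algebra on a `ℤ/2`-graded vector space `W = 𝒲 0 ⊕ 𝒲 1`, given by an odd codifferential
`d` on the tensor coalgebra `T(W) = ⨁_{n ≥ 1} W^{⊗ n}` (that is, by its components
`d_n : W^{⊗ n} → W`), together with an even, graded antisymmetric, non-degenerate and invariant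
inner product.  Sequences `w : ℕ → W` are used to write the arguments `w 0, w 1, …` of the
operations; only finitely many of them occur in each formula. -/
structure CyclicAInfinity {k : Type*} [Field k] {W : Type*} [AddCommGroup W] [Module k W]
    (𝒲 : ZMod 2 → Submodule k W) where
  /-- the components `d_n` of the codifferential -/
  d : (n : ℕ) → MultilinearMap k (fun _ : Fin n => W) W
  /-- `T(W)` starts in tensor degree one -/
  d_zero : d 0 = 0
  /-- `d` is odd -/
  d_odd : ∀ (n : ℕ) (w : Fin n → W) (p : Fin n → ZMod 2), (∀ i, w i ∈ 𝒲 (p i)) →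
    d n w ∈ 𝒲 (1 + ∑ i, p i)
  /-- the codifferential equation:
  `∑_{l+m=n+1, 0≤i≤n-m} (-1)^{w_1+⋯+w_i} d_l(w_1,…,w_i, d_m(w_{i+1},…,w_{i+m}),…,w_n) = 0` -/
  codifferential : ∀ (n : ℕ) (w : ℕ → W) (p : ℕ → ZMod 2), (∀ i, w i ∈ 𝒲 (p i)) →
    ∑ m ∈ Finset.Icc 1 n, ∑ i ∈ Finset.range (n + 1 - m),
      paritySign k (∑ s ∈ Finset.range i, p s) •
        d (n + 1 - m) (fun j =>
          if (j : ℕ) < i then w j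
          else if (j : ℕ) = i then d m (fun s => w (i + s))
          else w (j + m - 1)) = 0
  /-- the inner product -/
  form : LinearMap.BilinForm k W
  form_even : ∀ (i j : ZMod 2) (v w : W), v ∈ 𝒲 i → w ∈ 𝒲 j → i ≠ j → form v w = 0
  form_antisymm : ∀ (i j : ZMod 2) (v w : W), v ∈ 𝒲 i → w ∈ 𝒲 j →
    form w v = paritySign k (i * j + 1) * form v w
  form_nondegenerate : form.Nondegenerate
  /-- invariance:
  `⟨d_n(w_1,…,w_n), w_{n+1}⟩ = (-1)^{w_1+1} ⟨w_1, d_n(w_2,…,w_{n+1})⟩` -/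
  invariant : ∀ (n : ℕ) (w : ℕ → W) (p : ℕ → ZMod 2), (∀ i, w i ∈ 𝒲 (p i)) →
    form (d n (fun i => w i)) (w n) =
      paritySign k (p 0 + 1) * form (w 0) (d n (fun i => w (i + 1)))

/-- A (connected, at least trivalent) ribbon graph, presented by its half-edges.
The vertices, with their cyclic orders, are the cycles of `rot`;
the edges are the pairs `{x, flip x}`. -/
structure RibbonGraph where
  /-- the half-edges -/
  H : Type
  [fintypeH : Fintype H]
  [decEqH : DecidableEq H]
  [nonemptyH : Nonempty H]
  /-- the next half-edge in the cyclic order at the same vertex -/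
  rot : Equiv.Perm H
  /-- the other half of the same edge -/
  flip : Equiv.Perm H
  flip_flip : ∀ x, flip (flip x) = x
  flip_ne : ∀ x, flip x ≠ x
  /-- each vertex has at least three incident half-edges: `x`, `rot x`, `rot (rot x)` differ -/
  trivalent : ∀ x, rot x ≠ x ∧ rot (rot x) ≠ x
  /-- the graph is connected -/
  connected : ∀ S : Set H, S.Nonempty → (∀ x ∈ S, rot x ∈ S ∧ flip x ∈ S) → S = Set.univ

attribute [instance] RibbonGraph.fintypeH RibbonGraph.decEqH RibbonGraph.nonemptyH

namespace RibbonGraph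

/-- Two half-edges are incident to the same vertex. -/
def SameVertex (Γ : RibbonGraph) (x y : Γ.H) : Prop := Γ.rot.SameCycle x y

/-- The edge of the half-edge `x` is a loop (so it is not contractible). -/
def IsLoop (Γ : RibbonGraph) (x : Γ.H) : Prop := Γ.SameVertex x (Γ.flip x)

/-- The number of half-edges at the vertex of `x`. -/
noncomputable def valence (Γ : RibbonGraph) (x : Γ.H) : ℕ := Function.minimalPeriod Γ.rot x

/-- The number of cycles of a permutation, fixed points included. -/
noncomputable def cycleCount {H : Type} (σ : Equiv.Perm H) : ℕ :=
  Nat.card (Quotient (Equiv.Perm.SameCycle.setoid σ))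

/-- The ribbon graph has genus `g` and `n` boundary circuits (marked points):
the circuits are the cycles of `rot ∘ flip`, and `V - E + n = 2 - 2g`. -/
def HasType (Γ : RibbonGraph) (g n : ℕ) : Prop :=
  cycleCount (Γ.rot * Γ.flip) = n ∧ cycleCount Γ.rot + n + 2 * g = cycleCount Γ.flip + 2

/-- Isomorphisms of ribbon graphs. -/
structure Iso (Γ Δ : RibbonGraph) where
  /-- the bijection of half-edges -/
  toEquiv : Γ.H ≃ Δ.H
  map_rot : ∀ x, toEquiv (Γ.rot x) = Δ.rot (toEquiv x)
  map_flip : ∀ x, toEquiv (Γ.flip x) = Δ.flip (toEquiv x)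

/-- An orientation of a ribbon graph: an ordering of the vertices, given by labelling the
vertices with distinct natural numbers (only the resulting order will matter), and an arrow on
each edge, given by selecting one of its two half-edges as the tail. -/
structure Orientation (Γ : RibbonGraph) where
  /-- the label of the vertex of a half-edge -/
  label : Γ.H → ℕ
  label_eq_iff : ∀ x y, label x = label y ↔ Γ.SameVertex x y
  /-- whether the half-edge is the tail of the arrow on its edge -/
  tail : Γ.H → Bool
  tail_flip : ∀ x, tail (Γ.flip x) = !tail x

/-- Exchange the positions of the vertices of `u` and `v` in the ordering of the vertices. -/
def Orientation.swap {Γ : RibbonGraph} (o : Γ.Orientation) (u v : Γ.H) : Γ.Orientation where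
  label x := Equiv.swap (o.label u) (o.label v) (o.label x)
  label_eq_iff x y := by rw [EmbeddingLike.apply_eq_iff_eq]; exact o.label_eq_iff x y
  tail := o.tail
  tail_flip := o.tail_flip

/-- Reverse the arrow on the edge of `e`. -/
def Orientation.reverse {Γ : RibbonGraph} (o : Γ.Orientation) (e : Γ.H) : Γ.Orientation where
  label := o.label
  label_eq_iff := o.label_eq_iff
  tail x := if x = e ∨ x = Γ.flip e then !o.tail x else o.tail x
  tail_flip x := by
    have h1 : Γ.flip x = e ↔ x = Γ.flip e :=
      ⟨fun h => by rw [← h, Γ.flip_flip], fun h => by rw [h, Γ.flip_flip]⟩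
    have h2 : Γ.flip x = Γ.flip e ↔ x = e := EmbeddingLike.apply_eq_iff_eq _
    by_cases h : x = e ∨ x = Γ.flip e
    · rw [if_pos h, if_pos (by rw [h1, h2]; exact h.symm), o.tail_flip]
    · rw [if_neg h, if_neg (by rw [h1, h2]; exact fun h' => h h'.symm), o.tail_flip]

/-- The isomorphism carries the ordering of the vertices to the ordering of the vertices. -/
def Iso.PreservesOrder {Γ Δ : RibbonGraph} (φ : Γ.Iso Δ) (o : Γ.Orientation) (o' : Δ.Orientation) :
    Prop :=
  ∀ x y, o.label x < o.label y ↔ o'.label (φ.toEquiv x) < o'.label (φ.toEquiv y)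

section Contraction

variable (Γ : RibbonGraph) (a : Γ.H)

/-- The half-edges that remain when the edge of `a` is contracted. -/
abbrev Rest : Type := {x : Γ.H // x ≠ a ∧ x ≠ Γ.flip a}

/-- The successor of a half-edge in the cyclic order after contracting the edge of `a`: when the
successor was a half of the contracted edge, one continues on the other side of that edge. -/
def nextFun (x : Γ.H) : Γ.H :=
  if Γ.rot x = a then Γ.rot (Γ.flip a)
  else if Γ.rot x = Γ.flip a then Γ.rot a
  else Γ.rot x

theorem rot_ne_flip (ha : ¬ Γ.IsLoop a) : Γ.rot a ≠ Γ.flip a := fun h => ha ⟨1, by simpa using h⟩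

theorem rot_flip_ne (ha : ¬ Γ.IsLoop a) : Γ.rot (Γ.flip a) ≠ a := fun h =>
  ha (Equiv.Perm.SameCycle.symm ⟨1, by simpa using h⟩)

theorem nextFun_mem (ha : ¬ Γ.IsLoop a) (x : Γ.H) : Γ.nextFun a x ≠ a ∧ Γ.nextFun a x ≠ Γ.flip a := by
  have h1 := Γ.rot_ne_flip a ha
  have h2 := Γ.rot_flip_ne a ha
  have h3 := (Γ.trivalent a).1
  have h4 := (Γ.trivalent (Γ.flip a)).1
  unfold nextFun
  split_ifs with h h' <;> constructor <;> assumption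

theorem nextFun_injOn (x y : Γ.Rest a) (h : Γ.nextFun a x = Γ.nextFun a y) : x = y := by
  obtain ⟨x, hx⟩ := x
  obtain ⟨y, hy⟩ := y
  have hi := Γ.rot.injective
  have hne := Γ.flip_ne a
  apply Subtype.ext
  simp only [nextFun] at h ⊢
  split_ifs at h <;> first
    | exact hi h
    | exact absurd (hi h).symm hy.1
    | exact absurd (hi h).symm hy.2
    | exact absurd (hi h) hx.1
    | exact absurd (hi h) hx.2
    | exact absurd (hi h) hne
    | exact absurd (hi h).symm hne
    | (apply hi; simp_all)

/-- The cyclic orders after contracting the edge of `a`. -/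
noncomputable def contractRot (ha : ¬ Γ.IsLoop a) : Equiv.Perm (Γ.Rest a) :=
  Equiv.ofBijective (fun x => ⟨Γ.nextFun a x, Γ.nextFun_mem a ha x⟩)
    (Finite.injective_iff_bijective.mp fun x y h =>
      Γ.nextFun_injOn a x y (congrArg Subtype.val h))

/-- The edges after contracting the edge of `a`. -/
def contractFlip : Equiv.Perm (Γ.Rest a) :=
  Γ.flip.subtypePerm fun x => by
    have h1 : Γ.flip x = a ↔ x = Γ.flip a :=
      ⟨fun h => by rw [← h, Γ.flip_flip], fun h => by rw [h, Γ.flip_flip]⟩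
    have h2 : Γ.flip x = Γ.flip a ↔ x = a := EmbeddingLike.apply_eq_iff_eq _
    simp only [ne_eq, h1, h2, and_comm]

@[simp] theorem contractRot_coe (ha : ¬ Γ.IsLoop a) (x : Γ.Rest a) :
    (Γ.contractRot a ha x : Γ.H) = Γ.nextFun a x := rfl

@[simp] theorem contractFlip_coe (x : Γ.Rest a) : (Γ.contractFlip a x : Γ.H) = Γ.flip x := rfl

/-- The half-edge belongs to one of the two end vertices of the edge of `a`. -/
def AtEnds (x : Γ.H) : Prop := Γ.SameVertex a x ∨ Γ.SameVertex (Γ.flip a) x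

theorem sameVertex_rot (x : Γ.H) : Γ.SameVertex x (Γ.rot x) := ⟨1, by simp⟩

theorem contract_step (x : Γ.H) : Γ.SameVertex x (Γ.nextFun a x) ∨
    (Γ.AtEnds a x ∧ Γ.AtEnds a (Γ.nextFun a x)) := by
  have hx := (Γ.sameVertex_rot x).symm
  unfold nextFun
  split_ifs with h h'
  · rw [h] at hx
    exact Or.inr ⟨Or.inl hx, Or.inr (Γ.sameVertex_rot _)⟩
  · rw [h'] at hx
    exact Or.inr ⟨Or.inr hx, Or.inl (Γ.sameVertex_rot _)⟩
  · exact Or.inl (Γ.sameVertex_rot x)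

theorem atEnds_of_sameVertex {x y : Γ.H} (h : Γ.SameVertex x y) (hx : Γ.AtEnds a x) :
    Γ.AtEnds a y :=
  hx.imp (fun h' => Equiv.Perm.SameCycle.trans h' h) (fun h' => Equiv.Perm.SameCycle.trans h' h)

theorem contract_forward (ha : ¬ Γ.IsLoop a) (x y : Γ.Rest a)
    (h : (Γ.contractRot a ha).SameCycle x y) :
    Γ.SameVertex x y ∨ (Γ.AtEnds a x ∧ Γ.AtEnds a y) := by
  obtain ⟨n, -, rfl⟩ := h.exists_pow_eq'
  clear h
  induction n with
  | zero => exact Or.inl (Equiv.Perm.SameCycle.refl _ _)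
  | succ n ih =>
    rw [pow_succ', Equiv.Perm.mul_apply, contractRot_coe]
    have hs := Γ.contract_step a (((Γ.contractRot a ha) ^ n) x)
    rcases ih with ih | ⟨ih1, ih2⟩ <;> rcases hs with hs | ⟨hs1, hs2⟩
    · exact Or.inl (Equiv.Perm.SameCycle.trans ih hs)
    · exact Or.inr ⟨Γ.atEnds_of_sameVertex a (Equiv.Perm.SameCycle.symm ih) hs1, hs2⟩
    · exact Or.inr ⟨ih1, Γ.atEnds_of_sameVertex a hs ih2⟩
    · exact Or.inr ⟨ih1, hs2⟩

/-- Along a stretch of half-edges at a vertex of `Γ` that avoids the contracted edge, the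
contracted graph has the same cyclic order. -/
theorem contract_stretch (ha : ¬ Γ.IsLoop a) (x : Γ.Rest a) (n : ℕ)
    (h : ∀ m ≤ n, (Γ.rot ^ m) x ≠ a ∧ (Γ.rot ^ m) x ≠ Γ.flip a) :
    (Γ.contractRot a ha).SameCycle x ⟨(Γ.rot ^ n) x, h n le_rfl⟩ := by
  induction n with
  | zero => exact Equiv.Perm.SameCycle.refl _ _
  | succ n ih =>
    refine (ih fun m hm => h m (hm.trans n.le_succ)).trans ⟨1, Subtype.ext ?_⟩
    have hn := h (n + 1) le_rfl
    rw [pow_succ', Equiv.Perm.mul_apply] at hn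
    simp only [zpow_one, contractRot_coe, nextFun, if_neg hn.1, if_neg hn.2]
    rw [pow_succ', Equiv.Perm.mul_apply]

/-- All other half-edges at the vertex of `c`, where `c` is one of the two halves of the
contracted edge, end up at the vertex of `rot c`. -/
theorem contract_end (ha : ¬ Γ.IsLoop a) (c : Γ.H) (hc : c = a ∨ c = Γ.flip a)
    (hr : Γ.rot c ≠ a ∧ Γ.rot c ≠ Γ.flip a) (x : Γ.Rest a) (h : Γ.SameVertex c x) :
    (Γ.contractRot a ha).SameCycle ⟨Γ.rot c, hr⟩ x := by
  obtain ⟨n, hn⟩ : ∃ n : ℕ, (Γ.rot ^ n) (Γ.rot c) = x := by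
    have h' : Γ.rot.SameCycle (Γ.rot c) x := (Γ.sameVertex_rot c).symm.trans h
    obtain ⟨n, -, h⟩ := h'.exists_pow_eq'
    exact ⟨n, h⟩
  classical
  let N := Nat.find (p := fun n => (Γ.rot ^ n) (Γ.rot c) = x) ⟨n, hn⟩
  have hN : (Γ.rot ^ N) (Γ.rot c) = x := Nat.find_spec (p := fun n => (Γ.rot ^ n) (Γ.rot c) = x) _
  have hc0 : ∀ m ≤ N, (Γ.rot ^ m) (Γ.rot c) ≠ c := by
    intro m hm hmc
    rcases hm.lt_or_eq with hm | rfl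
    · have : (Γ.rot ^ (N - (m + 1))) (Γ.rot c) = x := by
        have e : N = (N - (m + 1)) + 1 + m := by omega
        rw [e, pow_add, Equiv.Perm.mul_apply, hmc, pow_succ, Equiv.Perm.mul_apply] at hN
        exact hN
      exact Nat.find_min (p := fun n => (Γ.rot ^ n) (Γ.rot c) = x) ⟨n, hn⟩
        (m := N - (m + 1)) (by change _ < N; omega) this
    · rw [hN] at hmc
      rcases hc with rfl | rfl
      · exact x.2.1 hmc
      · exact x.2.2 hmc
  have hsame : ∀ m : ℕ, Γ.SameVertex c ((Γ.rot ^ m) (Γ.rot c)) := fun m =>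
    ⟨(m + 1 : ℕ), by rw [zpow_natCast, pow_succ, Equiv.Perm.mul_apply]⟩
  have hall : ∀ m ≤ N, (Γ.rot ^ m) (Γ.rot c) ≠ a ∧ (Γ.rot ^ m) (Γ.rot c) ≠ Γ.flip a := by
    intro m hm
    have h0 := hc0 m hm
    have h1 := hsame m
    rcases hc with rfl | rfl
    · exact ⟨h0, fun h2 => ha (by rw [h2] at h1; exact h1)⟩
    · exact ⟨fun h2 => ha (by rw [h2] at h1; exact Equiv.Perm.SameCycle.symm h1), h0⟩
  have := Γ.contract_stretch a ha ⟨Γ.rot c, hr⟩ N hall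
  convert this using 1
  exact Subtype.ext hN.symm

/-- The vertices of the contracted graph. -/
theorem contract_sameCycle_iff (ha : ¬ Γ.IsLoop a) (x y : Γ.Rest a) :
    (Γ.contractRot a ha).SameCycle x y ↔
      Γ.SameVertex x y ∨ (Γ.AtEnds a x ∧ Γ.AtEnds a y) := by
  refine ⟨Γ.contract_forward a ha x y, fun h => ?_⟩
  have hra : Γ.rot a ≠ a ∧ Γ.rot a ≠ Γ.flip a := ⟨(Γ.trivalent a).1, Γ.rot_ne_flip a ha⟩
  have hrb : Γ.rot (Γ.flip a) ≠ a ∧ Γ.rot (Γ.flip a) ≠ Γ.flip a :=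
    ⟨Γ.rot_flip_ne a ha, (Γ.trivalent (Γ.flip a)).1⟩
  have hmid : (Γ.contractRot a ha).SameCycle ⟨Γ.rot a, hra⟩ ⟨Γ.rot (Γ.flip a), hrb⟩ := by
    have hz : Γ.rot.symm a ≠ a ∧ Γ.rot.symm a ≠ Γ.flip a :=
      ⟨fun h => hra.1 (by rw [Equiv.symm_apply_eq] at h; exact h.symm),
        fun h => hrb.1 (by rw [Equiv.symm_apply_eq] at h; exact h.symm)⟩
    refine (Γ.contract_end a ha a (Or.inl rfl) hra ⟨Γ.rot.symm a, hz⟩ ?_).trans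
      ⟨1, Subtype.ext ?_⟩
    · have := (Γ.sameVertex_rot (Γ.rot.symm a)).symm
      rwa [Equiv.apply_symm_apply] at this
    · simp [nextFun]
  have hend : ∀ z : Γ.Rest a, Γ.AtEnds a z →
      (Γ.contractRot a ha).SameCycle ⟨Γ.rot a, hra⟩ z := by
    rintro z (hz | hz)
    · exact Γ.contract_end a ha a (Or.inl rfl) hra z hz
    · exact hmid.trans (Γ.contract_end a ha _ (Or.inr rfl) hrb z hz)
  by_cases hx : Γ.AtEnds a x
  · have hy : Γ.AtEnds a y := h.elim (fun h => Γ.atEnds_of_sameVertex a h hx) And.right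
    exact (hend x hx).symm.trans (hend y hy)
  · have hxy : Γ.SameVertex x y := h.resolve_right fun h => hx h.1
    obtain ⟨n, -, hn⟩ := Equiv.Perm.SameCycle.exists_pow_eq' hxy
    have hall : ∀ m ≤ n, (Γ.rot ^ m) x ≠ a ∧ (Γ.rot ^ m) x ≠ Γ.flip a := by
      intro m _
      have hm : Γ.SameVertex ((Γ.rot ^ m) x) x :=
        Equiv.Perm.SameCycle.symm ⟨(m : ℕ), by rw [zpow_natCast]⟩
      exact ⟨fun h => hx (Or.inl (by rwa [h] at hm)), fun h => hx (Or.inr (by rwa [h] at hm))⟩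
    have := Γ.contract_stretch a ha x n hall
    convert this using 1
    exact Subtype.ext hn.symm

theorem contract_trivalent (ha : ¬ Γ.IsLoop a) (x : Γ.Rest a) :
    Γ.contractRot a ha x ≠ x ∧ Γ.contractRot a ha (Γ.contractRot a ha x) ≠ x := by
  have hQ : ∀ z, Γ.SameVertex a (Γ.rot z) ↔ Γ.SameVertex a z := fun z =>
    ⟨fun h => Equiv.Perm.SameCycle.trans h (Γ.sameVertex_rot z).symm,
      fun h => Equiv.Perm.SameCycle.trans h (Γ.sameVertex_rot z)⟩
  have hQa : Γ.SameVertex a a := Equiv.Perm.SameCycle.refl _ _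
  have hQb : ¬ Γ.SameVertex a (Γ.flip a) := ha
  have htx := Γ.trivalent x
  have hta := Γ.trivalent a
  have htb := Γ.trivalent (Γ.flip a)
  rw [ne_eq, ne_eq, Subtype.ext_iff, Subtype.ext_iff]
  simp only [contractRot_coe, nextFun]
  obtain ⟨x, hx⟩ := x
  simp only at htx ⊢
  grind

theorem contract_connected (ha : ¬ Γ.IsLoop a) (S : Set (Γ.Rest a)) (hS : S.Nonempty)
    (h : ∀ x ∈ S, Γ.contractRot a ha x ∈ S ∧ Γ.contractFlip a x ∈ S) : S = Set.univ := by
  have hcyc : ∀ x ∈ S, ∀ y, (Γ.contractRot a ha).SameCycle x y → y ∈ S := by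
    intro x hx y hxy
    obtain ⟨n, -, rfl⟩ := hxy.exists_pow_eq'
    clear hxy
    induction n with
    | zero => exact hx
    | succ n ih =>
      rw [pow_succ', Equiv.Perm.mul_apply]
      exact (h _ ih).1
  have hnext : ∀ x ∈ S, Γ.rot x ≠ a → Γ.rot x ≠ Γ.flip a → Γ.rot x ∈ Subtype.val '' S := by
    intro x hx h1 h2
    exact ⟨_, (h x hx).1, by simp [nextFun, h1, h2]⟩
  by_cases hz : ∃ z ∈ S, Γ.AtEnds a z
  · obtain ⟨z, hzS, hz⟩ := hz
    have hend : ∀ y, y ≠ a ∧ y ≠ Γ.flip a → Γ.AtEnds a y → y ∈ Subtype.val '' S :=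
      fun y hy hy' => ⟨⟨y, hy⟩, hcyc z hzS _
        ((Γ.contract_sameCycle_iff a ha z ⟨y, hy⟩).mpr (Or.inr ⟨hz, hy'⟩)), rfl⟩
    have hT := Γ.connected (Subtype.val '' S ∪ {a, Γ.flip a}) ⟨a, by simp⟩ (by
      rintro x (⟨x, hx, rfl⟩ | rfl | rfl)
      · refine ⟨?_, Or.inl ⟨_, (h x hx).2, rfl⟩⟩
        by_cases h1 : Γ.rot x = a
        · exact Or.inr (Or.inl h1)
        · by_cases h2 : Γ.rot x = Γ.flip a
          · exact Or.inr (Or.inr h2)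
          · exact Or.inl (hnext x hx h1 h2)
      · exact ⟨Or.inl (hend _ ⟨(Γ.trivalent x).1, Γ.rot_ne_flip x ha⟩
          (Or.inl (Γ.sameVertex_rot x))), Or.inr (Or.inr rfl)⟩
      · exact ⟨Or.inl (hend _ ⟨Γ.rot_flip_ne a ha, (Γ.trivalent _).1⟩
          (Or.inr (Γ.sameVertex_rot _))), Or.inr (Or.inl (Γ.flip_flip a))⟩)
    ext x
    simp only [Set.mem_univ, iff_true]
    have hx : (x : Γ.H) ∈ Subtype.val '' S ∪ {a, Γ.flip a} := hT ▸ Set.mem_univ _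
    rcases hx with ⟨y, hy, hyx⟩ | hx | hx
    · exact Subtype.ext hyx ▸ hy
    · exact absurd hx x.2.1
    · exact absurd hx x.2.2
  · have hT := Γ.connected (Subtype.val '' S) (hS.image _) (by
      rintro _ ⟨x, hx, rfl⟩
      have hrot := (Γ.sameVertex_rot x).symm
      exact ⟨hnext x hx (fun h1 => hz ⟨x, hx, Or.inl (by rwa [h1] at hrot)⟩)
        (fun h2 => hz ⟨x, hx, Or.inr (by rwa [h2] at hrot)⟩), ⟨_, (h x hx).2, rfl⟩⟩)
    obtain ⟨y, -, hy⟩ : a ∈ Subtype.val '' S := hT ▸ Set.mem_univ a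
    exact absurd hy y.2.1

/-- The ribbon graph obtained by contracting the edge of `a`, which must not be a loop. -/
noncomputable def contract (ha : ¬ Γ.IsLoop a) : RibbonGraph where
  H := Γ.Rest a
  nonemptyH := ⟨⟨Γ.rot a, (Γ.trivalent a).1, Γ.rot_ne_flip a ha⟩⟩
  rot := Γ.contractRot a ha
  flip := Γ.contractFlip a
  flip_flip x := Subtype.ext (Γ.flip_flip x)
  flip_ne x h := Γ.flip_ne x (congrArg Subtype.val h)
  trivalent := Γ.contract_trivalent a ha
  connected := Γ.contract_connected a ha

end Contraction

/-- The orientation induced on the contracted graph: the vertex at the head of the contracted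
arrow disappears, and the merged vertex takes the place of the vertex at its tail `a`. -/
def Orientation.contract {Γ : RibbonGraph} (o : Γ.Orientation) (a : Γ.H) (ha : ¬ Γ.IsLoop a) :
    (Γ.contract a ha).Orientation where
  label x := if o.label x.1 = o.label (Γ.flip a) then o.label a else o.label x.1
  label_eq_iff x y := by
    refine Iff.trans ?_ (Γ.contract_sameCycle_iff a ha x y).symm
    unfold AtEnds
    simp only [← o.label_eq_iff]
    grind
  tail x := o.tail x.1
  tail_flip x := o.tail_flip x.1

/-- The number of vertices that come after the vertex of `x` in the ordering. -/
def Orientation.after {Γ : RibbonGraph} (o : Γ.Orientation) (x : Γ.H) : ℕ :=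
  ((Finset.univ.image o.label).filter (fun m => o.label x < m)).card

end RibbonGraph

/-- An oriented ribbon graph. -/
structure OrientedRibbonGraph where
  graph : RibbonGraph
  orientation : graph.Orientation

/-- The relations of the graph complex.  Isomorphic oriented graphs are identified, where the arrow
on a loop is not required to be preserved, since its starting and ending vertex coincide;
exchanging two vertices in the ordering, or reversing an arrow, changes the sign. -/
inductive GraphRelation (k : Type*) [Field k] : (OrientedRibbonGraph →₀ k) → Prop
  | iso {Γ Δ : RibbonGraph} (o : Γ.Orientation) (o' : Δ.Orientation) (φ : Γ.Iso Δ)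
      (horder : φ.PreservesOrder o o')
      (harrow : ∀ x, ¬ Γ.IsLoop x → o'.tail (φ.toEquiv x) = o.tail x) :
      GraphRelation k (Finsupp.single ⟨Γ, o⟩ 1 - Finsupp.single ⟨Δ, o'⟩ 1)
  | swap {Γ : RibbonGraph} (o : Γ.Orientation) (u v : Γ.H) (huv : ¬ Γ.SameVertex u v) :
      GraphRelation k (Finsupp.single ⟨Γ, o.swap u v⟩ 1 + Finsupp.single ⟨Γ, o⟩ 1)
  | reverse {Γ : RibbonGraph} (o : Γ.Orientation) (e : Γ.H) :
      GraphRelation k (Finsupp.single ⟨Γ, o.reverse e⟩ 1 + Finsupp.single ⟨Γ, o⟩ 1)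

/-- The space of chains of the complex of metric ribbon graphs, with coefficients in `k`. -/
abbrev GraphChains (k : Type*) [Field k] : Type _ :=
  (OrientedRibbonGraph →₀ k) ⧸ Submodule.span k {r | GraphRelation k r}

namespace OrientedRibbonGraph

/-- The chain given by an oriented ribbon graph. -/
noncomputable def toChain (k : Type*) [Field k] (X : OrientedRibbonGraph) : GraphChains k :=
  Submodule.Quotient.mk (Finsupp.single X 1)

open Classical in
/-- The boundary of an oriented ribbon graph: the sum over all contractible edges, each listed by
the tail `a` of its arrow, of the oriented contracted graphs.  The sign is that of moving the
vertex at the head of the arrow to the last place, where it is then removed. -/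
noncomputable def boundary (k : Type*) [Field k] (X : OrientedRibbonGraph) : GraphChains k :=
  ∑ a : {a : X.graph.H // X.orientation.tail a = true ∧ ¬ X.graph.IsLoop a},
    (-1 : k) ^ X.orientation.after (X.graph.flip a.1) •
      toChain k ⟨X.graph.contract a.1 a.2.2, X.orientation.contract a.1 a.2.2⟩

/-- The choices made in writing down the tensor of an oriented graph: a starting half-edge at
each vertex, listed in the order of the vertices, and an order of the edges (listed by the
tails of their arrows). -/
structure Writing (X : OrientedRibbonGraph) where
  starts : List X.graph.H
  starts_sorted : (starts.map X.orientation.label).Pairwise (· < ·)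
  starts_cover : ∀ x, ∃ s ∈ starts, X.graph.SameVertex s x
  edges : List X.graph.H
  edges_nodup : edges.Nodup
  mem_edges : ∀ x, x ∈ edges ↔ X.orientation.tail x = true

/-- The half-edges in the order in which the indices of the tensors at the vertices occur. -/
noncomputable def Writing.lower {X : OrientedRibbonGraph} (w : X.Writing) : List X.graph.H :=
  w.starts.flatMap fun s => (List.range (X.graph.valence s)).map fun i => (X.graph.rot ^ i) s

/-- The half-edges in the order in which the indices of the tensors on the edges occur: for each
arrow first the tail and then the head. -/
def Writing.upper {X : OrientedRibbonGraph} (w : X.Writing) : List X.graph.H :=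
  w.edges.flatMap fun a => [a, X.graph.flip a]

theorem nonempty_writing (X : OrientedRibbonGraph) : Nonempty X.Writing := by
  classical
  have hl : ∀ m ∈ Finset.univ.image X.orientation.label, ∃ x, X.orientation.label x = m := by
    simp
  choose! f hf using hl
  refine ⟨⟨((Finset.univ.image X.orientation.label).sort (· ≤ ·)).map f, ?_, ?_,
    (Finset.univ.filter fun x => X.orientation.tail x = true).toList, Finset.nodup_toList _, ?_⟩⟩
  · have hid : (((Finset.univ.image X.orientation.label).sort (· ≤ ·)).map f).map
        X.orientation.label = (Finset.univ.image X.orientation.label).sort (· ≤ ·) := by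
      rw [List.map_map]
      conv_rhs => rw [← List.map_id ((Finset.univ.image X.orientation.label).sort (· ≤ ·))]
      exact List.map_congr_left fun m hm => hf m ((Finset.mem_sort _).mp hm)
    rw [hid]
    exact (Finset.sortedLT_sort _).pairwise
  · intro x
    have hx : X.orientation.label x ∈ Finset.univ.image X.orientation.label := by simp
    exact ⟨f (X.orientation.label x), List.mem_map_of_mem ((Finset.mem_sort _).mpr hx),
      (X.orientation.label_eq_iff _ _).mp (hf _ hx)⟩
  · simp

/-- `S` is a set of representatives, each with some orientation, of the isomorphism classes of
ribbon graphs of genus `g` with `n` boundary circuits. -/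
def IsRepresentatives (g n : ℕ) (S : Finset OrientedRibbonGraph) : Prop :=
  (∀ X ∈ S, X.graph.HasType g n) ∧
    ∀ Γ : RibbonGraph, Γ.HasType g n → ∃! X, X ∈ S ∧ Nonempty (Γ.Iso X.graph)

end OrientedRibbonGraph

/-- The sign of the graded contraction of `e^{x_1} ⊗ ⋯ ⊗ e^{x_N} ⊗ e_{y_1} ⊗ ⋯ ⊗ e_{y_N}`, where
the lists `L = [x_1, …, x_N]` and `M = [y_1, …, y_N]` enumerate the same indices, `e^x` is
contracted with `e_x`, and `q x` is the parity of `e^x` and of `e_x`.  By the exchange rule, two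
odd indices contribute a sign precisely when they occur in the same order in `L` and in `M`: the
contraction of `e^a ⊗ e^b ⊗ e_b ⊗ e_a` has sign `1`, that of `e^a ⊗ e^b ⊗ e_a ⊗ e_b` has sign
`(-1)^{ab}`. -/
def contractionSign (k : Type*) [Field k] {H : Type} [Fintype H] [DecidableEq H]
    (L M : List H) (q : H → ZMod 2) : k :=
  ∏ x, ∏ y, if L.idxOf x < L.idxOf y ∧ M.idxOf x < M.idxOf y then paritySign k (q x * q y) else 1

namespace CyclicAInfinity

variable {k : Type*} [Field k] {W : Type*} [AddCommGroup W] [Module k W]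
  {𝒲 : ZMod 2 → Submodule k W}

/-- The forms `C_m (w_1, …, w_m) = ⟨d_{m-1}(w_1, …, w_{m-1}), w_m⟩`; on basis vectors these are
the lower structure constants `d_{j_1, …, j_m}`. -/
def lowered (A : CyclicAInfinity 𝒲) : (m : ℕ) → (Fin m → W) → k
  | 0, _ => 0
  | n + 1, w => A.form (A.d n fun i => w i.castSucc) (w (Fin.last n))

/-- The components `k^{ab}` of the tensor `K = k^{ab} e_a ⊗ e_b` inverse to the inner product
`k_{ab} = ⟨e_a, e_b⟩`, with the convention `∑_b k^{ab} k_{cb} = δ^a_c`.  So the index of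
the lower structure constants is raised by `d^a_{j_1,…,j_m} = ∑_b k^{ab} d_{j_1,…,j_m,b}`. -/
noncomputable def copairing (A : CyclicAInfinity 𝒲) {ι : Type*} [Fintype ι] [DecidableEq ι]
    (e : Module.Basis ι k W) : Matrix ι ι k :=
  (Matrix.of fun b c => A.form (e c) (e b))⁻¹

/-- The graded contraction, along the graph, of the product of the tensors `C_m` at the vertices
(in the order of the vertices) and of the tensors `K` on the edges, for a given choice of writing.
Here `e` is a basis of homogeneous elements, with parities `p`. -/
noncomputable def contraction (A : CyclicAInfinity 𝒲) {ι : Type*} [Fintype ι] [DecidableEq ι]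
    (e : Module.Basis ι k W) (p : ι → ZMod 2) {X : OrientedRibbonGraph} (w : X.Writing) : k :=
  ∑ j : X.graph.H → ι,
    contractionSign k w.lower w.upper (fun x => p (j x)) *
      (w.starts.map fun s =>
        A.lowered (X.graph.valence s) fun i => e (j ((X.graph.rot ^ (i : ℕ)) s))).prod *
      (w.edges.map fun a => A.copairing e (j a) (j (X.graph.flip a))).prod

/-- The number `Z(Γ_or)` of an oriented ribbon graph. -/
noncomputable def partitionFunction (A : CyclicAInfinity 𝒲) {ι : Type*} [Fintype ι]
    [DecidableEq ι] (e : Module.Basis ι k W) (p : ι → ZMod 2) (X : OrientedRibbonGraph) : k :=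
  A.contraction e p (Classical.choice X.nonempty_writing)

/-- The chain `Z = ∑ Z(Γ_or) / |Aut Γ| Γ_or`, where `Γ_or` runs through a system of oriented
representatives of the isomorphism classes of ribbon graphs. -/
noncomputable def cycleChain (A : CyclicAInfinity 𝒲) {ι : Type*} [Fintype ι]
    [DecidableEq ι] (e : Module.Basis ι k W) (p : ι → ZMod 2) (S : Finset OrientedRibbonGraph) :
    GraphChains k :=
  ∑ X ∈ S, (A.partitionFunction e p X / (Nat.card (X.graph.Iso X.graph) : k)) • X.toChain k

end CyclicAInfinity

/-! Expand `Z(Γ_or)` as a sum over all labellings of the half-edges by basis indices (`diagramSum`).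
Each summand is a sign times lowered structure constants times entries of `K`, and two parity facts
control the sign. As `d` is odd and the form even, a lowered constant vanishes unless its indices
have total parity 1: the vertex tensors are odd. As the form is even, an entry of `K` vanishes
unless its two indices have equal parity: the edge tensors are even. Moreover `C_n` is strictly
cyclic, because the sign of invariance cancels that of antisymmetry (`loweredList_rotate`).

Hence rotating `uv` to `vu` at a vertex costs `(-1)^{|u||v|}` with `|u| + |v| = 1`, that is,
nothing; exchanging two vertices costs `-1`; permuting edges costs nothing; reversing an arrow costs
`-1` by the graded antisymmetry of `K`. Independence of the basis is multilinearity together with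
the transformation law of `K` (`copairing_change_basis`). Since `Z(Γ_or)` and the chain of `Γ_or`
change sign together, their product does not see the orientation. The Euler relation and trivalence
bound the number of half-edges, which gives finiteness.

The contribution of a single edge to the boundary, signed by its arrow, is also odd under exchanges
of vertices and reversals of arrows, and it is invariant under isomorphisms. So the boundary
descends to chains, and `Z(Γ_or)` times the contribution of an edge depends only on the unoriented
graph and the edge.

To see that the boundary of `Z` vanishes, regroup the pairs (graph, edge) by the contracted graph
`Δ`. With weights `1/|Aut|` this is an orbit count: a half-edge `a` of `Γ` with an isomorphism `Γ/a
≅ Δ` is the same as a cut of a vertex of `Δ` with an isomorphism of the expansion onto `Γ`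
(`Expansions.bijective_contraction`). Put the cut vertex of `Δ` last. Contracting the new edge first
inserts `d(X)` into the form at the other end, since `K` inverts the inner product
(`diagramSum_expand`). The sum over all cuts of one vertex is then, up to sign, twice the
codifferential equation paired with a last argument (`sum_compositeTerm`). The terms of that
equation with a one-element side correspond to no trivalent expansion, but they contain `d_1 = 0`.
-/

section Signs

/-! ### Signs of graded contractions. -/

variable (k : Type*) [Field k]

theorem ZMod.two_cases (i : ZMod 2) : i = 0 ∨ i = 1 := by
  fin_cases i
  · exact Or.inl rfl
  · exact Or.inr rfl

@[simp] theorem paritySign_zero : paritySign k 0 = 1 := by simp [paritySign]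

@[simp] theorem paritySign_one : paritySign k 1 = -1 := by simp [paritySign, ZMod.val_one]

theorem paritySign_add (i j : ZMod 2) :
    paritySign k (i + j) = paritySign k i * paritySign k j := by
  have h : (1 : ZMod 2) + 1 = 0 := rfl
  rcases ZMod.two_cases i with rfl | rfl <;> rcases ZMod.two_cases j with rfl | rfl <;> simp [h]

@[simp] theorem paritySign_mul_self (i : ZMod 2) : paritySign k i * paritySign k i = 1 := by
  rcases ZMod.two_cases i with rfl | rfl <;> simp

/-- The product of `g x y` over the pairs of entries `x`, `y` of a list with `x` before `y`. -/
def pairProd {H : Type} (g : H → H → k) : List H → k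
  | [] => 1
  | x :: l => (l.map (g x)).prod * pairProd g l

variable {k}

theorem pairProd_append {H : Type} (g : H → H → k) (A B : List H) :
    pairProd k g (A ++ B) =
      pairProd k g A * pairProd k g B * (A.map fun x => (B.map (g x)).prod).prod := by
  induction A with
  | nil => simp [pairProd]
  | cons x A ih => simp only [List.cons_append, pairProd, ih, List.map_append, List.prod_append,
      List.map_cons, List.prod_cons]; ring

theorem prod_map_prod_map_comm {H : Type} (g : H → H → k) (A B : List H) :
    (A.map fun x => (B.map (g x)).prod).prod = (B.map fun y => (A.map fun x => g x y).prod).prod := by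
  induction A with
  | nil => simp
  | cons x A ih =>
    simp only [List.map_cons, List.prod_cons, ih, List.prod_map_mul]

theorem pairProd_map {H H' : Type} (f : H → H') (g : H' → H' → k) (L : List H) :
    pairProd k g (L.map f) = pairProd k (fun x y => g (f x) (f y)) L := by
  induction L with
  | nil => rfl
  | cons a L ih => simp [pairProd, ih, Function.comp_def]

theorem prod_map_idxOf_eq_pairProd {H : Type} [DecidableEq H] (g : H → H → k) {L : List H}
    (hL : L.Nodup) :
    (L.map fun x => (L.map fun y => if L.idxOf x < L.idxOf y then g x y else 1).prod).prod =
      pairProd k g L := by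
  induction L with
  | nil => rfl
  | cons a L ih =>
    rw [List.nodup_cons] at hL
    have hne : ∀ x ∈ L, a ≠ x := by rintro x hx rfl; exact hL.1 hx
    have h1 : ∀ x ∈ L, (a :: L).idxOf x = L.idxOf x + 1 := fun x hx =>
      List.idxOf_cons_ne _ (hne x hx)
    simp only [List.map_cons, List.prod_cons, List.idxOf_cons_self, if_false, one_mul,
      Nat.not_lt_zero]
    rw [pairProd, ← ih hL.2]
    congr 2
    · refine List.map_congr_left fun y hy => ?_
      rw [h1 y hy, if_pos (Nat.succ_pos _)]
    · refine List.map_congr_left fun x hx => ?_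
      congr 1
      refine List.map_congr_left fun y hy => ?_
      rw [h1 x hx, h1 y hy]
      simp only [add_lt_add_iff_right]

/-- The parity of a list. -/
def listParity {H : Type*} (q : H → ZMod 2) (L : List H) : ZMod 2 := (L.map q).sum

@[simp] theorem listParity_nil {H : Type*} (q : H → ZMod 2) : listParity q [] = 0 := rfl

@[simp] theorem listParity_cons {H : Type*} (q : H → ZMod 2) (x : H) (L : List H) :
    listParity q (x :: L) = q x + listParity q L := by simp [listParity]

@[simp] theorem listParity_append {H : Type*} (q : H → ZMod 2) (L M : List H) :
    listParity q (L ++ M) = listParity q L + listParity q M := by simp [listParity]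

@[simp] theorem listParity_map {H H' : Type*} (q : H → ZMod 2) (f : H' → H) (L : List H') :
    listParity q (L.map f) = listParity (fun x => q (f x)) L := by
  simp [listParity, Function.comp_def]

theorem prod_map_paritySign {H : Type} (q : H → ZMod 2) (i : ZMod 2) (L : List H) :
    (L.map fun x => paritySign k (i * q x)).prod = paritySign k (i * listParity q L) := by
  induction L with
  | nil => simp
  | cons x L ih => simp [ih, mul_add, paritySign_add]

variable {H : Type} [Fintype H] [DecidableEq H]

/-- The defining condition is symmetric in the two lists, so exchange rules proved for the vertex
indices also apply to the edge indices. -/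
theorem contractionSign_comm (L M : List H) (q : H → ZMod 2) :
    contractionSign k L M q = contractionSign k M L q := by
  unfold contractionSign
  simp only [and_comm]

/-- The order in `L` becomes the recursion of `pairProd`, while the order in `M` remains a condition
on positions. The sign can then be computed by cutting `L` into blocks with `pairProd_append`. -/
theorem contractionSign_eq_pairProd {L : List H} (hL : L.Nodup) (hL' : ∀ x, x ∈ L) (M : List H)
    (q : H → ZMod 2) : contractionSign k L M q =
      pairProd k (fun x y => if M.idxOf x < M.idxOf y then paritySign k (q x * q y) else 1) L := by
  have hu : (Finset.univ : Finset H) = L.toFinset := by ext; simp [hL']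
  rw [← prod_map_idxOf_eq_pairProd _ hL, contractionSign, hu, List.prod_toFinset _ hL]
  congr 1
  refine List.map_congr_left fun x _ => ?_
  rw [List.prod_toFinset _ hL]
  simp only [ite_and]

/-- Exchanging two adjacent blocks of indices. -/
theorem contractionSign_swap {A B C D M : List H} (hL : (A ++ (B ++ (C ++ D))).Nodup)
    (hL' : ∀ x, x ∈ A ++ (B ++ (C ++ D))) (hM : ∀ x, x ∈ M) (q : H → ZMod 2) :
    contractionSign k (A ++ (B ++ (C ++ D))) M q =
      paritySign k (listParity q B * listParity q C) *
        contractionSign k (A ++ (C ++ (B ++ D))) M q := by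
  have hp : (A ++ (B ++ (C ++ D))).Perm (A ++ (C ++ (B ++ D))) := by
    refine List.Perm.append_left A ?_
    rw [← List.append_assoc, ← List.append_assoc]
    exact List.Perm.append_right D List.perm_append_comm
  have hBC : ∀ x ∈ B, ∀ y ∈ C, x ≠ y := by
    rintro x hx y hy rfl
    have := (List.nodup_append.mp hL).2.1
    exact (List.nodup_append.mp this).2.2 x hx x (by simp [hy]) rfl
  rw [contractionSign_eq_pairProd hL hL',
    contractionSign_eq_pairProd (hp.nodup_iff.mp hL) fun x => hp.subset (hL' x)]
  set g : H → H → k := fun x y =>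
    if M.idxOf x < M.idxOf y then paritySign k (q x * q y) else 1 with hg
  -- Only pairs with one entry in `B` and one in `C` change their order in `L`. Such a pair agrees
  -- with `M` in exactly one of the two orders, so its factors differ by `(-1)^{q x q y}`.
  have hcross : (B.map fun x => (C.map (g x)).prod).prod =
      paritySign k (listParity q B * listParity q C) *
        (C.map fun x => (B.map (g x)).prod).prod := by
    rw [prod_map_prod_map_comm g C B]
    have h1 : ∀ x ∈ B, (C.map (g x)).prod =
        paritySign k (q x * listParity q C) * (C.map fun y => g y x).prod := by
      intro x hx
      rw [← prod_map_paritySign, ← List.prod_map_mul]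
      congr 1
      refine List.map_congr_left fun y hy => ?_
      have hne : M.idxOf x ≠ M.idxOf y := fun h => hBC x hx y hy (List.idxOf_inj (hM x) |>.mp h)
      simp only [hg]
      rcases lt_or_gt_of_ne hne with h | h
      · rw [if_pos h, if_neg (by omega), mul_one]
      · rw [if_neg (by omega), if_pos h, mul_comm (q y), paritySign_mul_self]
    rw [List.map_congr_left h1, List.prod_map_mul]
    congr 1
    simp only [mul_comm _ (listParity q C)]
    exact prod_map_paritySign q _ B
  simp only [pairProd_append, List.map_append, List.prod_append, List.prod_map_mul, hcross]
  ring

theorem idxOf_map_of_injective {H H' : Type} [DecidableEq H] [DecidableEq H'] {f : H → H'}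
    (hf : Function.Injective f) (L : List H) (x : H) : (L.map f).idxOf (f x) = L.idxOf x := by
  induction L with
  | nil => rfl
  | cons a L ih =>
    by_cases h : a = x
    · subst h; simp
    · rw [List.map_cons, List.idxOf_cons_ne _ (fun h' => h (hf h')), List.idxOf_cons_ne _ h, ih]

theorem contractionSign_map {H' : Type} [Fintype H'] [DecidableEq H'] (f : H ≃ H')
    (L M : List H) (q : H' → ZMod 2) :
    contractionSign k (L.map f) (M.map f) q = contractionSign k L M (fun x => q (f x)) := by
  unfold contractionSign
  rw [← f.prod_comp]
  refine Finset.prod_congr rfl fun x _ => ?_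
  rw [← f.prod_comp]
  simp only [idxOf_map_of_injective f.injective]

end Signs

/-! ### The operations and the forms `C_n` on lists: parity, cyclic symmetry, codifferential
equation. -/

namespace CyclicAInfinity

variable {k : Type*} [Field k] {W : Type*} [AddCommGroup W] [Module k W]
  {𝒲 : ZMod 2 → Submodule k W}

/-- The operation `d_n` applied to a list of length `n`. -/
def dList (A : CyclicAInfinity 𝒲) (l : List W) : W := A.d l.length fun i => l.getD i 0

/-- The form `C_n` applied to a list of length `n`. -/
def loweredList (A : CyclicAInfinity 𝒲) (l : List W) : k := A.lowered l.length fun i => l.getD i 0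

theorem dList_eq (A : CyclicAInfinity 𝒲) {n : ℕ} {l : List W} (h : l.length = n) :
    A.dList l = A.d n fun i => l.getD i 0 := by
  subst h; rfl

theorem loweredList_eq (A : CyclicAInfinity 𝒲) {n : ℕ} {l : List W} (h : l.length = n) :
    A.loweredList l = A.lowered n fun i => l.getD i 0 := by
  subst h; rfl

theorem loweredList_concat (A : CyclicAInfinity 𝒲) (l : List W) (w : W) :
    A.loweredList (l ++ [w]) = A.form (A.dList l) w := by
  rw [A.loweredList_eq (n := l.length + 1) (by simp), lowered, dList]
  congr 1
  · congr 2
    funext i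
    simp
  · simp

/-- A list of elements with parities, such that each element has the given parity. -/
def _root_.IsHomogeneousList (𝒲 : ZMod 2 → Submodule k W) (l : List (W × ZMod 2)) : Prop :=
  ∀ x ∈ l, x.1 ∈ 𝒲 x.2

/-- Past the end of the list the default 0 occurs, which lies in every homogeneous part. A finite
list can therefore be fed to the axioms, which are stated for infinite sequences. -/
theorem _root_.IsHomogeneousList.getD {l : List (W × ZMod 2)} (h : IsHomogeneousList 𝒲 l) (i : ℕ) :
    (l.map Prod.fst).getD i 0 ∈ 𝒲 ((l.map Prod.snd).getD i 0) := by
  by_cases hi : i < l.length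
  · simp [hi]
    exact h _ (List.getElem_mem hi)
  · simp [not_lt.mp hi]

theorem sum_range_getD (l r : List (ZMod 2)) :
    ∑ s ∈ Finset.range l.length, (l ++ r).getD s 0 = l.sum := by
  induction l with
  | nil => simp
  | cons a l ih =>
    rw [List.length_cons, Finset.sum_range_succ', List.sum_cons, ← ih, add_comm]
    simp

theorem sum_fin_getD (l : List (ZMod 2)) : ∑ s : Fin l.length, l.getD s 0 = l.sum := by
  rw [Fin.sum_univ_eq_sum_range (fun s => l.getD s 0)]
  simpa using sum_range_getD l []

theorem dList_mem (A : CyclicAInfinity 𝒲) {l : List (W × ZMod 2)} (h : IsHomogeneousList 𝒲 l) :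
    A.dList (l.map Prod.fst) ∈ 𝒲 (1 + listParity Prod.snd l) := by
  have := A.d_odd l.length (fun i => (l.map Prod.fst).getD i 0)
    (fun i => (l.map Prod.snd).getD i 0) fun i => h.getD i
  rw [A.dList_eq (n := l.length) (by simp)]
  convert this using 3
  rw [listParity, ← sum_fin_getD, Fin.sum_univ_eq_sum_range (fun s => (l.map Prod.snd).getD s 0),
    Fin.sum_univ_eq_sum_range (fun s => (l.map Prod.snd).getD s 0), List.length_map]

/-- An odd operation paired by an even form: `d(l)` has parity `1 + |l|`, which must equal that of
the last entry. This oddness of the vertex tensors is the source of the signs under exchange of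
vertices. -/
theorem loweredList_eq_zero (A : CyclicAInfinity 𝒲) {l : List (W × ZMod 2)}
    (h : IsHomogeneousList 𝒲 l) (hl : listParity Prod.snd l ≠ 1) :
    A.loweredList (l.map Prod.fst) = 0 := by
  rcases List.eq_nil_or_concat l with rfl | ⟨l, z, rfl⟩
  · rfl
  · simp only [List.concat_eq_append, List.map_append, List.map_cons, List.map_nil,
      loweredList_concat] at h hl ⊢
    refine A.form_even _ _ _ _ (A.dList_mem fun x hx => h x (by simp [hx])) (h z (by simp)) ?_
    intro hz
    apply hl
    rw [listParity_append, listParity_cons, ← hz]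
    generalize listParity Prod.snd l = c
    rcases ZMod.two_cases c with rfl | rfl <;> rfl

/-- Invariance moves `x` to the left of the form with sign `(-1)^{|x|+1}`, and antisymmetry moves
`d(l)` back in front. As the form is even, only `|d(l)| = |x|` contributes, the second sign is then
`(-1)^{|x|+1}` too, and the two cancel. -/
theorem loweredList_rotate (A : CyclicAInfinity 𝒲) {x : W × ZMod 2} {l : List (W × ZMod 2)}
    (h : IsHomogeneousList 𝒲 (x :: l)) :
    A.loweredList ((x :: l).map Prod.fst) = A.loweredList ((l ++ [x]).map Prod.fst) := by
  rcases List.eq_nil_or_concat l with rfl | ⟨l, z, rfl⟩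
  · rfl
  simp only [List.concat_eq_append] at h ⊢
  have h1 : IsHomogeneousList 𝒲 (l ++ [z]) := fun y hy => h y (List.mem_cons_of_mem _ hy)
  have hd := A.dList_mem h1
  have hx : x.1 ∈ 𝒲 x.2 := h x (by simp)
  have hinv := A.invariant (l.length + 1) (fun i => ((x :: (l ++ [z])).map Prod.fst).getD i 0)
    (fun i => ((x :: (l ++ [z])).map Prod.snd).getD i 0) fun i => h.getD i
  have e1 : A.loweredList ((x :: (l ++ [z])).map Prod.fst) = A.form (A.d (l.length + 1)
      fun i => ((x :: (l ++ [z])).map Prod.fst).getD i 0)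
      (((x :: (l ++ [z])).map Prod.fst).getD (l.length + 1) 0) := by
    rw [A.loweredList_eq (n := l.length + 1 + 1) (by simp)]
    rfl
  have e2 : A.loweredList ((l ++ [z] ++ [x]).map Prod.fst) = A.form (A.d (l.length + 1)
      fun i => ((x :: (l ++ [z])).map Prod.fst).getD (i + 1) 0) x.1 := by
    rw [List.map_append (l₂ := [x]), List.map_cons, List.map_nil, loweredList_concat,
      A.dList_eq (n := l.length + 1) (by simp)]
    rfl
  have e3 : A.dList ((l ++ [z]).map Prod.fst) = A.d (l.length + 1)
      fun i => ((x :: (l ++ [z])).map Prod.fst).getD (i + 1) 0 := by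
    rw [A.dList_eq (n := l.length + 1) (by simp)]
    rfl
  rw [e1, e2, hinv, ← e3]
  simp only [List.map_cons, List.getD_cons_zero]
  rw [A.form_antisymm _ _ _ _ hd hx]
  by_cases hp : 1 + listParity Prod.snd (l ++ [z]) = x.2
  · rw [hp, ← mul_assoc]
    have : x.2 * x.2 = x.2 := by
      generalize x.2 = c
      rcases ZMod.two_cases c with rfl | rfl <;> rfl
    rw [this, paritySign_mul_self, one_mul]
  · rw [A.form_even _ _ _ _ hd hx hp]
    simp

theorem loweredList_rotate' (A : CyclicAInfinity 𝒲) (l r : List (W × ZMod 2))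
    (h : IsHomogeneousList 𝒲 (l ++ r)) :
    A.loweredList ((l ++ r).map Prod.fst) = A.loweredList ((r ++ l).map Prod.fst) := by
  induction l generalizing r with
  | nil => simp
  | cons x l ih =>
    rw [List.cons_append, A.loweredList_rotate (x := x) (l := l ++ r) h, List.append_assoc, ih]
    · simp
    · intro y hy
      refine h y ?_
      simp only [List.mem_append, List.mem_cons, List.not_mem_nil] at hy ⊢
      tauto

theorem codifferential_list (A : CyclicAInfinity 𝒲) {l : List (W × ZMod 2)}
    (h : IsHomogeneousList 𝒲 l) :
    ∑ m ∈ Finset.Icc 1 l.length, ∑ i ∈ Finset.range (l.length + 1 - m),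
      paritySign k (listParity Prod.snd (l.take i)) •
        A.dList ((l.take i).map Prod.fst ++ A.dList (((l.drop i).take m).map Prod.fst) ::
          (l.drop (i + m)).map Prod.fst) = 0 := by
  rw [← A.codifferential l.length (fun i => (l.map Prod.fst).getD i 0)
    (fun i => (l.map Prod.snd).getD i 0) fun i => h.getD i]
  refine Finset.sum_congr rfl fun m hm => Finset.sum_congr rfl fun i hi => ?_
  rw [Finset.mem_Icc] at hm
  rw [Finset.mem_range] at hi
  congr 1
  · congr 1
    have := sum_range_getD ((l.take i).map Prod.snd) ((l.drop i).map Prod.snd)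
    rw [← List.map_append, List.take_append_drop, List.length_map, List.length_take,
      min_eq_left (by omega)] at this
    exact this.symm
  · rw [A.dList_eq (n := l.length + 1 - m) (by simp; omega),
      A.dList_eq (n := m) (by simp; omega)]
    congr 1
    funext ⟨j, hj⟩
    have hti : ((l.take i).map Prod.fst).length = i := by simp; omega
    simp only
    split_ifs with h1 h2
    · rw [List.getD_append _ _ _ _ (by omega)]
      simp [h1]
    · subst h2
      rw [List.getD_append_right _ _ _ _ (by omega), hti, Nat.sub_self, List.getD_cons_zero]
      congr 1
      funext s
      simp
    · rw [List.getD_append_right _ _ _ _ (by omega), hti]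
      obtain ⟨t, rfl⟩ : ∃ t, j = i + 1 + t := ⟨j - i - 1, by omega⟩
      rw [show i + 1 + t - i = t + 1 by omega, List.getD_cons_succ]
      simp only [List.getD_eq_getElem?_getD, List.getElem?_map, List.getElem?_drop]
      rw [show i + 1 + t + m - 1 = i + m + t by omega]

/-- Pair the codifferential equation for the word without its last letter with that letter. Here `i`
and `j` are the positions where the inner word begins and ends, so `m = j - i`; the inner word never
contains the last letter. -/
theorem codifferential_lowered (A : CyclicAInfinity 𝒲) {l : List (W × ZMod 2)}
    (h : IsHomogeneousList 𝒲 l) :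
    ∑ j ∈ Finset.range l.length, ∑ i ∈ Finset.range j,
      paritySign k (listParity Prod.snd (l.take i)) *
        A.loweredList ((l.take i).map Prod.fst ++
          A.dList (((l.drop i).take (j - i)).map Prod.fst) :: (l.drop j).map Prod.fst) = 0 := by
  rcases List.eq_nil_or_concat l with rfl | ⟨l, z, rfl⟩
  · simp
  simp only [List.concat_eq_append] at h ⊢
  have h0 := congrArg (fun v => A.form v z.1)
    (A.codifferential_list fun x hx => h x (List.mem_append_left _ hx))
  simp only [map_sum, map_smul, LinearMap.sum_apply, LinearMap.smul_apply, map_zero,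
    LinearMap.zero_apply, smul_eq_mul, ← loweredList_concat] at h0
  rw [← h0, Finset.sum_sigma', Finset.sum_sigma']
  refine Finset.sum_bij' (fun x _ => ⟨x.1 - x.2, x.2⟩) (fun x _ => ⟨x.2 + x.1, x.2⟩) ?_ ?_ ?_ ?_ ?_
  · rintro ⟨j, i⟩ hx
    simp only [Finset.mem_sigma, Finset.mem_range, Finset.mem_Icc, List.length_append,
      List.length_singleton] at hx ⊢
    omega
  · rintro ⟨j, i⟩ hx
    simp only [Finset.mem_sigma, Finset.mem_range, Finset.mem_Icc, List.length_append,
      List.length_singleton] at hx ⊢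
    omega
  · rintro ⟨j, i⟩ hx
    simp only [Finset.mem_sigma, Finset.mem_range] at hx
    simp only [Sigma.mk.injEq, heq_eq_eq, and_true]
    omega
  · rintro ⟨j, i⟩ hx
    simp
  · rintro ⟨j, i⟩ hx
    simp only [Finset.mem_sigma, Finset.mem_range, List.length_append,
      List.length_singleton] at hx ⊢
    rw [List.take_append_of_le_length (by omega), List.drop_append_of_le_length (by omega),
      List.drop_append_of_le_length (by omega), List.take_append_of_le_length (by simp; omega),
      show i + (j - i) = j by omega]
    simp

/-- Multilinearity in one slot of a concatenated list. The existential form hides the length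
arithmetic; the 0 in the witness only marks the slot being updated. -/
theorem exists_linear_dList (A : CyclicAInfinity 𝒲) (l r : List W) :
    ∃ φ : W →ₗ[k] W, ∀ u, A.dList (l ++ u :: r) = φ u := by
  refine ⟨(A.d (l.length + 1 + r.length)).toLinearMap (fun i => (l ++ 0 :: r).getD i 0)
    ⟨l.length, by omega⟩, fun u => ?_⟩
  rw [A.dList_eq (n := l.length + 1 + r.length) (by simp; omega)]
  simp only [MultilinearMap.toLinearMap_apply]
  congr 1
  funext ⟨i, hi⟩
  rcases lt_trichotomy i l.length with h | h | h
  · rw [Function.update_of_ne (by simpa using h.ne)]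
    simp [List.getElem?_append_left, h]
  · subst h
    simp
  · rw [Function.update_of_ne (by simpa using h.ne')]
    obtain ⟨t, rfl⟩ : ∃ t, i = l.length + (t + 1) := ⟨i - l.length - 1, by omega⟩
    simp only
    rw [List.getD_append_right _ _ _ _ (by omega), List.getD_append_right _ _ _ _ (by omega),
      Nat.add_sub_cancel_left, List.getD_cons_succ, List.getD_cons_succ]

theorem exists_linear_loweredList (A : CyclicAInfinity 𝒲) (l r : List W) :
    ∃ φ : W →ₗ[k] k, ∀ u, A.loweredList (l ++ u :: r) = φ u := by
  rcases List.eq_nil_or_concat r with rfl | ⟨r, z, rfl⟩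
  · exact ⟨A.form (A.dList l), fun u => A.loweredList_concat l u⟩
  · obtain ⟨φ, hφ⟩ := A.exists_linear_dList l r
    refine ⟨A.form.flip z ∘ₗ φ, fun u => ?_⟩
    rw [List.concat_eq_append, ← List.cons_append, ← List.append_assoc, loweredList_concat, hφ]
    rfl

end CyclicAInfinity

/-! ### The tensor `K` inverse to the inner product. -/

namespace CyclicAInfinity

variable {k : Type*} [Field k] {W : Type*} [AddCommGroup W] [Module k W]
  {𝒲 : ZMod 2 → Submodule k W} (A : CyclicAInfinity 𝒲) {ι : Type*} [Fintype ι] [DecidableEq ι]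
  (e : Module.Basis ι k W) {p : ι → ZMod 2}

/-- The matrix of the inner product, transposed. -/
noncomputable def gram : Matrix ι ι k := Matrix.of fun b c => A.form (e c) (e b)

theorem isUnit_det_gram : IsUnit (A.gram e).det := by
  have h := (LinearMap.BilinForm.nondegenerate_toMatrix_iff (B := A.form) e).mpr A.form_nondegenerate
  have h2 : (LinearMap.BilinForm.toMatrix e A.form).det ≠ 0 := h.det_ne_zero
  have h3 : A.gram e = (LinearMap.BilinForm.toMatrix e A.form).transpose := by
    ext b c
    simp [gram, LinearMap.BilinForm.toMatrix_apply]
  rw [h3, Matrix.det_transpose]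
  exact h2.isUnit

theorem copairing_mul_gram : A.copairing e * A.gram e = 1 :=
  Matrix.nonsing_inv_mul _ (A.isUnit_det_gram e)

theorem gram_mul_copairing : A.gram e * A.copairing e = 1 :=
  Matrix.mul_nonsing_inv _ (A.isUnit_det_gram e)

/-- Properties of `K` are proved through uniqueness of the inverse: a candidate only has to be
tested against the Gram matrix. -/
theorem eq_copairing {N : Matrix ι ι k} (h : N * A.gram e = 1) : N = A.copairing e := by
  rw [← Matrix.mul_one N, ← A.gram_mul_copairing e, ← Matrix.mul_assoc, h, Matrix.one_mul]

theorem sum_copairing_form (a c : ι) :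
    ∑ b, A.copairing e a b * A.form (e c) (e b) = if a = c then 1 else 0 := by
  have := congrFun (congrFun (A.copairing_mul_gram e) a) c
  rwa [Matrix.mul_apply, Matrix.one_apply] at this

/-- A vector is recovered from its inner products. -/
theorem sum_copairing_smul (v : W) :
    ∑ a, (∑ b, A.copairing e a b * A.form v (e b)) • e a = v := by
  have h : ∑ a, (∑ b, A.copairing e a b • (A.form.flip (e b))).smulRight (e a) =
      (LinearMap.id : W →ₗ[k] W) := by
    refine e.ext fun c => ?_
    simp [LinearMap.sum_apply, sum_copairing_form]
  simpa [LinearMap.sum_apply] using LinearMap.congr_fun h v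

variable {e} (he : ∀ i, e i ∈ 𝒲 (p i))
include he

/-- The Gram matrix is block diagonal for the parity. Discarding the entries of `K` between
different parities therefore leaves a left inverse, which must be `K` again. -/
theorem copairing_eq_zero {a b : ι} (hab : p a ≠ p b) : A.copairing e a b = 0 := by
  have h : (Matrix.of fun a b => if p a = p b then A.copairing e a b else 0) = A.copairing e := by
    refine A.eq_copairing e ?_
    ext a c
    rw [Matrix.mul_apply, Matrix.one_apply, ← A.sum_copairing_form e a c]
    by_cases hac : p a = p c
    · refine Finset.sum_congr rfl fun b _ => ?_
      simp only [Matrix.of_apply, gram]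
      split_ifs with h
      · rfl
      · rw [A.form_even _ _ _ _ (he c) (he b) (hac ▸ h)]
        simp
    · rw [A.sum_copairing_form, if_neg fun h => hac (congrArg p h)]
      refine Finset.sum_eq_zero fun b _ => ?_
      simp only [Matrix.of_apply, gram]
      split_ifs with h
      · rw [A.form_even _ _ _ _ (he c) (he b) fun h' => hac (h.trans h'.symm), mul_zero]
      · rw [zero_mul]
  rw [← h]
  simp [hab]

/-- The Gram matrix is antisymmetric up to the parity sign of one index, the two parities being
equal wherever an entry is nonzero. Scaling the columns of `K` by `-(-1)^{p b}` thus gives an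
inverse of the transposed Gram matrix, that is, the transpose of `K`; where `K` is nonzero, `p a * p
b = p b`. -/
theorem copairing_antisymm (a b : ι) :
    A.copairing e b a = -(paritySign k (p a * p b) * A.copairing e a b) := by
  have hg : ∀ b c, A.gram e c b = -(paritySign k (p b) * A.gram e b c) := by
    intro b c
    simp only [gram, Matrix.of_apply]
    by_cases hbc : p b = p c
    · rw [A.form_antisymm _ _ _ _ (he c) (he b), hbc, paritySign_add]
      have : p c * p c = p c := by
        rcases ZMod.two_cases (p c) with h | h <;> rw [h] <;> rfl
      rw [this]
      simp
    · rw [A.form_even _ _ _ _ (he b) (he c) hbc, A.form_even _ _ _ _ (he c) (he b) (Ne.symm hbc)]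
      simp
  have h : (Matrix.of fun a b => -(paritySign k (p b) * A.copairing e a b)) =
      (A.copairing e).transpose := by
    have h1 : (Matrix.of fun a b => -(paritySign k (p b) * A.copairing e a b)) *
        (A.gram e).transpose = 1 := by
      rw [← A.copairing_mul_gram e]
      ext a c
      simp only [Matrix.mul_apply, Matrix.of_apply, Matrix.transpose_apply]
      refine Finset.sum_congr rfl fun b _ => ?_
      rw [hg b c]
      linear_combination A.copairing e a b * A.gram e b c * paritySign_mul_self k (p b)
    have h2 : (A.gram e).transpose * (A.copairing e).transpose = 1 := by
      rw [← Matrix.transpose_mul, A.copairing_mul_gram, Matrix.transpose_one]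
    rw [← Matrix.mul_one (Matrix.of _), ← h2, ← Matrix.mul_assoc, h1, Matrix.one_mul]
  have h' : A.copairing e b a = -(paritySign k (p b) * A.copairing e a b) :=
    (congrFun (congrFun h a) b).symm
  rw [h']
  by_cases hab : p a = p b
  · have : p a * p b = p b := by
      rw [hab]
      rcases ZMod.two_cases (p b) with h | h <;> rw [h] <;> rfl
    rw [this]
  · rw [A.copairing_eq_zero he hab]; simp

omit he

/-- With `P` the matrix of the change of basis, the Gram matrices satisfy `G' = Pᵀ G P`, so `P K'
Pᵀ` is a left inverse of `G`. -/
theorem copairing_change_basis {ι' : Type*} [Fintype ι'] [DecidableEq ι'] (e : Module.Basis ι k W)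
    (e' : Module.Basis ι' k W) (a b : ι) :
    A.copairing e a b =
      ∑ α, ∑ β, e.repr (e' α) a * e.repr (e' β) b * A.copairing e' α β := by
  set P : Matrix ι ι' k := e.toMatrix e' with hP
  have hg : A.gram e' = P.transpose * A.gram e * P := by
    ext b c
    have hb : e' b = ∑ y, P y b • e y := (e.sum_toMatrix_smul_self e' b).symm
    have hc : e' c = ∑ y, P y c • e y := (e.sum_toMatrix_smul_self e' c).symm
    simp only [gram, Matrix.of_apply, Matrix.mul_apply, Matrix.transpose_apply]
    conv_lhs => rw [hb, hc]
    simp only [map_sum, map_smul, LinearMap.sum_apply, LinearMap.smul_apply, smul_eq_mul,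
      Finset.sum_mul, Finset.mul_sum]
    rw [Finset.sum_comm]
    refine Finset.sum_congr rfl fun x _ => Finset.sum_congr rfl fun y _ => ?_
    ring
  have h : P * A.copairing e' * P.transpose = A.copairing e := by
    refine A.eq_copairing e ?_
    have h1 : P * e'.toMatrix e = 1 := e.toMatrix_mul_toMatrix_flip e'
    calc P * A.copairing e' * P.transpose * A.gram e
        = P * A.copairing e' * (P.transpose * A.gram e * P) * e'.toMatrix e := by
          simp only [Matrix.mul_assoc, h1, Matrix.mul_one]
      _ = 1 := by
          rw [← hg, Matrix.mul_assoc P, A.copairing_mul_gram, Matrix.mul_one, h1]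
  rw [← h, Matrix.mul_apply]
  simp only [Matrix.mul_apply, Matrix.transpose_apply, Finset.sum_mul]
  rw [Finset.sum_comm]
  refine Finset.sum_congr rfl fun x _ => Finset.sum_congr rfl fun y _ => ?_
  simp only [hP, Module.Basis.toMatrix_apply]
  ring

-- The part of the expansion of `v` along basis vectors of the wrong parity lies in `𝒲 (i + 1)`.
-- Being the difference of `v` and the remaining part, it also lies in `𝒲 i`, hence it is zero.
include he in
omit [DecidableEq ι] in
theorem repr_eq_zero (h𝒲 : DirectSum.IsInternal 𝒲) {i : ZMod 2} {v : W} (hv : v ∈ 𝒲 i) {j : ι}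
    (hj : p j ≠ i) : e.repr v j = 0 := by
  classical
  have hv' : v = ∑ x ∈ Finset.univ.filter (fun x => p x = i), e.repr v x • e x +
      ∑ x ∈ Finset.univ.filter (fun x => ¬ p x = i), e.repr v x • e x := by
    rw [Finset.sum_filter_add_sum_filter_not]
    exact (e.sum_repr v).symm
  have h1 : ∑ x ∈ Finset.univ.filter (fun x => ¬ p x = i), e.repr v x • e x ∈ 𝒲 i := by
    rw [eq_sub_of_add_eq' hv'.symm]
    refine Submodule.sub_mem _ hv (Submodule.sum_mem _ fun x hx => Submodule.smul_mem _ _ ?_)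
    rw [← (Finset.mem_filter.mp hx).2]
    exact he x
  have h2 : ∑ x ∈ Finset.univ.filter (fun x => ¬ p x = i), e.repr v x • e x ∈ 𝒲 (i + 1) := by
    refine Submodule.sum_mem _ fun x hx => Submodule.smul_mem _ _ ?_
    have hx' := (Finset.mem_filter.mp hx).2
    have : p x = i + 1 := by
      exact (by decide : ∀ c i : ZMod 2, ¬c = i → c = i + 1) _ _ hx'
    rw [← this]
    exact he x
  have hd : Disjoint (𝒲 i) (𝒲 (i + 1)) :=
    h𝒲.submodule_iSupIndep.pairwiseDisjoint ((by decide : ∀ i : ZMod 2, i ≠ i + 1) i)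
  have h0 := Submodule.disjoint_def.mp hd _ h1 h2
  rw [h0, add_zero] at hv'
  rw [hv', map_sum, Finsupp.finsetSum_apply]
  refine Finset.sum_eq_zero fun x hx => ?_
  have hne : x ≠ j := by
    rintro rfl
    exact hj (Finset.mem_filter.mp hx).2
  simp [Finsupp.single_eq_of_ne hne.symm]

end CyclicAInfinity

/-! ### Diagrams: two partitions of the half-edges, into blocks and into arrows. -/

/-- The list of the ends of a list of arrows. -/
def arrowEnds {H : Type} (es : List (H × H)) : List H := es.flatMap fun a => [a.1, a.2]

@[simp] theorem arrowEnds_nil {H : Type} : arrowEnds ([] : List (H × H)) = [] := rfl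

@[simp] theorem arrowEnds_cons {H : Type} (a : H × H) (es : List (H × H)) :
    arrowEnds (a :: es) = a.1 :: a.2 :: arrowEnds es := rfl

@[simp] theorem arrowEnds_append {H : Type} (es es' : List (H × H)) :
    arrowEnds (es ++ es') = arrowEnds es ++ arrowEnds es' := by
  simp [arrowEnds]

theorem arrowEnds_map {H H' : Type} (f : H → H') (es : List (H × H)) :
    arrowEnds (es.map (Prod.map f f)) = (arrowEnds es).map f := by
  induction es with
  | nil => rfl
  | cons a es ih => simp [ih]

/-- The blocks `bs` and the arrows `es` both partition the set of half-edges. -/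
structure IsDiagram {H : Type} (bs : List (List H)) (es : List (H × H)) : Prop where
  nodup_blocks : bs.flatten.Nodup
  mem_blocks : ∀ x, x ∈ bs.flatten
  nodup_arrows : (arrowEnds es).Nodup
  mem_arrows : ∀ x, x ∈ arrowEnds es

theorem IsDiagram.of_perm {H : Type} {bs bs' : List (List H)} {es es' : List (H × H)}
    (h : IsDiagram bs es) (hb : bs.flatten.Perm bs'.flatten)
    (he : (arrowEnds es).Perm (arrowEnds es')) : IsDiagram bs' es' :=
  ⟨hb.nodup_iff.mp h.1, fun x => hb.subset (h.2 x), he.nodup_iff.mp h.3, fun x => he.subset (h.4 x)⟩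

/-- An arrow whose ends have equal parity is an even pair, and even pairs move past anything freely.
The prefix `pre` is carried along so that the induction on the permutation can step past a common
head. -/
theorem contractionSign_perm_arrows {k : Type*} [Field k] {H : Type} [Fintype H] [DecidableEq H]
    {L : List H} (hL : ∀ x, x ∈ L) (q : H → ZMod 2) {es es' : List (H × H)} (h : es.Perm es')
    (hq : ∀ a ∈ es, q a.1 = q a.2) (pre : List H) (hn : (pre ++ arrowEnds es).Nodup)
    (hm : ∀ x, x ∈ pre ++ arrowEnds es) :
    contractionSign k (pre ++ arrowEnds es) L q = contractionSign k (pre ++ arrowEnds es') L q := by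
  induction h generalizing pre with
  | nil => rfl
  | cons a h ih =>
    have := ih (fun b hb => hq b (by simp [hb])) (pre ++ [a.1, a.2]) (by simpa using hn)
      (by simpa using hm)
    simpa using this
  | swap a b es =>
    have := contractionSign_swap (k := k) (A := pre) (B := [b.1, b.2]) (C := [a.1, a.2])
      (D := arrowEnds es) (M := L) (by simpa using hn) (by simpa using hm) hL q
    have h0 : listParity q [b.1, b.2] = 0 := by
      rw [listParity_cons, listParity_cons, hq b (by simp), listParity_nil, add_zero]
      exact (by decide : ∀ i : ZMod 2, i + i = 0) _
    rw [h0, zero_mul, paritySign_zero, one_mul] at this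
    simpa using this
  | trans h1 h2 ih1 ih2 =>
    have hp := (List.Perm.flatMap_right (fun a : H × H => [a.1, a.2]) h1).append_left pre
    rw [ih1 hq pre hn hm, ih2 (fun a ha => hq a (h1.symm.subset ha)) pre (hp.nodup_iff.mp hn)
      fun x => hp.subset (hm x)]

/-! ### Symmetries of the contraction of a diagram. -/

namespace CyclicAInfinity

variable {k : Type*} [Field k] {W : Type*} [AddCommGroup W] [Module k W]
  {𝒲 : ZMod 2 → Submodule k W} (A : CyclicAInfinity 𝒲) {ι : Type*} [Fintype ι] [DecidableEq ι]
  (e : Module.Basis ι k W) (p : ι → ZMod 2)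

/-- The summand of the contraction of a diagram given by a labelling `j` of the half-edges. -/
noncomputable def diagramTerm {H : Type} [Fintype H] [DecidableEq H] (bs : List (List H))
    (es : List (H × H)) (j : H → ι) : k :=
  contractionSign k bs.flatten (arrowEnds es) (fun x => p (j x)) *
    (bs.map fun b => A.loweredList (b.map fun x => e (j x))).prod *
    (es.map fun a => A.copairing e (j a.1) (j a.2)).prod

/-- The contraction of a diagram. -/
noncomputable def diagramSum {H : Type} [Fintype H] [DecidableEq H] (bs : List (List H))
    (es : List (H × H)) : k :=
  ∑ j : H → ι, A.diagramTerm e p bs es j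

variable {e p} (he : ∀ i, e i ∈ 𝒲 (p i))
include he

omit [Fintype ι] [DecidableEq ι] in
theorem isHomogeneousList_map {H : Type} (j : H → ι) (b : List H) :
    IsHomogeneousList 𝒲 (b.map fun x => (e (j x), p (j x))) := by
  intro x hx
  obtain ⟨y, -, rfl⟩ := List.mem_map.mp hx
  exact he _

omit [Fintype ι] [DecidableEq ι] in
theorem loweredList_map_eq_zero {H : Type} (j : H → ι) {b : List H}
    (h : listParity (fun x => p (j x)) b ≠ 1) : A.loweredList (b.map fun x => e (j x)) = 0 := by
  have := A.loweredList_eq_zero (isHomogeneousList_map he j b) (by simpa using h)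
  simpa [Function.comp_def] using this

omit [Fintype ι] [DecidableEq ι] in
theorem loweredList_map_rotate {H : Type} (j : H → ι) (u v : List H) :
    A.loweredList ((u ++ v).map fun x => e (j x)) =
      A.loweredList ((v ++ u).map fun x => e (j x)) := by
  have := A.loweredList_rotate' (u.map fun x => (e (j x), p (j x)))
    (v.map fun x => (e (j x), p (j x))) (by
      rw [← List.map_append]
      exact isHomogeneousList_map he j _)
  simpa [Function.comp_def] using this

variable {H : Type} [Fintype H] [DecidableEq H]

/-- The index sign is `(-1)^{|u||v|}`. If the block is odd, one of `u` and `v` is even and the sign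
is 1; if it is even, the form vanishes. The forms themselves are cyclic without sign. -/
theorem diagramTerm_rotate {bs bs' : List (List H)} {u v : List H} {es : List (H × H)}
    (h : IsDiagram (bs ++ (u ++ v) :: bs') es) (j : H → ι) :
    A.diagramTerm e p (bs ++ (u ++ v) :: bs') es j =
      A.diagramTerm e p (bs ++ (v ++ u) :: bs') es j := by
  unfold diagramTerm
  simp only [List.map_append (l₁ := bs), List.map_cons (l := bs'), List.prod_append,
    List.prod_cons, A.loweredList_map_rotate he j v u]
  by_cases hp : listParity (fun x => p (j x)) (u ++ v) = 1
  · have hs := contractionSign_swap (k := k) (A := bs.flatten) (B := u) (C := v)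
      (D := bs'.flatten) (M := arrowEnds es) (by simpa using h.1) (by simpa using h.2) h.4
      (fun x => p (j x))
    have h0 : listParity (fun x => p (j x)) u * listParity (fun x => p (j x)) v = 0 := by
      rw [listParity_append] at hp
      exact (by decide : ∀ a b : ZMod 2, a + b = 1 → a * b = 0) _ _ hp
    rw [h0, paritySign_zero, one_mul] at hs
    congr 2
    simpa using hs
  · rw [A.loweredList_map_eq_zero he j hp]
    simp

/-- Only labellings with both blocks odd contribute. The signs of moving `b` and `c` past the blocks
between them cancel, and passing one odd block over the other leaves `-1`. -/
theorem diagramTerm_swap {bs₁ bs₂ bs₃ : List (List H)} {b c : List H} {es : List (H × H)}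
    (h : IsDiagram (bs₁ ++ b :: (bs₂ ++ c :: bs₃)) es) (j : H → ι) :
    A.diagramTerm e p (bs₁ ++ c :: (bs₂ ++ b :: bs₃)) es j =
      -A.diagramTerm e p (bs₁ ++ b :: (bs₂ ++ c :: bs₃)) es j := by
  unfold diagramTerm
  simp only [List.map_append, List.map_cons, List.prod_append, List.prod_cons]
  by_cases hb : listParity (fun x => p (j x)) b = 1
  · by_cases hc : listParity (fun x => p (j x)) c = 1
    · have hs := contractionSign_swap (k := k) (A := bs₁.flatten) (B := b)
        (C := bs₂.flatten ++ c) (D := bs₃.flatten) (M := arrowEnds es) (by simpa using h.1)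
        (by simpa using h.2) h.4 (fun x => p (j x))
      have hp : (bs₁.flatten ++ (b ++ (bs₂.flatten ++ c ++ bs₃.flatten))).Perm
          (bs₁.flatten ++ (bs₂.flatten ++ (c ++ (b ++ bs₃.flatten)))) := by
        refine List.Perm.append_left _ ?_
        simpa using List.Perm.append_right bs₃.flatten
          (List.perm_append_comm (l₁ := b) (l₂ := bs₂.flatten ++ c))
      have hs2 := contractionSign_swap (k := k) (A := bs₁.flatten) (B := bs₂.flatten)
        (C := c) (D := b ++ bs₃.flatten) (M := arrowEnds es)
        (hp.nodup_iff.mp (by simpa using h.1))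
        (fun x => hp.subset (by simpa using h.2 x)) h.4 (fun x => p (j x))
      rw [List.append_assoc, List.append_assoc, hs2, listParity_append, hb, hc, one_mul, mul_one,
        paritySign_add, paritySign_one, ← mul_assoc, mul_right_comm (paritySign k _),
        paritySign_mul_self] at hs
      simp only [List.flatten_append, List.flatten_cons] at hs ⊢
      rw [hs]
      ring
    · rw [A.loweredList_map_eq_zero he j hc]
      simp
  · rw [A.loweredList_map_eq_zero he j hb]
    simp

/-- Either every arrow is even and moves freely, or some arrow joins different parities and its
factor of `K` is zero. -/
theorem diagramTerm_perm {bs : List (List H)} {es es' : List (H × H)} (h : IsDiagram bs es)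
    (hp : es.Perm es') (j : H → ι) :
    A.diagramTerm e p bs es j = A.diagramTerm e p bs es' j := by
  unfold diagramTerm
  rw [(hp.map _).prod_eq]
  by_cases h0 : ∀ a ∈ es, p (j a.1) = p (j a.2)
  · rw [contractionSign_comm bs.flatten, contractionSign_comm bs.flatten]
    have := contractionSign_perm_arrows (k := k) h.2 (fun x => p (j x)) hp h0 [] h.3 h.4
    simp only [List.nil_append] at this
    rw [this]
  · push Not at h0
    obtain ⟨a, ha, hne⟩ := h0
    have : (es'.map fun a => A.copairing e (j a.1) (j a.2)).prod = 0 :=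
      List.prod_eq_zero (List.mem_map.mpr ⟨a, hp.subset ha, A.copairing_eq_zero he hne⟩)
    rw [this, mul_zero, mul_zero]

/-- Exchanging the two adjacent indices of the arrow costs `(-1)^{p a p b}`, which is exactly the
sign in `copairing_antisymm`; only the `-1` remains. -/
theorem diagramTerm_reverse {bs : List (List H)} {es es' : List (H × H)} {a b : H}
    (h : IsDiagram bs (es ++ (a, b) :: es')) (j : H → ι) :
    A.diagramTerm e p bs (es ++ (b, a) :: es') j = -A.diagramTerm e p bs (es ++ (a, b) :: es') j := by
  unfold diagramTerm
  have hs := contractionSign_swap (k := k) (A := arrowEnds es) (B := [a]) (C := [b])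
    (D := arrowEnds es') (M := bs.flatten) (by simpa using h.3) (by simpa using h.4) h.2
    (fun x => p (j x))
  simp only [List.cons_append, List.nil_append, listParity_cons, listParity_nil, add_zero] at hs
  simp only [arrowEnds_append, arrowEnds_cons, List.map_append, List.map_cons, List.prod_append,
    List.prod_cons]
  rw [contractionSign_comm bs.flatten, contractionSign_comm bs.flatten, hs,
    A.copairing_antisymm he (j a) (j b)]
  ring

omit he

theorem diagramTerm_map {H' : Type} [Fintype H'] [DecidableEq H'] (f : H ≃ H')
    (bs : List (List H)) (es : List (H × H)) (j : H' → ι) :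
    A.diagramTerm e p (bs.map (List.map f)) (es.map (Prod.map f f)) j =
      A.diagramTerm e p bs es (fun x => j (f x)) := by
  unfold diagramTerm
  rw [arrowEnds_map, ← List.map_flatten, contractionSign_map]
  simp [Function.comp_def]

theorem diagramSum_map {H' : Type} [Fintype H'] [DecidableEq H'] (f : H ≃ H')
    (bs : List (List H)) (es : List (H × H)) :
    A.diagramSum e p (bs.map (List.map f)) (es.map (Prod.map f f)) = A.diagramSum e p bs es := by
  unfold diagramSum
  simp only [diagramTerm_map]
  exact (f.arrowCongr (Equiv.refl ι)).symm.sum_comp fun j => A.diagramTerm e p bs es j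

end CyclicAInfinity

/-! ### Independence of the homogeneous basis. -/

namespace CyclicAInfinity

variable {k : Type*} [Field k] {W : Type*} [AddCommGroup W] [Module k W]
  {𝒲 : ZMod 2 → Submodule k W} (A : CyclicAInfinity 𝒲) {ι : Type*} [Fintype ι] [DecidableEq ι]
  {e : Module.Basis ι k W} {p : ι → ZMod 2}
  {H : Type} [Fintype H] [DecidableEq H]

-- Without repetitions among the half-edges, `x` occurs once in one block. Changing its vector
-- affects a single slot of a single factor.
omit [Fintype H] in
theorem exists_linear_prod_loweredList {bs : List (List H)} (hn : bs.flatten.Nodup) {x : H}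
    (hx : x ∈ bs.flatten) (w : H → W) :
    ∃ φ : W →ₗ[k] k, ∀ u,
      (bs.map fun b => A.loweredList (b.map (Function.update w x u))).prod = φ u := by
  obtain ⟨b, hb, hxb⟩ := List.mem_flatten.mp hx
  obtain ⟨B₁, B₂, rfl⟩ := List.append_of_mem hb
  obtain ⟨l, r, rfl⟩ := List.append_of_mem hxb
  have hmap : ∀ (t : List H) (u : W), x ∉ t → t.map (Function.update w x u) = t.map w :=
    fun t u ht => List.map_congr_left fun y hy =>
      Function.update_of_ne (by rintro rfl; exact ht hy) _ _
  simp only [List.flatten_append, List.flatten_cons, List.nodup_append, List.nodup_cons,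
    List.mem_append, List.mem_cons] at hn
  have hl : x ∉ l := fun h => hn.2.1.1.2.2 x h x (Or.inl rfl) rfl
  have hr : x ∉ r := hn.2.1.1.2.1.1
  have hB₁ : ∀ b ∈ B₁, x ∉ b := fun b hb h =>
    hn.2.2 x (List.mem_flatten.mpr ⟨b, hb, h⟩) x (Or.inl (Or.inr (Or.inl rfl))) rfl
  have hB₂ : ∀ b ∈ B₂, x ∉ b := fun b hb h =>
    hn.2.1.2.2 x (Or.inr (Or.inl rfl)) x (List.mem_flatten.mpr ⟨b, hb, h⟩) rfl
  obtain ⟨φ, hφ⟩ := A.exists_linear_loweredList (l.map w) (r.map w)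
  refine ⟨((B₁.map fun b => A.loweredList (b.map w)).prod *
    (B₂.map fun b => A.loweredList (b.map w)).prod) • φ, fun u => ?_⟩
  have e₁ : (B₁.map fun b => A.loweredList (b.map (Function.update w x u))) =
      B₁.map fun b => A.loweredList (b.map w) :=
    List.map_congr_left fun b hb => by rw [hmap b u (hB₁ b hb)]
  have e₂ : (B₂.map fun b => A.loweredList (b.map (Function.update w x u))) =
      B₂.map fun b => A.loweredList (b.map w) :=
    List.map_congr_left fun b hb => by rw [hmap b u (hB₂ b hb)]
  rw [List.map_append, List.map_cons, List.prod_append, List.prod_cons, e₁, e₂, List.map_append,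
    List.map_cons, hmap l u hl, hmap r u hr, Function.update_self, hφ]
  simp only [LinearMap.smul_apply, smul_eq_mul]
  ring

/-- The product of the forms at the blocks, as a multilinear map. -/
def blocksForm {bs : List (List H)} (hn : bs.flatten.Nodup) (hm : ∀ x, x ∈ bs.flatten) :
    MultilinearMap k (fun _ : H => W) k where
  toFun w := (bs.map fun b => A.loweredList (b.map w)).prod
  map_update_add' {inst} w x u v := by
    rw [Subsingleton.elim inst ‹DecidableEq H›]
    obtain ⟨φ, hφ⟩ := A.exists_linear_prod_loweredList hn (hm x) w
    rw [hφ, hφ, hφ, map_add]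
  map_update_smul' {inst} w x c u := by
    rw [Subsingleton.elim inst ‹DecidableEq H›]
    obtain ⟨φ, hφ⟩ := A.exists_linear_prod_loweredList hn (hm x) w
    rw [hφ, hφ, map_smul]

theorem arrow_bijective {es : List (H × H)} (hn : (arrowEnds es).Nodup)
    (hm : ∀ x, x ∈ arrowEnds es) :
    Function.Bijective fun i : Fin es.length × Bool => if i.2 then es[i.1].1 else es[i.1].2 := by
  refine (Fintype.bijective_iff_surjective_and_card _).mpr ⟨fun x => ?_, ?_⟩
  · obtain ⟨a, ha, hx⟩ := List.mem_flatMap.mp (hm x)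
    obtain ⟨i, hi, rfl⟩ := List.mem_iff_getElem.mp ha
    simp only [List.mem_cons, List.not_mem_nil, or_false] at hx
    rcases hx with rfl | rfl
    · exact ⟨(⟨i, hi⟩, true), rfl⟩
    · exact ⟨(⟨i, hi⟩, false), rfl⟩
  · have h : (Finset.univ : Finset H) = (arrowEnds es).toFinset := by ext; simp [hm]
    have hl : ∀ es : List (H × H), (arrowEnds es).length = es.length * 2 := by
      intro es
      induction es with
      | nil => rfl
      | cons a es ih => simp [ih]; ring
    rw [← Finset.card_univ (α := H), h, List.toFinset_card_of_nodup hn, hl]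
    simp

/-- The arrows partition the half-edges into pairs, so a labelling is an independent choice of two
labels for each arrow, and the sum of products factors over the arrows. -/
theorem sum_prod_arrows {ι' : Type*} [Fintype ι'] [DecidableEq ι'] {es : List (H × H)}
    (hn : (arrowEnds es).Nodup) (hm : ∀ x, x ∈ arrowEnds es) (P : H → ι' → k)
    (K : ι' → ι' → k) :
    ∑ j : H → ι', (∏ x, P x (j x)) * (es.map fun a => K (j a.1) (j a.2)).prod =
      (es.map fun a => ∑ α, ∑ β, P a.1 α * P a.2 β * K α β).prod := by
  classical
  set f := Equiv.ofBijective _ (arrow_bijective hn hm) with hf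
  have hf1 : ∀ i : Fin es.length, f (i, true) = es[i].1 := fun i => rfl
  have hf2 : ∀ i : Fin es.length, f (i, false) = es[i].2 := fun i => rfl
  have hlist : ∀ G : H × H → k, (es.map G).prod = ∏ i : Fin es.length, G es[i] := by
    intro G
    exact (Fin.prod_univ_fun_getElem es G).symm
  simp only [hlist]
  simp only [← Fintype.sum_prod_type' (f := fun α β => P _ α * P _ β * K α β)]
  rw [Finset.prod_univ_sum, Fintype.piFinset_univ]
  let g : (Fin es.length → ι' × ι') ≃ (H → ι') :=
    ((Equiv.arrowCongr (Equiv.refl _) (Equiv.boolArrowEquivProd ι').symm).trans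
      (Equiv.curry _ _ _).symm).trans (Equiv.arrowCongr f (Equiv.refl _))
  have hg : ∀ j i, g j (f i) = if i.2 then (j i.1).2 else (j i.1).1 := by
    rintro j ⟨i, b⟩
    change Function.uncurry (fun i => (Equiv.boolArrowEquivProd ι').symm (j i)) (f.symm (f (i, b))) = _
    rw [Equiv.symm_apply_apply]
    cases b <;> rfl
  -- `Equiv.boolArrowEquivProd` lists the value at `false`, here the head, first; this exchange puts
  -- the tail first.
  let s : (Fin es.length → ι' × ι') ≃ (Fin es.length → ι' × ι') :=
    Equiv.arrowCongr (Equiv.refl _) (Equiv.prodComm _ _)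
  rw [← (s.trans g).sum_comp]
  refine Finset.sum_congr rfl fun j _ => ?_
  have h1 : ∀ i : Fin es.length, (s.trans g) j es[i].1 = (j i).1 := by
    intro i
    rw [← hf1, Equiv.trans_apply, hg]
    rfl
  have h2 : ∀ i : Fin es.length, (s.trans g) j es[i].2 = (j i).2 := by
    intro i
    rw [← hf2, Equiv.trans_apply, hg]
    rfl
  rw [← f.prod_comp, Fintype.prod_prod_type, ← Finset.prod_mul_distrib]
  refine Finset.prod_congr rfl fun i _ => ?_
  rw [Fintype.prod_bool, hf1, hf2, h1, h2]

/-- Expand every vector of the new basis in the old one. After exchanging the sums over the two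
kinds of labellings, the coefficients at the two ends of each arrow combine with `K` in the new
basis to give `K` in the old one. -/
theorem diagramSum_change_basis (h𝒲 : DirectSum.IsInternal 𝒲) (he : ∀ i, e i ∈ 𝒲 (p i))
    {ι' : Type*} [Fintype ι'] [DecidableEq ι'] {e' : Module.Basis ι' k W} {p' : ι' → ZMod 2}
    (he' : ∀ i, e' i ∈ 𝒲 (p' i)) {bs : List (List H)} {es : List (H × H)}
    (h : IsDiagram bs es) :
    A.diagramSum e' p' bs es = A.diagramSum e p bs es := by
  have hexp : ∀ j' : H → ι', (bs.map fun b => A.loweredList (b.map fun x => e' (j' x))).prod =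
      ∑ j : H → ι, (∏ x, e.repr (e' (j' x)) (j x)) *
        (bs.map fun b => A.loweredList (b.map fun x => e (j x))).prod := by
    intro j'
    have h1 : (fun x => e' (j' x)) = fun x => ∑ i, e.repr (e' (j' x)) i • e i := by
      funext x
      exact (e.sum_repr _).symm
    change A.blocksForm h.1 h.2 (fun x => e' (j' x)) = _
    rw [h1, MultilinearMap.map_sum]
    refine Finset.sum_congr rfl fun j _ => ?_
    rw [MultilinearMap.map_smul_univ]
    rfl
  unfold diagramSum diagramTerm
  simp only [hexp, Finset.mul_sum, Finset.sum_mul]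
  rw [Finset.sum_comm]
  refine Finset.sum_congr rfl fun j _ => ?_
  have hK : ∀ a : H × H, A.copairing e (j a.1) (j a.2) = ∑ α, ∑ β,
      e.repr (e' α) (j a.1) * e.repr (e' β) (j a.2) * A.copairing e' α β :=
    fun a => A.copairing_change_basis e e' _ _
  simp only [hK]
  refine Eq.trans ?_ (congrArg _ (sum_prod_arrows h.3 h.4 (fun x α => e.repr (e' α) (j x))
    (fun α β => A.copairing e' α β)))
  rw [Finset.mul_sum]
  refine Finset.sum_congr rfl fun j' _ => ?_
  -- The sign depends on the new labels only through their parities. A nonzero product of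
  -- coefficients forces these to be the parities of the old labels.
  by_cases hp : ∀ x, p (j x) = p' (j' x)
  · simp only [hp]
    ring
  · push Not at hp
    obtain ⟨x, hx⟩ := hp
    have : ∏ x, e.repr (e' (j' x)) (j x) = 0 :=
      Finset.prod_eq_zero (Finset.mem_univ x) (repr_eq_zero he h𝒲 (he' _) hx)
    rw [this]
    simp

end CyclicAInfinity

/-! ### Splitting a block along a new edge. -/

section SignExpand

variable {k : Type*} [Field k] {H : Type} [Fintype H] [DecidableEq H]

/-- The indices `a`, `b` stand in the same order in both lists, relative to each other and to all
that follows, so each such pair contributes its sign. -/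
theorem contractionSign_cons_cons {T : Type} [Fintype T] [DecidableEq T] {i : H → T} {a b : T}
    (hi : Function.Injective i) (hab : a ≠ b) (ha : ∀ x, a ≠ i x) (hb : ∀ x, b ≠ i x)
    (hT : ∀ t, t = a ∨ t = b ∨ ∃ x, i x = t) {L M : List H} (hL : L.Nodup) (hL' : ∀ x, x ∈ L)
    (q : T → ZMod 2) :
    contractionSign k (a :: b :: L.map i) (a :: b :: M.map i) q =
      paritySign k (q a * q b) *
        paritySign k ((q a + q b) * listParity (fun x => q (i x)) L) *
        contractionSign k L M (fun x => q (i x)) := by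
  have hn : (a :: b :: L.map i).Nodup := by
    simp only [List.nodup_cons, List.nodup_map_iff hi, hL, List.mem_cons, List.mem_map, hab,
      false_or, and_true]
    exact ⟨fun ⟨x, _, hx⟩ => ha x hx.symm, fun ⟨x, _, hx⟩ => hb x hx.symm⟩
  have hm : ∀ x, x ∈ (a :: b :: L.map i) := by
    intro t
    rcases hT t with rfl | rfl | ⟨x, rfl⟩ <;> simp [hL']
  rw [contractionSign_eq_pairProd hn hm, contractionSign_eq_pairProd hL hL']
  have hl : ∀ x : H, (a :: b :: M.map i).idxOf (i x) = M.idxOf x + 2 := by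
    intro x
    rw [List.idxOf_cons_ne _ (ha x), List.idxOf_cons_ne _ (hb x), idxOf_map_of_injective hi]
  have hf : (a :: b :: M.map i).idxOf b = 1 := by
    rw [List.idxOf_cons_ne _ hab, List.idxOf_cons_self]
  simp only [pairProd, pairProd_map, List.map_cons, List.prod_cons, List.map_map,
    Function.comp_def, hl, hf, List.idxOf_cons_self, if_true, Nat.zero_lt_succ,
    show ∀ n, 1 < n + 2 from fun n => by omega, add_lt_add_iff_right]
  rw [prod_map_paritySign (fun x => q (i x)), prod_map_paritySign (fun x => q (i x)),
    add_mul, paritySign_add]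
  ring

end SignExpand

theorem IsDiagram.expand {H : Type} {bs : List (List H)} {X Y : List H} {es : List (H × H)}
    (h : IsDiagram (bs ++ [X ++ Y]) es) :
    IsDiagram (bs.map (List.map Sum.inl) ++
      [Sum.inr true :: X.map Sum.inl, Sum.inr false :: Y.map Sum.inl] : List (List (H ⊕ Bool)))
      ((Sum.inr true, Sum.inr false) :: es.map (Prod.map Sum.inl Sum.inl)) := by
  have h0 : IsDiagram ([[Sum.inr true, Sum.inr false], (bs ++ [X ++ Y]).flatten.map Sum.inl] :
      List (List (H ⊕ Bool)))
      ((Sum.inr true, Sum.inr false) :: es.map (Prod.map Sum.inl Sum.inl)) := by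
    refine ⟨?_, ?_, ?_, ?_⟩
    · simp only [List.flatten_cons, List.flatten_nil, List.append_nil, List.cons_append,
        List.nil_append]
      simp only [List.nodup_cons, List.nodup_map_iff Sum.inl_injective, h.1]
      simp
    · have := h.2
      rintro (x | _ | _)
      · have := this x
        simp at this ⊢
        exact this
      · simp
      · simp
    · rw [arrowEnds_cons, arrowEnds_map]
      simp [List.nodup_map_iff Sum.inl_injective, h.3]
    · rw [arrowEnds_cons, arrowEnds_map]
      rintro (x | _ | _) <;> simp [h.4]
  refine h0.of_perm ?_ (List.Perm.refl _)
  simp only [List.flatten_cons, List.flatten_nil, List.append_nil, List.cons_append,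
    List.nil_append, List.flatten_append, List.map_append, List.map_flatten]
  set B := (List.map (List.map (Sum.inl : H → H ⊕ Bool)) bs).flatten
  have p1 : (Sum.inr true :: Sum.inr false :: (B ++ (X.map Sum.inl ++ Y.map Sum.inl)) :
      List (H ⊕ Bool)).Perm
      (Sum.inr true :: (B ++ X.map Sum.inl ++ Sum.inr false :: Y.map Sum.inl)) := by
    refine List.Perm.cons _ ?_
    rw [← List.append_assoc]
    exact List.perm_middle.symm
  refine p1.trans ?_
  rw [List.append_assoc]
  exact List.perm_middle.symm

/-- Let `a` be the parity of the new half-edges. Moving the first to the front past `B` costs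
`(-1)^{ab}`, moving the second behind it past `B` and `X` costs `(-1)^{a(b+x)}`, and removing both
costs `(-1)^{aa}`. The total exponent is `a(x + 1)`, which is `a` because `a + x = 1`. -/
theorem contractionSign_expand {k : Type*} [Field k] {H : Type} [Fintype H] [DecidableEq H]
    {bs : List (List H)} {X Y : List H} {es : List (H × H)}
    (h : IsDiagram (bs ++ [X ++ Y]) es) (q : H ⊕ Bool → ZMod 2)
    (hq : q (Sum.inr true) = q (Sum.inr false))
    (hX : q (Sum.inr true) + listParity (fun x => q (Sum.inl x)) X = 1) :
    contractionSign k (bs.map (List.map Sum.inl) ++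
        [Sum.inr true :: X.map Sum.inl, Sum.inr false :: Y.map Sum.inl]).flatten
        (arrowEnds ((Sum.inr true, Sum.inr false) :: es.map (Prod.map Sum.inl Sum.inl))) q =
      paritySign k (q (Sum.inr true)) *
        contractionSign k (bs.flatten ++ (X ++ Y)) (arrowEnds es) (fun x => q (Sum.inl x)) := by
  have hE := h.expand
  have hd : IsDiagram [bs.flatten ++ (X ++ Y)] es :=
    h.of_perm (by simp) (List.Perm.refl _)
  set B := (bs.map (List.map (Sum.inl : H → H ⊕ Bool))).flatten with hB
  have hflat : (bs.map (List.map Sum.inl) ++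
      [Sum.inr true :: X.map Sum.inl, Sum.inr false :: Y.map Sum.inl] :
        List (List (H ⊕ Bool))).flatten =
      [] ++ (B ++ ([Sum.inr true] ++ (X.map Sum.inl ++ Sum.inr false :: Y.map Sum.inl))) := by
    simp [hB]
  have s1 := contractionSign_swap (k := k) (by rw [← hflat]; exact hE.1)
    (by rw [← hflat]; exact hE.2) hE.4 q
  have hp1 : ([] ++ (B ++ ([Sum.inr true] ++ (X.map Sum.inl ++ Sum.inr false :: Y.map Sum.inl)))).Perm
      ([Sum.inr true] ++ ((B ++ X.map Sum.inl) ++ ([Sum.inr false] ++ Y.map Sum.inl))) := by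
    simp only [List.nil_append, List.cons_append, List.append_assoc]
    exact List.perm_middle
  have s2 := contractionSign_swap (k := k) (hp1.nodup_iff.mp (by rw [← hflat]; exact hE.1))
    (fun x => hp1.subset (by rw [← hflat]; exact hE.2 x)) hE.4 q
  rw [hflat, s1]
  rw [show ([] ++ ([Sum.inr true] ++ (B ++ (X.map Sum.inl ++ Sum.inr false :: Y.map Sum.inl)))) =
    ([Sum.inr true] ++ ((B ++ X.map Sum.inl) ++ ([Sum.inr false] ++ Y.map Sum.inl))) by simp, s2]
  rw [show ([Sum.inr true] ++ ([Sum.inr false] ++ ((B ++ X.map Sum.inl) ++ Y.map Sum.inl))) =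
    Sum.inr true :: Sum.inr false :: (bs.flatten ++ (X ++ Y)).map Sum.inl by
      simp [hB, List.map_flatten]]
  rw [arrowEnds_cons, arrowEnds_map,
    contractionSign_cons_cons Sum.inl_injective (by simp) (by simp) (by simp)
      (by rintro (x | _ | _) <;> simp) (by simpa using hd.1) (by simpa using hd.2), hq]
  simp only [listParity_append, listParity_cons, listParity_nil, listParity_map, hq]
  rw [hq] at hX
  generalize listParity q B = b
  generalize listParity (fun x => q (Sum.inl x)) X = x at hX ⊢
  generalize listParity (fun x => q (Sum.inl x)) bs.flatten = b'
  generalize listParity (fun x => q (Sum.inl x)) Y = y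
  generalize q (Sum.inr false) = a at hX ⊢
  rw [← mul_assoc, ← mul_assoc, ← mul_assoc, ← paritySign_add, ← paritySign_add, ← paritySign_add]
  congr 2
  revert a b x b' y
  decide

namespace CyclicAInfinity

variable {k : Type*} [Field k] {W : Type*} [AddCommGroup W] [Module k W]
  {𝒲 : ZMod 2 → Submodule k W} (A : CyclicAInfinity 𝒲) {ι : Type*} [Fintype ι] [DecidableEq ι]
  (e : Module.Basis ι k W) (p : ι → ZMod 2)
  {H : Type} [Fintype H] [DecidableEq H]

/-- The summand of the contraction of a diagram in which the last block is the composite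
`d(X) ∘ Y`. -/
noncomputable def compositeTerm (bs : List (List H)) (X Y : List H) (es : List (H × H))
    (j : H → ι) : k :=
  contractionSign k (bs.flatten ++ (X ++ Y)) (arrowEnds es) (fun x => p (j x)) *
    (bs.map fun b => A.loweredList (b.map fun x => e (j x))).prod *
    A.loweredList (A.dList (X.map fun x => e (j x)) :: Y.map fun x => e (j x)) *
    (es.map fun a => A.copairing e (j a.1) (j a.2)).prod

variable {e p} (he : ∀ i, e i ∈ 𝒲 (p i))
include he

/-- Sum first over the labels `α` and `β` of the two halves of the new edge. By cyclicity the tail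
block is `⟨d(X), e_α⟩`, and summing `k^{βα} ⟨d(X), e_α⟩ e_β` gives back `d(X)`, which lands in the
first slot of the other block. The arrow carries `k^{αβ} = -(-1)^{p α p β} k^{βα}`; its sign cancels
that of `contractionSign_expand` up to the overall `-1`. -/
theorem diagramSum_expand {bs : List (List H)} {X Y : List H} {es : List (H × H)}
    (h : IsDiagram (bs ++ [X ++ Y]) es) :
    A.diagramSum e p (bs.map (List.map Sum.inl) ++
        [Sum.inr true :: X.map Sum.inl, Sum.inr false :: Y.map Sum.inl])
        ((Sum.inr true, Sum.inr false) :: es.map (Prod.map Sum.inl Sum.inl)) =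
      -∑ j, A.compositeTerm e p bs X Y es j := by
  unfold diagramSum
  rw [← (((Equiv.refl (H → ι)).prodCongr (Equiv.boolArrowEquivProd ι).symm).trans
    (Equiv.sumArrowEquivProdArrow H Bool ι).symm).sum_comp, Fintype.sum_prod_type,
    ← Finset.sum_neg_distrib]
  refine Finset.sum_congr rfl fun j _ => ?_
  rw [Fintype.sum_prod_type]
  set F : ι → ι → (H ⊕ Bool → ι) := fun β α => Sum.elim j fun b => if b then α else β with hF
  have hFl : ∀ β α x, F β α (Sum.inl x) = j x := fun _ _ _ => rfl
  have hterm : ∀ β α, A.diagramTerm e p (bs.map (List.map Sum.inl) ++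
        [Sum.inr true :: X.map Sum.inl, Sum.inr false :: Y.map Sum.inl])
        ((Sum.inr true, Sum.inr false) :: es.map (Prod.map Sum.inl Sum.inl)) (F β α) =
      -(contractionSign k (bs.flatten ++ (X ++ Y)) (arrowEnds es) (fun x => p (j x)) *
        (bs.map fun b => A.loweredList (b.map fun x => e (j x))).prod *
        (es.map fun a => A.copairing e (j a.1) (j a.2)).prod *
        (A.copairing e β α * A.form (A.dList (X.map fun x => e (j x))) (e α) *
        A.loweredList (e β :: Y.map fun x => e (j x)))) := by
    intro β α
    have hcyc : A.form (A.dList (X.map fun x => e (j x))) (e α) =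
        A.loweredList ((Sum.inr true :: X.map Sum.inl).map fun x => e (F β α x)) := by
      rw [← List.singleton_append, A.loweredList_map_rotate he, List.map_append, List.map_map,
        List.map_cons, List.map_nil, loweredList_concat]
      rfl
    have hY : (e β :: Y.map fun x => e (j x)) =
        (Sum.inr false :: Y.map Sum.inl).map fun x => e (F β α x) := by
      simp [Function.comp_def, F]
    unfold diagramTerm
    simp only [List.map_append, List.map_cons (l := []), List.map_cons (l := es.map _),
      List.map_cons (l := [_]), List.map_nil,
      List.prod_append, List.prod_cons, List.prod_nil, mul_one, List.map_map,
      ← hcyc, ← hY]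
    simp only [Function.comp_def, List.map_map, Prod.map_fst, Prod.map_snd, hFl]
    have hFt : F β α (Sum.inr true) = α := rfl
    have hFf : F β α (Sum.inr false) = β := rfl
    simp only [hFt, hFf]
    by_cases hαβ : p α = p β
    · by_cases hX : p α + listParity (fun x => p (j x)) X = 1
      · have := contractionSign_expand (k := k) h (fun x => p (F β α x)) hαβ hX
        rw [this, A.copairing_antisymm he α β, hFt, hαβ]
        have h2 : p β * p β = p β := (by decide : ∀ i : ZMod 2, i * i = i) _
        rw [h2]
        simp only [hFl]
        ring
      · have h0 : A.form (A.dList (X.map fun x => e (j x))) (e α) = 0 := by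
          rw [hcyc]
          exact A.loweredList_map_eq_zero he _ (by
            rw [listParity_cons, listParity_map]; exact hX)
        rw [h0]
        ring
    · rw [A.copairing_eq_zero he hαβ, A.copairing_eq_zero he (Ne.symm hαβ)]
      ring
  have hbody : ∀ β α, A.diagramTerm e p (bs.map (List.map Sum.inl) ++
        [Sum.inr true :: X.map Sum.inl, Sum.inr false :: Y.map Sum.inl])
        ((Sum.inr true, Sum.inr false) :: es.map (Prod.map Sum.inl Sum.inl))
        ((((Equiv.refl (H → ι)).prodCongr (Equiv.boolArrowEquivProd ι).symm).trans
    (Equiv.sumArrowEquivProdArrow H Bool ι).symm) (j, (β, α))) = _ := fun β α => by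
    refine Eq.trans ?_ (hterm β α)
    congr 1
  simp only [hbody]
  simp only [Finset.sum_neg_distrib, ← Finset.mul_sum]
  congr 1
  unfold compositeTerm
  -- Linearity in the first slot brings the sum over `β` inside the form.
  obtain ⟨φ, hφ⟩ := A.exists_linear_loweredList [] (Y.map fun x => e (j x))
  simp only [List.nil_append] at hφ
  simp only [hφ, ← Finset.sum_mul]
  conv_rhs => rw [← A.sum_copairing_smul e (A.dList (X.map fun x => e (j x)))]
  simp only [map_sum, map_smul, smul_eq_mul]
  ring

end CyclicAInfinity

/-! ### The codifferential equation for composites of two vertices. -/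

namespace CyclicAInfinity

variable {k : Type*} [Field k] {W : Type*} [AddCommGroup W] [Module k W]
  {𝒲 : ZMod 2 → Submodule k W} (A : CyclicAInfinity 𝒲) {ι : Type*} [Fintype ι] [DecidableEq ι]
  {e : Module.Basis ι k W} {p : ι → ZMod 2}
  {H : Type} [Fintype H] [DecidableEq H] (he : ∀ i, e i ∈ 𝒲 (p i))
include he

omit [Fintype ι] [DecidableEq ι] [Fintype H] [DecidableEq H] in
theorem dList_map_mem (j : H → ι) (b : List H) :
    A.dList (b.map fun x => e (j x)) ∈ 𝒲 (1 + listParity (fun x => p (j x)) b) := by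
  have := A.dList_mem (isHomogeneousList_map he j b)
  simpa [Function.comp_def] using this

omit [Fintype ι] [DecidableEq ι] [Fintype H] [DecidableEq H] in
theorem loweredList_composite_rotate (j : H → ι) (X l r : List H) :
    A.loweredList (A.dList (X.map fun x => e (j x)) :: (r ++ l).map fun x => e (j x)) =
      A.loweredList (l.map (fun x => e (j x)) ++
        A.dList (X.map fun x => e (j x)) :: r.map fun x => e (j x)) := by
  have := A.loweredList_rotate' (l.map fun x => (e (j x), p (j x)))
    ((A.dList (X.map fun x => e (j x)), 1 + listParity (fun x => p (j x)) X) ::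
      r.map fun x => (e (j x), p (j x))) (by
      intro y hy
      rw [List.mem_append, List.mem_cons] at hy
      rcases hy with hy | rfl | hy
      · exact isHomogeneousList_map he j l y hy
      · exact A.dList_map_mem he j X
      · exact isHomogeneousList_map he j r y hy)
  simpa [Function.comp_def] using this.symm

-- Rotating `d(X)` to the last place exhibits the composite as an inner product, which makes the
-- roles of `X` and `Y` interchangeable.
omit [Fintype ι] [DecidableEq ι] [Fintype H] [DecidableEq H] in
theorem loweredList_composite (j : H → ι) (X Y : List H) :
    A.loweredList (A.dList (X.map fun x => e (j x)) :: Y.map fun x => e (j x)) =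
      A.form (A.dList (Y.map fun x => e (j x))) (A.dList (X.map fun x => e (j x))) := by
  have := A.loweredList_composite_rotate he j X Y []
  rw [List.nil_append] at this
  rw [this, List.map_nil, loweredList_concat]

omit [Fintype ι] [DecidableEq ι] [Fintype H] [DecidableEq H] in
theorem loweredList_composite_eq_zero (j : H → ι) {X Y : List H}
    (h : listParity (fun x => p (j x)) (X ++ Y) ≠ 0) :
    A.loweredList (A.dList (X.map fun x => e (j x)) :: Y.map fun x => e (j x)) = 0 := by
  rw [A.loweredList_composite he]
  refine A.form_even _ _ _ _ (A.dList_map_mem he j Y) (A.dList_map_mem he j X) fun h' => h ?_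
  rw [listParity_append]
  exact (by decide : ∀ a b : ZMod 2, 1 + b = 1 + a → a + b = 0) _ _ h'

-- A side with one element would be a bivalent vertex. If it is `X`, the inner operation is `d_1`;
-- if it is `Y`, the form is `⟨d_1(d(X)), y⟩`.
omit he in
theorem compositeTerm_eq_zero (hd₁ : A.d 1 = 0) {bs : List (List H)} {X Y : List H}
    {es : List (H × H)} (j : H → ι) (hXY : X.length = 1 ∨ Y.length = 1) :
    A.compositeTerm e p bs X Y es j = 0 := by
  have h : A.loweredList (A.dList (X.map fun x => e (j x)) :: Y.map fun x => e (j x)) = 0 := by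
    rcases hXY with h | h
    · obtain ⟨φ, hφ⟩ := A.exists_linear_loweredList [] (Y.map fun x => e (j x))
      have := hφ (A.dList (X.map fun x => e (j x)))
      rw [List.nil_append] at this
      rw [this, A.dList_eq (n := 1) (by simpa using h), hd₁]
      simp
    · obtain ⟨y, rfl⟩ := List.length_eq_one_iff.mp h
      have := A.loweredList_concat [A.dList (X.map fun x => e (j x))] (e (j y))
      rw [List.singleton_append] at this
      rw [List.map_cons, List.map_nil, this, A.dList_eq (n := 1) rfl, hd₁]
      simp
  rw [compositeTerm, h]
  ring

/-- Exchanging the indices gives `(-1)^{|X||Y|}`, and antisymmetry of the form gives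
`(-1)^{(1+|X|)(1+|Y|)+1}`. For `|X| + |Y| = 0` the product is 1; otherwise both sides vanish. -/
theorem compositeTerm_comm {bs : List (List H)} {X Y : List H} {es : List (H × H)}
    (h : IsDiagram (bs ++ [X ++ Y]) es) (j : H → ι) :
    A.compositeTerm e p bs X Y es j = A.compositeTerm e p bs Y X es j := by
  unfold compositeTerm
  by_cases hp : listParity (fun x => p (j x)) (X ++ Y) = 0
  · have hs := contractionSign_swap (k := k) (A := bs.flatten) (B := X) (C := Y) (D := [])
      (M := arrowEnds es) (by simpa using h.1) (by simpa using h.2) h.4 (fun x => p (j x))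
    rw [List.append_nil, List.append_nil] at hs
    rw [hs, A.loweredList_composite he j X, A.loweredList_composite he j Y,
      A.form_antisymm _ _ _ _ (A.dList_map_mem he j X) (A.dList_map_mem he j Y)]
    have h1 : paritySign k (listParity (fun x => p (j x)) X * listParity (fun x => p (j x)) Y) *
        paritySign k ((1 + listParity (fun x => p (j x)) X) *
          (1 + listParity (fun x => p (j x)) Y) + 1) = 1 := by
      rw [← paritySign_add, ← paritySign_zero k]
      congr 1
      rw [listParity_append] at hp
      exact (by decide : ∀ a b : ZMod 2, a + b = 0 → a * b + ((1 + a) * (1 + b) + 1) = 0) _ _ hp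
    linear_combination contractionSign k (bs.flatten ++ (Y ++ X)) (arrowEnds es)
        (fun x => p (j x)) * (bs.map fun b => A.loweredList (b.map fun x => e (j x))).prod *
      A.form (A.dList (X.map fun x => e (j x))) (A.dList (Y.map fun x => e (j x))) *
      (es.map fun a => A.copairing e (j a.1) (j a.2)).prod * h1
  · rw [A.loweredList_composite_eq_zero he j hp, A.loweredList_composite_eq_zero he j (by
      rw [listParity_append] at hp ⊢
      rwa [add_comm])]
    ring

/-- The `A∞` relation, as a relation between diagrams. -/
theorem sum_compositeTerm {bs : List (List H)} {c : List H} {es : List (H × H)}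
    (h : IsDiagram (bs ++ [c]) es) (j : H → ι) :
    ∑ n ∈ Finset.range c.length, ∑ m ∈ Finset.range n,
      A.compositeTerm e p bs ((c.drop m).take (n - m)) (c.drop n ++ c.take m) es j = 0 := by
  have h0 := A.codifferential_lowered (isHomogeneousList_map he j c)
  set K := contractionSign k (bs.flatten ++ c) (arrowEnds es) (fun x => p (j x)) *
    (bs.map fun b => A.loweredList (b.map fun x => e (j x))).prod *
    (es.map fun a => A.copairing e (j a.1) (j a.2)).prod with hK
  rw [← mul_zero K, ← h0, Finset.mul_sum, List.length_map]
  refine Finset.sum_congr rfl fun n hn => ?_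
  rw [Finset.mul_sum]
  refine Finset.sum_congr rfl fun m hm => ?_
  rw [Finset.mem_range] at hn hm
  have hc : c = c.take m ++ ((c.drop m).take (n - m) ++ c.drop n) := by
    have : c.drop n = (c.drop m).drop (n - m) := by rw [List.drop_drop]; congr 1; omega
    rw [this, List.take_append_drop, List.take_append_drop]
  simp only [← List.map_take, ← List.map_drop, List.map_map, Function.comp_def, listParity_map]
  set l₁ := c.take m
  set l₂ := (c.drop m).take (n - m)
  set l₃ := c.drop n
  rw [← A.loweredList_composite_rotate he j l₂ l₁ l₃]
  unfold compositeTerm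
  by_cases hp : listParity (fun x => p (j x)) (l₂ ++ (l₃ ++ l₁)) = 0
  -- Moving `l₁` behind `l₂ l₃` costs `(-1)^{|l₁|(|l₂|+|l₃|)}`. As the total parity is 0, this is
  -- `(-1)^{|l₁|}`, the very sign of the codifferential equation.
  · have hs := contractionSign_swap (k := k) (A := bs.flatten) (B := l₁) (C := l₂ ++ l₃) (D := [])
      (M := arrowEnds es) (by simpa [← hc] using h.1) (by simpa [← hc] using h.2) h.4
      (fun x => p (j x))
    have h1 : listParity (fun x => p (j x)) l₁ * listParity (fun x => p (j x)) (l₂ ++ l₃) =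
        listParity (fun x => p (j x)) l₁ := by
      rw [listParity_append, listParity_append] at hp
      rw [listParity_append]
      exact (by decide : ∀ a b c : ZMod 2, b + (c + a) = 0 → a * (b + c) = a) _ _ _ hp
    rw [h1, List.append_nil, List.append_nil, ← hc, List.append_assoc] at hs
    rw [hK, hs]
    linear_combination -(contractionSign k (bs.flatten ++ (l₂ ++ (l₃ ++ l₁))) (arrowEnds es)
        (fun x => p (j x)) * (bs.map fun b => A.loweredList (b.map fun x => e (j x))).prod *
      A.loweredList (A.dList (l₂.map fun x => e (j x)) :: (l₃ ++ l₁).map fun x => e (j x)) *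
      (es.map fun a => A.copairing e (j a.1) (j a.2)).prod) *
      paritySign_mul_self k (listParity (fun x => p (j x)) l₁)
  · rw [A.loweredList_composite_eq_zero he j hp]
    ring

end CyclicAInfinity

/-! ### The cyclic list of half-edges at a vertex. -/

namespace RibbonGraph

variable (Γ : RibbonGraph)

theorem valence_pos (s : Γ.H) : 0 < Γ.valence s :=
  Function.minimalPeriod_pos_of_mem_periodicPts (Γ.rot.injective.mem_periodicPts s)

theorem rot_pow_valence (s : Γ.H) : (Γ.rot ^ Γ.valence s) s = s := by
  rw [← Equiv.Perm.iterate_eq_pow]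
  exact Function.iterate_minimalPeriod

/-- The half-edges at the vertex of `s`, in the cyclic order, starting with `s`. -/
noncomputable def block (s : Γ.H) : List Γ.H :=
  (List.range (Γ.valence s)).map fun i => (Γ.rot ^ i) s

@[simp] theorem length_block (s : Γ.H) : (Γ.block s).length = Γ.valence s := by simp [block]

theorem mem_block {s x : Γ.H} : x ∈ Γ.block s ↔ Γ.SameVertex s x := by
  constructor
  · intro h
    obtain ⟨i, -, rfl⟩ := List.mem_map.mp h
    exact ⟨i, by simp⟩
  · intro h
    obtain ⟨n, -, rfl⟩ := Equiv.Perm.SameCycle.exists_pow_eq' h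
    refine List.mem_map.mpr ⟨n % Γ.valence s, by simpa using Nat.mod_lt _ (Γ.valence_pos s), ?_⟩
    rw [← Equiv.Perm.iterate_eq_pow, ← Equiv.Perm.iterate_eq_pow]
    exact Function.iterate_mod_minimalPeriod_eq

theorem nodup_block (s : Γ.H) : (Γ.block s).Nodup := by
  refine List.Nodup.map_on ?_ List.nodup_range
  intro i hi j hj hij
  rw [← Equiv.Perm.iterate_eq_pow, ← Equiv.Perm.iterate_eq_pow] at hij
  exact Function.iterate_injOn_Iio_minimalPeriod (Set.mem_Iio.mpr (List.mem_range.mp hi))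
    (Set.mem_Iio.mpr (List.mem_range.mp hj)) hij

theorem block_chain (s : Γ.H) : List.IsChain (fun x y => Γ.rot x = y) (Γ.block s ++ [s]) := by
  have h : Γ.block s ++ [s] = (List.range (Γ.valence s + 1)).map fun i => (Γ.rot ^ i) s := by
    rw [List.range_succ, List.map_append, List.map_cons, List.map_nil, rot_pow_valence]
    rfl
  rw [h, List.isChain_iff_getElem]
  intro i hi
  simp [pow_succ']

theorem exists_block_eq_cons (s : Γ.H) : ∃ t, Γ.block s = s :: t := by
  obtain ⟨n, hn⟩ : ∃ n, Γ.valence s = n + 1 := ⟨Γ.valence s - 1, by have := Γ.valence_pos s; omega⟩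
  exact ⟨(List.range n).map fun i => (Γ.rot ^ (i + 1)) s, by
    simp [block, hn, List.range_succ_eq_map, Function.comp_def]⟩

/-- The chain condition forces the `i`-th entry to be `rot^i s`, and the absence of repetitions
forces the period to be the length. Blocks of rotated, isomorphic or expanded graphs are identified
in this way without computing valences. -/
theorem block_eq_of_chain {s : Γ.H} {t : List Γ.H} (hn : (s :: t).Nodup)
    (hc : List.IsChain (fun x y => Γ.rot x = y) (s :: t ++ [s])) : Γ.block s = s :: t := by
  have hget : ∀ i (hi : i < (s :: t ++ [s]).length), (s :: t ++ [s])[i] = (Γ.rot ^ i) s := by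
    intro i
    induction i with
    | zero => intro _; rfl
    | succ i ih =>
      intro hi
      rw [← List.isChain_iff_getElem.mp hc i hi, ih (by omega), pow_succ']
      rfl
  have hper : (Γ.rot ^ (s :: t).length) s = s := by
    rw [← hget _ (by simp)]
    simp
  have hget' : ∀ i (hi : i < (s :: t).length), (s :: t)[i] = (Γ.rot ^ i) s := by
    intro i hi
    rw [← hget i (by simp at hi ⊢; omega), List.getElem_append_left hi]
  have hval : Γ.valence s = (s :: t).length := by
    refine le_antisymm (Function.IsPeriodicPt.minimalPeriod_le (by simp) ?_) ?_
    · rw [Function.IsPeriodicPt, Function.IsFixedPt, Equiv.Perm.iterate_eq_pow]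
      exact hper
    · by_contra! hlt
      have h1 := hget' _ hlt
      rw [Γ.rot_pow_valence] at h1
      have h2 := (List.Nodup.getElem_inj_iff hn (hi := hlt) (hj := by simp) (j := 0)).mp h1
      have := Γ.valence_pos s
      omega
  refine List.ext_getElem (by rw [length_block, hval]) fun i h1 h2 => ?_
  rw [hget' i h2]
  simp [block]

theorem block_rotate {s x : Γ.H} {u v : List Γ.H} (h : Γ.block s = u ++ x :: v) :
    Γ.block x = x :: v ++ u := by
  have hc := Γ.block_chain s
  have hn := Γ.nodup_block s
  obtain ⟨t, ht⟩ := Γ.exists_block_eq_cons s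
  refine Γ.block_eq_of_chain (t := v ++ u) ?_ ?_
  · rw [h] at hn
    have : (u ++ x :: v).Perm (x :: (v ++ u)) :=
      List.perm_middle.trans (List.perm_append_comm.cons x)
    exact this.nodup_iff.mp hn
  · rw [h] at ht hc
    cases u with
    | nil =>
      simp only [List.nil_append, List.cons.injEq] at ht hc
      rw [← ht.1] at hc
      simpa using hc
    | cons y u =>
      simp only [List.cons_append, List.cons.injEq] at ht
      rw [ht.1, show s :: u ++ x :: v ++ [s] = (s :: u) ++ x :: (v ++ [s]) by simp,
        List.isChain_split] at hc
      rw [show x :: (v ++ y :: u) ++ [x] = (x :: v) ++ y :: (u ++ [x]) by simp,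
        List.isChain_split, ht.1]
      exact ⟨hc.2, hc.1⟩

theorem exists_block_rotate {s x : Γ.H} (h : Γ.SameVertex s x) :
    ∃ u v, Γ.block s = u ++ v ∧ Γ.block x = v ++ u := by
  obtain ⟨u, v, huv⟩ := List.append_of_mem (Γ.mem_block.mpr h)
  exact ⟨u, x :: v, huv, Γ.block_rotate huv⟩

theorem Iso.block_map {Γ Δ : RibbonGraph} (φ : Γ.Iso Δ) (s : Γ.H) :
    Δ.block (φ.toEquiv s) = (Γ.block s).map φ.toEquiv := by
  obtain ⟨t, ht⟩ := Γ.exists_block_eq_cons s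
  rw [ht, List.map_cons]
  refine Δ.block_eq_of_chain ?_ ?_
  · rw [← List.map_cons, List.nodup_map_iff φ.toEquiv.injective, ← ht]
    exact Γ.nodup_block s
  · have h := Γ.block_chain s
    rw [ht] at h
    rw [show φ.toEquiv s :: t.map φ.toEquiv ++ [φ.toEquiv s] = (s :: t ++ [s]).map φ.toEquiv by simp,
      List.isChain_map]
    refine h.imp fun a b hab => ?_
    rw [← φ.map_rot, hab]

theorem Iso.sameVertex_iff {Γ Δ : RibbonGraph} (φ : Γ.Iso Δ) {x y : Γ.H} :
    Δ.SameVertex (φ.toEquiv x) (φ.toEquiv y) ↔ Γ.SameVertex x y := by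
  rw [← mem_block, ← mem_block, φ.block_map, List.mem_map_of_injective φ.toEquiv.injective]

end RibbonGraph

/-! ### The diagram of an oriented ribbon graph. -/

namespace OrientedRibbonGraph

variable {X : OrientedRibbonGraph}

/-- The blocks of half-edges at the vertices. -/
noncomputable def Writing.blocks (w : X.Writing) : List (List X.graph.H) :=
  w.starts.map X.graph.block

/-- The arrows, as pairs of half-edges. -/
def Writing.arrows (w : X.Writing) : List (X.graph.H × X.graph.H) :=
  w.edges.map fun a => (a, X.graph.flip a)

theorem Writing.flatten_blocks (w : X.Writing) : w.blocks.flatten = w.lower := rfl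

theorem Writing.arrowEnds_arrows (w : X.Writing) : arrowEnds w.arrows = w.upper := by
  simp [Writing.arrows, Writing.upper, arrowEnds, List.flatMap_map]

theorem Writing.isDiagram (w : X.Writing) : IsDiagram w.blocks w.arrows := by
  refine ⟨?_, ?_, ?_, ?_⟩
  · rw [List.nodup_flatten]
    refine ⟨fun l hl => ?_, ?_⟩
    · obtain ⟨s, -, rfl⟩ := List.mem_map.mp hl
      exact X.graph.nodup_block s
    · refine List.pairwise_map.mpr ((List.pairwise_map.mp w.starts_sorted).imp ?_)
      intro s t hst x hs ht
      rw [X.graph.mem_block, ← X.orientation.label_eq_iff] at hs ht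
      omega
  · intro x
    obtain ⟨s, hs, hsx⟩ := w.starts_cover x
    exact List.mem_flatten.mpr ⟨_, List.mem_map_of_mem hs, X.graph.mem_block.mpr hsx⟩
  · rw [w.arrowEnds_arrows, Writing.upper, List.nodup_flatMap]
    refine ⟨fun a _ => by simpa using (X.graph.flip_ne a).symm, ?_⟩
    refine List.Nodup.pairwise_of_forall_ne w.edges_nodup fun a ha b hb hab => ?_
    rw [w.mem_edges] at ha hb
    have hfa := X.orientation.tail_flip a
    have hfb := X.orientation.tail_flip b
    intro x hx hy
    simp only [List.mem_cons, List.not_mem_nil, or_false] at hx hy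
    rcases hx with rfl | rfl <;> rcases hy with hy | hy
    · exact hab hy
    · rw [hy, hfb, hb] at ha; simp at ha
    · rw [hy, hb, ha] at hfa; simp at hfa
    · exact hab (X.graph.flip.injective hy)
  · intro x
    rw [w.arrowEnds_arrows, Writing.upper, List.mem_flatMap]
    cases hx : X.orientation.tail x with
    | true => exact ⟨x, (w.mem_edges x).mpr hx, by simp⟩
    | false =>
      refine ⟨X.graph.flip x, (w.mem_edges _).mpr ?_, by simp [X.graph.flip_flip]⟩
      rw [X.orientation.tail_flip, hx]
      rfl

end OrientedRibbonGraph

/-! ### Choices and orientation: how `Z(Γ_or)` changes. -/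

namespace CyclicAInfinity

variable {k : Type*} [Field k] {W : Type*} [AddCommGroup W] [Module k W]
  {𝒲 : ZMod 2 → Submodule k W} (A : CyclicAInfinity 𝒲) {ι : Type*} [Fintype ι] [DecidableEq ι]
  {e : Module.Basis ι k W} {p : ι → ZMod 2}

theorem contraction_eq_diagramSum {X : OrientedRibbonGraph} (w : X.Writing) :
    A.contraction e p w = A.diagramSum e p w.blocks w.arrows := by
  unfold contraction diagramSum diagramTerm
  refine Finset.sum_congr rfl fun j _ => ?_
  have h₁ : (w.blocks.map fun b => A.loweredList (b.map fun x => e (j x))) =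
      w.starts.map fun s => A.lowered (X.graph.valence s) fun i =>
        e (j ((X.graph.rot ^ (i : ℕ)) s)) := by
    unfold OrientedRibbonGraph.Writing.blocks
    rw [List.map_map]
    refine List.map_congr_left fun s _ => ?_
    rw [Function.comp_apply, A.loweredList_eq (n := X.graph.valence s) (by simp)]
    congr 1
    funext i
    simp [RibbonGraph.block]
  have h₂ : (w.arrows.map fun a => A.copairing e (j a.1) (j a.2)) =
      w.edges.map fun a => A.copairing e (j a) (j (X.graph.flip a)) := by
    unfold OrientedRibbonGraph.Writing.arrows
    rw [List.map_map]
    rfl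
  rw [w.arrowEnds_arrows, w.flatten_blocks, h₁, h₂]

variable (he : ∀ i, e i ∈ 𝒲 (p i))
include he

theorem diagramTerm_starts {Γ : RibbonGraph} {l l' : List Γ.H} (h : List.Forall₂ Γ.SameVertex l l')
    {es : List (Γ.H × Γ.H)} (j : Γ.H → ι) (bs : List (List Γ.H))
    (hd : IsDiagram (bs ++ l.map Γ.block) es) :
    A.diagramTerm e p (bs ++ l.map Γ.block) es j =
      A.diagramTerm e p (bs ++ l'.map Γ.block) es j := by
  induction h generalizing bs with
  | nil => rfl
  | @cons a b l l' hab h ih =>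
    obtain ⟨u, v, hu, hv⟩ := Γ.exists_block_rotate hab
    simp only [List.map_cons, hu, hv] at hd ⊢
    rw [A.diagramTerm_rotate he hd]
    have := ih (bs ++ [v ++ u]) (hd.of_perm (by
      simpa using (List.perm_append_comm_assoc u v (l.map Γ.block).flatten).append_left bs.flatten)
      (List.Perm.refl _))
    simpa using this

/-- In both writings the labels of the starting points are the increasing enumeration of all labels,
so the starts agree vertex by vertex up to rotation, and the lists of edges are permutations of each
other. -/
theorem contraction_eq_contraction {X : OrientedRibbonGraph} (w w' : X.Writing) :
    A.contraction e p w = A.contraction e p w' := by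
  rw [A.contraction_eq_diagramSum, A.contraction_eq_diagramSum]
  refine Finset.sum_congr rfl fun j _ => ?_
  have hmem : ∀ (w : X.Writing) m, m ∈ w.starts.map X.orientation.label ↔
      ∃ x, X.orientation.label x = m := by
    intro w m
    rw [List.mem_map]
    refine ⟨fun ⟨x, _, hx⟩ => ⟨x, hx⟩, ?_⟩
    rintro ⟨x, rfl⟩
    obtain ⟨s, hs, hsx⟩ := w.starts_cover x
    exact ⟨s, hs, (X.orientation.label_eq_iff _ _).mpr hsx⟩
  have hl : w.starts.map X.orientation.label = w'.starts.map X.orientation.label := by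
    refine List.Perm.eq_of_pairwise (le := (· < ·)) (fun a b _ _ h1 h2 => absurd h1 h2.asymm)
      w.starts_sorted w'.starts_sorted ?_
    rw [List.perm_ext_iff_of_nodup (w.starts_sorted.imp ne_of_lt) (w'.starts_sorted.imp ne_of_lt)]
    intro m
    rw [hmem, hmem]
  have hf : List.Forall₂ X.graph.SameVertex w.starts w'.starts := by
    rw [← List.forall₂_eq_eq_eq, List.forall₂_map_left_iff, List.forall₂_map_right_iff] at hl
    exact hl.imp fun a b hab => (X.orientation.label_eq_iff a b).mp hab
  have he' : w.edges.Perm w'.edges := by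
    rw [List.perm_ext_iff_of_nodup w.edges_nodup w'.edges_nodup]
    intro x
    rw [w.mem_edges, w'.mem_edges]
  rw [A.diagramTerm_perm he w.isDiagram (he'.map _)]
  exact A.diagramTerm_starts he hf j [] (w.isDiagram.of_perm (List.Perm.refl _)
    (List.Perm.flatMap_right _ (he'.map _)))

theorem partitionFunction_eq {X : OrientedRibbonGraph} (w : X.Writing) :
    A.partitionFunction e p X = A.diagramSum e p w.blocks w.arrows := by
  rw [← A.contraction_eq_diagramSum]
  exact A.contraction_eq_contraction he _ w

theorem partitionFunction_change_basis (h𝒲 : DirectSum.IsInternal 𝒲) {ι' : Type*} [Fintype ι']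
    [DecidableEq ι'] {e' : Module.Basis ι' k W} {p' : ι' → ZMod 2}
    (he' : ∀ i, e' i ∈ 𝒲 (p' i)) (X : OrientedRibbonGraph) :
    A.partitionFunction e' p' X = A.partitionFunction e p X := by
  unfold partitionFunction
  rw [A.contraction_eq_diagramSum, A.contraction_eq_diagramSum]
  exact A.diagramSum_change_basis h𝒲 he he' (OrientedRibbonGraph.Writing.isDiagram _)

open RibbonGraph in
theorem partitionFunction_iso {Γ Δ : RibbonGraph} {o : Γ.Orientation} {o' : Δ.Orientation}
    (φ : Γ.Iso Δ) (hφ : φ.PreservesOrder o o') (ht : ∀ x, o'.tail (φ.toEquiv x) = o.tail x) :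
    A.partitionFunction e p ⟨Γ, o⟩ = A.partitionFunction e p ⟨Δ, o'⟩ := by
  obtain ⟨w⟩ := OrientedRibbonGraph.nonempty_writing ⟨Γ, o⟩
  let w' : OrientedRibbonGraph.Writing ⟨Δ, o'⟩ :=
    { starts := w.starts.map φ.toEquiv
      starts_sorted := by
        rw [List.map_map]
        have := w.starts_sorted
        rw [List.pairwise_map] at this ⊢
        exact this.imp fun {a b} h => (hφ a b).mp h
      starts_cover := by
        intro x
        obtain ⟨s, hs, hsx⟩ := w.starts_cover (φ.toEquiv.symm x)
        refine ⟨φ.toEquiv s, List.mem_map_of_mem hs, ?_⟩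
        rw [← φ.sameVertex_iff, Equiv.apply_symm_apply] at hsx
        exact hsx
      edges := w.edges.map φ.toEquiv
      edges_nodup := (List.nodup_map_iff φ.toEquiv.injective).mpr w.edges_nodup
      mem_edges := by
        intro x
        rw [← φ.toEquiv.apply_symm_apply x, List.mem_map_of_injective φ.toEquiv.injective,
          w.mem_edges, ht] }
  rw [A.partitionFunction_eq he w, A.partitionFunction_eq he w', ← A.diagramSum_map φ.toEquiv]
  congr 1
  · change _ = (w.starts.map φ.toEquiv).map Δ.block
    rw [OrientedRibbonGraph.Writing.blocks, List.map_map, List.map_map]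
    exact List.map_congr_left fun s _ => (φ.block_map s).symm
  · change _ = (w.edges.map φ.toEquiv).map fun a => (a, Δ.flip a)
    rw [OrientedRibbonGraph.Writing.arrows, List.map_map, List.map_map]
    refine List.map_congr_left fun a _ => ?_
    simp [φ.map_flip]

theorem partitionFunction_reverse {Γ : RibbonGraph} (o : Γ.Orientation) (x : Γ.H) :
    A.partitionFunction e p ⟨Γ, o.reverse x⟩ = -A.partitionFunction e p ⟨Γ, o⟩ := by
  obtain ⟨w⟩ := OrientedRibbonGraph.nonempty_writing ⟨Γ, o⟩
  obtain ⟨a, hax, hat⟩ : ∃ a, (x = a ∨ x = Γ.flip a) ∧ o.tail a = true := by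
    cases hx : o.tail x with
    | true => exact ⟨x, Or.inl rfl, hx⟩
    | false => exact ⟨Γ.flip x, Or.inr (Γ.flip_flip x).symm, by rw [o.tail_flip, hx]; rfl⟩
  obtain ⟨E₁, E₂, hE⟩ := List.append_of_mem ((w.mem_edges a).mpr hat)
  have hxa : ∀ y, (y = x ∨ y = Γ.flip x) ↔ (y = a ∨ y = Γ.flip a) := by
    intro y
    rcases hax with rfl | rfl
    · rfl
    · rw [Γ.flip_flip]; exact or_comm
  have hnd := w.edges_nodup
  have hmem := w.mem_edges
  simp only [hE] at hnd hmem
  have hfa : Γ.flip a ∉ E₁ ++ a :: E₂ := by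
    intro h
    have h1 := (hmem _).mp h
    simp only [o.tail_flip, hat] at h1
    exact absurd h1 (by decide)
  let w' : OrientedRibbonGraph.Writing ⟨Γ, o.reverse x⟩ :=
    { starts := w.starts
      starts_sorted := w.starts_sorted
      starts_cover := w.starts_cover
      edges := E₁ ++ Γ.flip a :: E₂
      edges_nodup := by
        rw [List.nodup_middle] at hnd ⊢
        rw [List.nodup_cons] at hnd ⊢
        refine ⟨fun h => hfa ?_, hnd.2⟩
        simp only [List.mem_append, List.mem_cons] at h ⊢
        tauto
      mem_edges := by
        intro y
        change _ ↔ (if y = x ∨ y = Γ.flip x then !o.tail y else o.tail y) = true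
        have h1 := hmem y
        have hane : a ∉ E₁ ++ E₂ := by
          rw [List.nodup_middle, List.nodup_cons] at hnd
          exact hnd.1
        simp only [List.mem_append, List.mem_cons] at h1 hane hfa ⊢
        simp only [hxa]
        have hne := Γ.flip_ne a
        split_ifs with hy
        · rcases hy with rfl | rfl
          · rw [hat]
            simp only [Bool.not_true]
            have := hne.symm
            tauto
          · rw [o.tail_flip, hat]
            simp
        · rw [← h1]
          tauto }
  rw [A.partitionFunction_eq he w, A.partitionFunction_eq he w']
  have hw : w.arrows = E₁.map (fun a => (a, Γ.flip a)) ++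
      (a, Γ.flip a) :: E₂.map fun a => (a, Γ.flip a) := by
    simp [OrientedRibbonGraph.Writing.arrows, hE]
  have hw' : w'.arrows = E₁.map (fun a => (a, Γ.flip a)) ++
      (Γ.flip a, a) :: E₂.map fun a => (a, Γ.flip a) := by
    simp [OrientedRibbonGraph.Writing.arrows, w', Γ.flip_flip]
  have hd := w.isDiagram
  rw [hw] at hd
  rw [hw, hw']
  simp only [diagramSum]
  rw [← Finset.sum_neg_distrib]
  exact Finset.sum_congr rfl fun j _ => A.diagramTerm_reverse he hd j

/-- Exchanging the labels makes the old list of starting points, with `s` and `t` exchanged, a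
sorted list for the new orientation. The claim then reduces to exchanging two blocks. -/
theorem partitionFunction_swap_of_lt {Γ : RibbonGraph} (o : Γ.Orientation) {u v : Γ.H}
    (huv : o.label u < o.label v) :
    A.partitionFunction e p ⟨Γ, o.swap u v⟩ = -A.partitionFunction e p ⟨Γ, o⟩ := by
  obtain ⟨w⟩ := OrientedRibbonGraph.nonempty_writing ⟨Γ, o⟩
  obtain ⟨s, hs, hsu⟩ := w.starts_cover u
  obtain ⟨t, ht, htv⟩ := w.starts_cover v
  have hsl : o.label s = o.label u := (o.label_eq_iff _ _).mpr hsu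
  have htl : o.label t = o.label v := (o.label_eq_iff _ _).mpr htv
  obtain ⟨B₁, R, hR⟩ := List.append_of_mem hs
  have hsort := w.starts_sorted
  rw [hR, List.map_append, List.map_cons, List.pairwise_append, List.pairwise_cons] at hsort
  simp only [List.mem_map, List.mem_cons] at hsort
  have htR : t ∈ R := by
    rw [hR, List.mem_append, List.mem_cons] at ht
    rcases ht with ht | rfl | ht
    · have := hsort.2.2 (o.label t) ⟨t, ht, rfl⟩ (o.label s) (Or.inl rfl)
      omega
    · omega
    · exact ht
  obtain ⟨B₂, B₃, rfl⟩ := List.append_of_mem htR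
  clear hsort
  have hsort : ((B₁ ++ s :: (B₂ ++ t :: B₃)).map o.label).Pairwise (· < ·) := hR ▸ w.starts_sorted
  have hl : (B₁ ++ t :: (B₂ ++ s :: B₃)).map (o.swap u v).label =
      (B₁ ++ s :: (B₂ ++ t :: B₃)).map o.label := by
    have hne : ∀ y ∈ B₁ ++ (B₂ ++ B₃), (o.swap u v).label y = o.label y := by
      intro y hy
      refine Equiv.swap_apply_of_ne_of_ne ?_ ?_
      · rw [← hsl]
        have hnd := hsort.imp (S := fun a b => a ≠ b) ne_of_lt
        have : (B₁ ++ s :: (B₂ ++ t :: B₃)).Perm (s :: (B₁ ++ (B₂ ++ t :: B₃))) := List.perm_middle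
        have h2 : ((s :: (B₁ ++ (B₂ ++ t :: B₃))).map o.label).Nodup :=
          (this.map _).nodup_iff.mp hnd
        rw [List.map_cons, List.nodup_cons] at h2
        intro hc
        exact h2.1 (hc ▸ List.mem_map_of_mem (by simp at hy ⊢; tauto))
      · rw [← htl]
        have hnd := hsort.imp (S := fun a b => a ≠ b) ne_of_lt
        have : (B₁ ++ s :: (B₂ ++ t :: B₃)).Perm (t :: (B₁ ++ s :: B₂ ++ B₃)) := by
          rw [← List.cons_append, ← List.append_assoc]
          exact List.perm_middle
        have h2 : ((t :: (B₁ ++ s :: B₂ ++ B₃)).map o.label).Nodup :=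
          (this.map _).nodup_iff.mp hnd
        rw [List.map_cons, List.nodup_cons] at h2
        intro hc
        exact h2.1 (hc ▸ List.mem_map_of_mem (by simp at hy ⊢; tauto))
    have hs' : (o.swap u v).label s = o.label t := by
      change Equiv.swap _ _ (o.label s) = _
      rw [hsl, htl, Equiv.swap_apply_left]
    have ht' : (o.swap u v).label t = o.label s := by
      change Equiv.swap _ _ (o.label t) = _
      rw [hsl, htl, Equiv.swap_apply_right]
    simp only [List.map_append, List.map_cons, hs', ht']
    rw [List.map_congr_left fun y hy => hne y (by simp [hy]),
      List.map_congr_left (l := B₂) fun y hy => hne y (by simp [hy]),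
      List.map_congr_left (l := B₃) fun y hy => hne y (by simp [hy])]
  let w' : OrientedRibbonGraph.Writing ⟨Γ, o.swap u v⟩ :=
    { starts := B₁ ++ t :: (B₂ ++ s :: B₃)
      starts_sorted := hl ▸ hsort
      starts_cover := by
        intro x
        obtain ⟨y, hy, hyx⟩ := w.starts_cover x
        refine ⟨y, ?_, hyx⟩
        rw [hR] at hy
        simp only [List.mem_append, List.mem_cons] at hy ⊢
        tauto
      edges := w.edges
      edges_nodup := w.edges_nodup
      mem_edges := w.mem_edges }
  rw [A.partitionFunction_eq he w, A.partitionFunction_eq he w']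
  have hw : w.blocks = B₁.map Γ.block ++ Γ.block s :: (B₂.map Γ.block ++ Γ.block t ::
      B₃.map Γ.block) := by
    rw [OrientedRibbonGraph.Writing.blocks, hR]
    simp
  have hw' : w'.blocks = B₁.map Γ.block ++ Γ.block t :: (B₂.map Γ.block ++ Γ.block s ::
      B₃.map Γ.block) := by
    simp [OrientedRibbonGraph.Writing.blocks, w']
  have hd := w.isDiagram
  rw [hw] at hd
  rw [hw, hw']
  simp only [diagramSum]
  rw [← Finset.sum_neg_distrib]
  exact Finset.sum_congr rfl fun j _ => A.diagramTerm_swap he hd j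

omit he in
theorem _root_.RibbonGraph.Orientation.swap_comm {Γ : RibbonGraph} (o : Γ.Orientation) (u v : Γ.H) :
    o.swap u v = o.swap v u := by
  simp only [RibbonGraph.Orientation.swap, Equiv.swap_comm]

theorem partitionFunction_swap {Γ : RibbonGraph} (o : Γ.Orientation) {u v : Γ.H}
    (huv : ¬ Γ.SameVertex u v) :
    A.partitionFunction e p ⟨Γ, o.swap u v⟩ = -A.partitionFunction e p ⟨Γ, o⟩ := by
  rw [← o.label_eq_iff] at huv
  rcases lt_or_gt_of_ne huv with h | h
  · exact A.partitionFunction_swap_of_lt he o h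
  · rw [o.swap_comm]
    exact A.partitionFunction_swap_of_lt he o h

end CyclicAInfinity

/-! ### Isomorphisms, and quantities independent of the orientation. -/

namespace RibbonGraph

variable {Γ Δ : RibbonGraph}

/-- The identity isomorphism. -/
def Iso.refl (Γ : RibbonGraph) : Γ.Iso Γ := ⟨Equiv.refl _, fun _ => rfl, fun _ => rfl⟩

/-- The inverse isomorphism. -/
def Iso.symm (φ : Γ.Iso Δ) : Δ.Iso Γ where
  toEquiv := φ.toEquiv.symm
  map_rot x := by rw [Equiv.symm_apply_eq, φ.map_rot, Equiv.apply_symm_apply]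
  map_flip x := by rw [Equiv.symm_apply_eq, φ.map_flip, Equiv.apply_symm_apply]

/-- The composite of two isomorphisms. -/
def Iso.trans {Θ : RibbonGraph} (φ : Γ.Iso Δ) (ψ : Δ.Iso Θ) : Γ.Iso Θ where
  toEquiv := φ.toEquiv.trans ψ.toEquiv
  map_rot x := by simp [φ.map_rot, ψ.map_rot]
  map_flip x := by simp [φ.map_flip, ψ.map_flip]

@[ext] theorem Iso.ext {φ ψ : Γ.Iso Δ} (h : ∀ x, φ.toEquiv x = ψ.toEquiv x) : φ = ψ := by
  cases φ; cases ψ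
  simp only [Iso.mk.injEq]
  exact Equiv.ext h

theorem Iso.isLoop_iff (φ : Γ.Iso Δ) {x : Γ.H} : Δ.IsLoop (φ.toEquiv x) ↔ Γ.IsLoop x := by
  unfold IsLoop
  rw [← φ.map_flip, φ.sameVertex_iff]

theorem isLoop_flip {x : Γ.H} : Γ.IsLoop (Γ.flip x) ↔ Γ.IsLoop x := by
  unfold IsLoop
  rw [Γ.flip_flip]
  exact Equiv.Perm.sameCycle_comm

theorem sameVertex_contract_iff {a : Γ.H} (ha : ¬ Γ.IsLoop a) (x y : (Γ.contract a ha).H) :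
    (Γ.contract a ha).SameVertex x y ↔
      Γ.SameVertex x.1 y.1 ∨ (Γ.AtEnds a x.1 ∧ Γ.AtEnds a y.1) :=
  Γ.contract_sameCycle_iff a ha x y

theorem not_isLoop_of_contract {a : Γ.H} (ha : ¬ Γ.IsLoop a) {x : (Γ.contract a ha).H}
    (h : ¬ (Γ.contract a ha).IsLoop x) : ¬ Γ.IsLoop x.1 := fun h' =>
  h ((sameVertex_contract_iff ha _ _).mpr (Or.inl h'))

theorem nextFun_map (φ : Γ.Iso Δ) {a : Γ.H} {b : Δ.H}
    (hab : φ.toEquiv a = b ∨ φ.toEquiv a = Δ.flip b) (x : Γ.H) :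
    φ.toEquiv (Γ.nextFun a x) = Δ.nextFun b (φ.toEquiv x) := by
  unfold nextFun
  rw [← φ.map_rot]
  have h1 : ∀ y, Γ.rot x = y ↔ φ.toEquiv (Γ.rot x) = φ.toEquiv y := fun y =>
    φ.toEquiv.injective.eq_iff.symm
  have hne := Δ.flip_ne b
  rcases hab with rfl | h
  · rw [← φ.map_flip]
    simp only [φ.toEquiv.injective.eq_iff]
    split_ifs <;> simp only [φ.map_rot]
  · have h2 : φ.toEquiv (Γ.flip a) = b := by rw [φ.map_flip, h, Δ.flip_flip]
    rw [← h, ← h2]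
    simp only [φ.toEquiv.injective.eq_iff]
    have hne' := Γ.flip_ne a
    split_ifs with h3 h4 h4
    · exact absurd (h4.symm.trans h3) hne'
    · simp only [φ.map_rot]
    · simp only [φ.map_rot]
    · rfl

/-- Contracting corresponding edges of isomorphic graphs. -/
def Iso.contract (φ : Γ.Iso Δ) {a : Γ.H} {b : Δ.H}
    (hab : φ.toEquiv a = b ∨ φ.toEquiv a = Δ.flip b) (ha : ¬ Γ.IsLoop a) (hb : ¬ Δ.IsLoop b) :
    (Γ.contract a ha).Iso (Δ.contract b hb) where
  toEquiv := φ.toEquiv.subtypeEquiv fun x => by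
    have h := fun y => φ.toEquiv.injective.eq_iff (a := x) (b := y)
    rcases hab with rfl | h'
    · simp only [ne_eq, ← φ.map_flip, h]
    · have h2 : φ.toEquiv (Γ.flip a) = b := by rw [φ.map_flip, h', Δ.flip_flip]
      rw [← h', ← h2]
      simp only [ne_eq, h, and_comm]
  map_rot x := Subtype.ext (nextFun_map φ hab x.1)
  map_flip x := Subtype.ext (φ.map_flip x.1)

@[simp] theorem Iso.contract_coe (φ : Γ.Iso Δ) {a : Γ.H} {b : Δ.H}
    (hab : φ.toEquiv a = b ∨ φ.toEquiv a = Δ.flip b) (ha : ¬ Γ.IsLoop a) (hb : ¬ Δ.IsLoop b)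
    (x : (Γ.contract a ha).H) : ((φ.contract hab ha hb).toEquiv x).1 = φ.toEquiv x.1 := rfl

theorem Orientation.ext' {o o' : Γ.Orientation} (hl : ∀ x, o.label x = o'.label x)
    (ht : ∀ x, o.tail x = o'.tail x) : o = o' := by
  cases o; cases o'
  simp only [Orientation.mk.injEq]
  exact ⟨funext hl, funext ht⟩

/-- Change the labels of the vertices by a permutation. -/
def Orientation.relabel (o : Γ.Orientation) (σ : Equiv.Perm ℕ) : Γ.Orientation where
  label x := σ (o.label x)
  label_eq_iff x y := by rw [σ.injective.eq_iff, o.label_eq_iff]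
  tail := o.tail
  tail_flip := o.tail_flip

/-- The labels of the vertices. -/
def Orientation.labels (o : Γ.Orientation) : Finset ℕ := Finset.univ.image o.label

theorem Orientation.mem_labels {o : Γ.Orientation} {m : ℕ} :
    m ∈ o.labels ↔ ∃ x, o.label x = m := by
  simp [Orientation.labels]

theorem Orientation.label_mem (o : Γ.Orientation) (x : Γ.H) : o.label x ∈ o.labels :=
  Orientation.mem_labels.mpr ⟨x, rfl⟩

theorem Orientation.labels_swap (o : Γ.Orientation) (u v : Γ.H) :
    (o.swap u v).labels = o.labels := by
  ext m
  rw [Orientation.mem_labels, Orientation.mem_labels]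
  change (∃ x, Equiv.swap (o.label u) (o.label v) (o.label x) = m) ↔ _
  constructor
  · rintro ⟨x, rfl⟩
    rw [Equiv.swap_apply_def]
    split_ifs
    exacts [⟨v, rfl⟩, ⟨u, rfl⟩, ⟨x, rfl⟩]
  · rintro ⟨x, rfl⟩
    by_cases hu : o.label x = o.label u
    · exact ⟨v, by rw [Equiv.swap_apply_right, hu]⟩
    · by_cases hv : o.label x = o.label v
      · exact ⟨u, by rw [Equiv.swap_apply_left, hv]⟩
      · exact ⟨x, Equiv.swap_apply_of_ne_of_ne hu hv⟩

/-- Reversing an arrow on which the two orientations disagree reduces the number of half-edges with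
different tails. -/
theorem Orientation.exists_tails {M : Type*} (f : Γ.Orientation → M)
    (hrev : ∀ o x, f (o.reverse x) = f o) (o o' : Γ.Orientation) :
    ∃ o'' : Γ.Orientation, f o'' = f o' ∧ o''.label = o'.label ∧ o''.tail = o.tail := by
  induction hN : (Finset.univ.filter fun x => o'.tail x ≠ o.tail x).card using
    Nat.strong_induction_on generalizing o' with
  | _ N ih =>
    by_cases h : ∃ x, o'.tail x ≠ o.tail x
    · obtain ⟨x, hx⟩ := h
      have hr : ∀ y, (o'.reverse x).tail y =
          if y = x ∨ y = Γ.flip x then !o'.tail y else o'.tail y := fun y => rfl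
      obtain ⟨o'', h1, h2, h3⟩ := ih _ (by
        rw [← hN]
        refine Finset.card_lt_card ⟨?_, ?_⟩
        · intro y hy
          simp only [Finset.mem_filter, Finset.mem_univ, true_and, hr] at hy ⊢
          split_ifs at hy with hc
          · rcases hc with rfl | rfl
            · exact hx
            · rw [o'.tail_flip, o.tail_flip]
              simpa using hx
          · exact hy
        · intro hsub
          have := hsub (Finset.mem_filter.mpr ⟨Finset.mem_univ x, hx⟩)
          simp only [Finset.mem_filter, Finset.mem_univ, true_and, hr] at this
          simp only [true_or, if_true] at this
          revert this hx
          cases o'.tail x <;> cases o.tail x <;> simp) (o'.reverse x) rfl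
      exact ⟨o'', h1.trans (hrev _ _), h2, h3⟩
    · push Not at h
      exact ⟨o', rfl, rfl, funext h⟩

/-- Transpositions generate the permutations of the labels. Composing a relabelling with a
transposition exchanges the two vertices that currently carry those labels. -/
theorem Orientation.relabel_perm {M : Type*} (f : Γ.Orientation → M)
    (hswap : ∀ (o : Γ.Orientation) (u v : Γ.H), ¬ Γ.SameVertex u v → f (o.swap u v) = f o)
    (o : Γ.Orientation) (σ : Equiv.Perm {m // m ∈ o.labels}) :
    f (o.relabel (Equiv.Perm.ofSubtype σ)) = f o := by
  induction σ using Equiv.Perm.swap_induction_on with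
  | one => rw [map_one]; rfl
  | swap_mul τ a b hab ih =>
    have hl : ∀ m : {m // m ∈ o.labels}, ∃ x, (o.relabel (Equiv.Perm.ofSubtype τ)).label x = m := by
      intro m
      obtain ⟨x, hx⟩ := Orientation.mem_labels.mp (τ.symm m).2
      refine ⟨x, ?_⟩
      change Equiv.Perm.ofSubtype τ (o.label x) = m
      rw [hx, Equiv.Perm.ofSubtype_apply_coe, Equiv.apply_symm_apply]
    obtain ⟨u, hu⟩ := hl a
    obtain ⟨v, hv⟩ := hl b
    have h1 : o.relabel (Equiv.Perm.ofSubtype (Equiv.swap a b * τ)) =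
        (o.relabel (Equiv.Perm.ofSubtype τ)).swap u v := by
      refine Orientation.ext' (fun x => ?_) fun x => rfl
      change Equiv.Perm.ofSubtype (Equiv.swap a b * τ) (o.label x) =
        Equiv.swap ((o.relabel (Equiv.Perm.ofSubtype τ)).label u)
          ((o.relabel (Equiv.Perm.ofSubtype τ)).label v) (Equiv.Perm.ofSubtype τ (o.label x))
      rw [hu, hv, map_mul, Equiv.Perm.ofSubtype_swap_eq]
      rfl
    rw [h1, hswap, ih]
    rw [← Orientation.label_eq_iff (o.relabel (Equiv.Perm.ofSubtype τ)), hu, hv]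
    exact fun h => hab (Subtype.ext h)

/-- A quantity that depends only on the order of the vertices and the arrows, and that is
unchanged when two vertices are exchanged or an arrow is reversed, is constant. -/
theorem Orientation.eq_of_invariant {M : Type*} (f : Γ.Orientation → M)
    (hswap : ∀ (o : Γ.Orientation) (u v : Γ.H), ¬ Γ.SameVertex u v → f (o.swap u v) = f o)
    (hrev : ∀ o x, f (o.reverse x) = f o)
    (hord : ∀ o o' : Γ.Orientation, (∀ x y, o.label x < o.label y ↔ o'.label x < o'.label y) →
      (∀ x, o.tail x = o'.tail x) → f o = f o') (o o' : Γ.Orientation) : f o = f o' := by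
  obtain ⟨o'', h1, h2, h3⟩ := Orientation.exists_tails f hrev o o'
  rw [← h1]
  have hg : ∀ m : o.labels, ∃ x, o.label x = m := fun m => Orientation.mem_labels.mp m.2
  choose g hg using hg
  have hcard : o''.labels.card = o.labels.card := by
    refine (Finset.card_bij (fun m hm => o''.label (g ⟨m, hm⟩)) (fun m hm => o''.label_mem _)
      ?_ ?_).symm
    · intro m hm n hn hmn
      rw [o''.label_eq_iff, ← o.label_eq_iff, hg, hg] at hmn
      exact hmn
    · intro m hm
      obtain ⟨x, rfl⟩ := Orientation.mem_labels.mp hm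
      refine ⟨o.label x, o.label_mem x, ?_⟩
      rw [o''.label_eq_iff, ← o.label_eq_iff, hg]
  -- The labels are arbitrary natural numbers, so the two label sets are first matched by the
  -- increasing bijection `ω`. The permutation `σ` sends the label of a vertex in `o` to the
  -- `ω`-image of its label in `o''`, so `o` relabelled by `σ` orders the vertices as `o''` does.
  let ω : o''.labels ≃o o.labels :=
    (o''.labels.orderIsoOfFin hcard).symm.trans (o.labels.orderIsoOfFin rfl)
  have hinj : Function.Injective fun m : o.labels => ω ⟨o''.label (g m), o''.label_mem _⟩ := by
    intro m n hmn
    have := congrArg Subtype.val (ω.injective hmn)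
    simp only at this
    rw [o''.label_eq_iff, ← o.label_eq_iff, hg, hg] at this
    exact Subtype.ext this
  let σ : Equiv.Perm {m // m ∈ o.labels} :=
    Equiv.ofBijective _ (Finite.injective_iff_bijective.mp hinj)
  rw [← Orientation.relabel_perm f hswap o σ]
  refine hord _ _ (fun x y => ?_) fun x => (congrFun h3 x).symm
  have hσ : ∀ x, (o.relabel (Equiv.Perm.ofSubtype σ)).label x =
      ω ⟨o''.label x, o''.label_mem x⟩ := by
    intro x
    change Equiv.Perm.ofSubtype σ (o.label x) = _
    rw [show o.label x = ((⟨o.label x, o.label_mem x⟩ : {m // m ∈ o.labels}) : ℕ) from rfl,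
      Equiv.Perm.ofSubtype_apply_coe]
    change ((ω ⟨o''.label (g ⟨o.label x, o.label_mem x⟩), _⟩ : o.labels) : ℕ) = _
    congr 3
    rw [o''.label_eq_iff, ← o.label_eq_iff, hg]
  rw [hσ, hσ, Subtype.coe_lt_coe, ω.lt_iff_lt]
  rfl

end RibbonGraph

/-! ### The contribution of one edge to the boundary. -/

namespace RibbonGraph

variable {Γ Δ : RibbonGraph} (k : Type*) [Field k]

theorem toChain_iso {o : Γ.Orientation} {o' : Δ.Orientation} (φ : Γ.Iso Δ)
    (horder : φ.PreservesOrder o o')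
    (harrow : ∀ x, ¬ Γ.IsLoop x → o'.tail (φ.toEquiv x) = o.tail x) :
    OrientedRibbonGraph.toChain k ⟨Γ, o⟩ = OrientedRibbonGraph.toChain k ⟨Δ, o'⟩ :=
  (Submodule.Quotient.eq _).mpr (Submodule.subset_span (GraphRelation.iso o o' φ horder harrow))

theorem toChain_order {o o' : Γ.Orientation}
    (horder : ∀ x y, o.label x < o.label y ↔ o'.label x < o'.label y)
    (harrow : ∀ x, ¬ Γ.IsLoop x → o'.tail x = o.tail x) :
    OrientedRibbonGraph.toChain k ⟨Γ, o⟩ = OrientedRibbonGraph.toChain k ⟨Γ, o'⟩ :=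
  toChain_iso k (Iso.refl Γ) horder harrow

theorem toChain_swap (o : Γ.Orientation) {u v : Γ.H} (huv : ¬ Γ.SameVertex u v) :
    OrientedRibbonGraph.toChain k ⟨Γ, o.swap u v⟩ = -OrientedRibbonGraph.toChain k ⟨Γ, o⟩ := by
  rw [eq_neg_iff_add_eq_zero]
  exact (Submodule.Quotient.mk_eq_zero _).mpr (Submodule.subset_span (GraphRelation.swap o u v huv))

theorem toChain_reverse (o : Γ.Orientation) (x : Γ.H) :
    OrientedRibbonGraph.toChain k ⟨Γ, o.reverse x⟩ = -OrientedRibbonGraph.toChain k ⟨Γ, o⟩ := by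
  rw [eq_neg_iff_add_eq_zero]
  exact (Submodule.Quotient.mk_eq_zero _).mpr (Submodule.subset_span (GraphRelation.reverse o x))

/-- The contribution to the boundary of the edge of `a`, with the sign appropriate to the
arrow with tail `a`. -/
noncomputable def edgeBoundary (o : Γ.Orientation) (a : Γ.H) (ha : ¬ Γ.IsLoop a) : GraphChains k :=
  ((if o.tail a then 1 else -1 : k) * (-1) ^ o.after (Γ.flip a)) •
    OrientedRibbonGraph.toChain k ⟨Γ.contract a ha, o.contract a ha⟩

theorem Orientation.after_eq (o : Γ.Orientation) (x : Γ.H) :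
    o.after x = (o.labels.filter fun m => o.label x < m).card := rfl

theorem after_iso {o : Γ.Orientation} {o' : Δ.Orientation} (φ : Γ.Iso Δ)
    (horder : φ.PreservesOrder o o') (x : Γ.H) : o'.after (φ.toEquiv x) = o.after x := by
  have heq : ∀ y z, o.label y = o.label z ↔ o'.label (φ.toEquiv y) = o'.label (φ.toEquiv z) := by
    intro y z
    rw [o.label_eq_iff, o'.label_eq_iff, φ.sameVertex_iff]
  symm
  choose! g hg using fun m => (Orientation.mem_labels (o := o) (m := m)).mp
  refine Finset.card_bij (fun m _ => o'.label (φ.toEquiv (g m))) ?_ ?_ ?_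
  · intro m hm
    rw [Finset.mem_filter] at hm ⊢
    refine ⟨o'.label_mem _, ?_⟩
    rw [← horder, hg m hm.1]
    exact hm.2
  · intro m hm n hn hmn
    rw [Finset.mem_filter] at hm hn
    rw [← heq, hg m hm.1, hg n hn.1] at hmn
    exact hmn
  · intro m hm
    rw [Finset.mem_filter] at hm
    obtain ⟨y, hy⟩ := Orientation.mem_labels.mp hm.1
    obtain ⟨y, rfl⟩ := φ.toEquiv.surjective y
    refine ⟨o.label y, Finset.mem_filter.mpr ⟨o.label_mem y, ?_⟩, ?_⟩
    · rw [horder, hy]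
      exact hm.2
    · rw [← hy, ← heq, hg _ (o.label_mem y)]

theorem edgeBoundary_iso {o : Γ.Orientation} {o' : Δ.Orientation} (φ : Γ.Iso Δ)
    (horder : φ.PreservesOrder o o')
    (harrow : ∀ x, ¬ Γ.IsLoop x → o'.tail (φ.toEquiv x) = o.tail x) (a : Γ.H)
    (ha : ¬ Γ.IsLoop a) (ha' : ¬ Δ.IsLoop (φ.toEquiv a)) :
    edgeBoundary k o' (φ.toEquiv a) ha' = edgeBoundary k o a ha := by
  unfold edgeBoundary
  rw [← φ.map_flip, after_iso φ horder, harrow a ha]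
  congr 1
  refine (toChain_iso k (φ.contract (Or.inl rfl) ha ha') ?_ ?_).symm
  · have heq : ∀ y z, o.label y = o.label z ↔ o'.label (φ.toEquiv y) = o'.label (φ.toEquiv z) := by
      intro y z
      rw [o.label_eq_iff, o'.label_eq_iff, φ.sameVertex_iff]
    intro x y
    simp only [Orientation.contract, Iso.contract_coe, ← φ.map_flip, ← heq]
    split_ifs <;> exact horder _ _
  · intro x hx
    exact harrow x.1 (not_isLoop_of_contract ha hx)

/-- Reversing the contracted edge changes only the arrow sign; reversing another edge survives as a
reversal in the contracted graph. -/
theorem edgeBoundary_reverse (o : Γ.Orientation) (x a : Γ.H) (ha : ¬ Γ.IsLoop a) :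
    edgeBoundary k (o.reverse x) a ha = -edgeBoundary k o a ha := by
  have hr : ∀ y, (o.reverse x).tail y =
    if y = x ∨ y = Γ.flip x then !o.tail y else o.tail y := fun y => rfl
  have hafter : (o.reverse x).after (Γ.flip a) = o.after (Γ.flip a) := rfl
  unfold edgeBoundary
  rw [hafter, hr a]
  by_cases hax : a = x ∨ a = Γ.flip x
  · have hc : (o.reverse x).contract a ha = o.contract a ha := by
      refine Orientation.ext' (fun y => rfl) fun y => ?_
      change (o.reverse x).tail y.1 = o.tail y.1
      rw [hr, if_neg]
      rintro (h | h)
      · rcases hax with rfl | rfl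
        · exact y.2.1 h
        · exact y.2.2 (by rw [h, Γ.flip_flip])
      · rcases hax with rfl | rfl
        · exact y.2.2 h
        · exact y.2.1 h
    rw [hc, if_pos hax, ← neg_smul, ← neg_mul]
    cases o.tail a <;> simp
  · have hx : x ≠ a ∧ x ≠ Γ.flip a := by
      refine ⟨fun h => hax (Or.inl h.symm), fun h => hax (Or.inr ?_)⟩
      rw [h, Γ.flip_flip]
    obtain ⟨z, rfl⟩ : ∃ z : (Γ.contract a ha).H, z.1 = x := ⟨⟨x, hx⟩, rfl⟩
    have hc : (o.reverse z.1).contract a ha = (o.contract a ha).reverse z := by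
      refine Orientation.ext' (fun y => rfl) fun y => ?_
      change (if y.1 = z.1 ∨ y.1 = Γ.flip z.1 then !o.tail y.1 else o.tail y.1) =
        if y = z ∨ y = (Γ.contract a ha).flip z then !o.tail y.1 else o.tail y.1
      have h1 : y = z ↔ y.1 = z.1 := Subtype.ext_iff
      have h2 : y = (Γ.contract a ha).flip z ↔ y.1 = Γ.flip z.1 := Subtype.ext_iff
      simp only [h1, h2]
    rw [hc, toChain_reverse, if_neg hax, smul_neg]

theorem Orientation.contract_label (o : Γ.Orientation) {a : Γ.H} (ha : ¬ Γ.IsLoop a)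
    (x : (Γ.contract a ha).H) : (o.contract a ha).label x =
      if o.label x.1 = o.label (Γ.flip a) then o.label a else o.label x.1 := rfl

theorem exists_rest_label (o : Γ.Orientation) {a : Γ.H} (ha : ¬ Γ.IsLoop a) {u : Γ.H}
    (hu : o.label u ≠ o.label (Γ.flip a)) :
    ∃ u' : (Γ.contract a ha).H, (o.contract a ha).label u' = o.label u ∧
      Γ.SameVertex u u'.1 := by
  have hf : u ≠ Γ.flip a := fun h => hu (congrArg _ h)
  by_cases h : u = a
  · subst h
    refine ⟨⟨Γ.rot u, (Γ.trivalent u).1, Γ.rot_ne_flip u ha⟩, ?_, Γ.sameVertex_rot u⟩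
    have : o.label (Γ.rot u) = o.label u :=
      (o.label_eq_iff _ _).mpr (Γ.sameVertex_rot u).symm
    change (if o.label (Γ.rot u) = _ then _ else o.label (Γ.rot u)) = _
    rw [this, if_neg hu]
  · exact ⟨⟨u, h, hf⟩, if_neg hu, Equiv.Perm.SameCycle.refl _ _⟩

/-- If the head vertex is not involved, its position is unchanged and the exchange commutes with the
contraction. One of the exchanged vertices may be the tail vertex, whose label the merged vertex
inherits. -/
theorem edgeBoundary_swap_of_ne (o : Γ.Orientation) {a : Γ.H} (ha : ¬ Γ.IsLoop a) {u v : Γ.H}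
    (huv : ¬ Γ.SameVertex u v) (hu : o.label u ≠ o.label (Γ.flip a))
    (hv : o.label v ≠ o.label (Γ.flip a)) :
    edgeBoundary k (o.swap u v) a ha = -edgeBoundary k o a ha := by
  obtain ⟨u', hu', -⟩ := exists_rest_label o ha hu
  obtain ⟨v', hv', -⟩ := exists_rest_label o ha hv
  have hhead : (o.swap u v).label (Γ.flip a) = o.label (Γ.flip a) :=
    Equiv.swap_apply_of_ne_of_ne hu.symm hv.symm
  have hc : (o.swap u v).contract a ha = (o.contract a ha).swap u' v' := by
    refine Orientation.ext' (fun y => ?_) fun y => rfl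
    change _ = Equiv.swap ((o.contract a ha).label u') ((o.contract a ha).label v')
      ((o.contract a ha).label y)
    rw [hu', hv', o.contract_label, (o.swap u v).contract_label]
    have hiff : (o.swap u v).label y.1 = (o.swap u v).label (Γ.flip a) ↔
        o.label y.1 = o.label (Γ.flip a) := by
      rw [(o.swap u v).label_eq_iff, ← o.label_eq_iff]
    by_cases hy : o.label y.1 = o.label (Γ.flip a)
    · rw [if_pos hy, if_pos (hiff.mpr hy)]; rfl
    · rw [if_neg hy, if_neg (mt hiff.mp hy)]; rfl
  have huv' : ¬ (Γ.contract a ha).SameVertex u' v' := by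
    rw [← (o.contract a ha).label_eq_iff, hu', hv', o.label_eq_iff]
    exact huv
  unfold edgeBoundary
  rw [hc, toChain_swap k _ huv', Orientation.after_eq, hhead, o.labels_swap, smul_neg]
  rfl

/-- Induction on the number of labels strictly between the head and `v`. If there is none, the
contracted graph has the same vertex order before and after, and the count behind the head changes
by one. If some `w` lies between, the exchange is a product of three: `w` with `v`, then the head
with `v`, then the head with `w`; each contributes `-1`. -/
theorem edgeBoundary_swap_head (o : Γ.Orientation) {a : Γ.H} (ha : ¬ Γ.IsLoop a) (v : Γ.H)
    (hv : o.label v ≠ o.label (Γ.flip a)) :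
    edgeBoundary k (o.swap (Γ.flip a) v) a ha = -edgeBoundary k o a ha := by
  induction hN : (o.labels.filter fun m => (o.label (Γ.flip a) < m ∧ m < o.label v) ∨
    (o.label v < m ∧ m < o.label (Γ.flip a))).card using
      Nat.strong_induction_on generalizing o v with
  | _ N ih =>
    by_cases h : ∃ w, (o.label (Γ.flip a) < o.label w ∧ o.label w < o.label v) ∨
        (o.label v < o.label w ∧ o.label w < o.label (Γ.flip a))
    · obtain ⟨w, hw⟩ := h
      set L := o.label with hL
      have hwv : L w ≠ L v := by omega
      have hwh : L w ≠ L (Γ.flip a) := by omega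
      have hvw : ¬ Γ.SameVertex w v := by rw [← o.label_eq_iff]; exact hwv
      have hlt : ∀ P : ℕ → Prop, ∀ _ : DecidablePred P, (∀ m, P m →
          (L (Γ.flip a) < m ∧ m < L v) ∨ (L v < m ∧ m < L (Γ.flip a))) → ¬ P (L w) →
          (o.labels.filter P).card < N := by
        intro P _ hP hPw
        rw [← hN]
        refine Finset.card_lt_card ⟨fun m hm => ?_, fun hsub => ?_⟩
        · rw [Finset.mem_filter] at hm ⊢
          exact ⟨hm.1, hP m hm.2⟩
        · exact hPw (Finset.mem_filter.mp (hsub (Finset.mem_filter.mpr ⟨o.label_mem w, hw⟩))).2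
      set o₁ := o.swap w v with ho₁
      have h₁ : ∀ x, o₁.label x = Equiv.swap (L w) (L v) (L x) := fun x => rfl
      have e₁h : o₁.label (Γ.flip a) = L (Γ.flip a) := by
        rw [h₁, Equiv.swap_apply_of_ne_of_ne hwh.symm hv.symm]
      have e₁v : o₁.label v = L w := by rw [h₁, Equiv.swap_apply_right]
      have e₁w : o₁.label w = L v := by rw [h₁, Equiv.swap_apply_left]
      set o₂ := o₁.swap (Γ.flip a) v with ho₂
      have h₂ : ∀ x, o₂.label x = Equiv.swap (L (Γ.flip a)) (L w) (o₁.label x) := by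
        intro x
        rw [← e₁h, ← e₁v]
        rfl
      have e₂h : o₂.label (Γ.flip a) = L w := by rw [h₂, e₁h, Equiv.swap_apply_left]
      have e₂w : o₂.label w = L v := by
        rw [h₂, e₁w, Equiv.swap_apply_of_ne_of_ne hv hwv.symm]
      have hl₁ : o₁.labels = o.labels := o.labels_swap w v
      have hl₂ : o₂.labels = o.labels := (o₁.labels_swap _ _).trans hl₁
      have s₁ := edgeBoundary_swap_of_ne k o ha hvw hwh hv
      have c₁ : (o₁.labels.filter fun m => (o₁.label (Γ.flip a) < m ∧ m < o₁.label v) ∨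
          (o₁.label v < m ∧ m < o₁.label (Γ.flip a))).card < N := by
        rw [hl₁, e₁v, e₁h]
        exact hlt _ _ (fun m hm => by omega) (by omega)
      have c₂ : (o₂.labels.filter fun m => (o₂.label (Γ.flip a) < m ∧ m < o₂.label w) ∨
          (o₂.label w < m ∧ m < o₂.label (Γ.flip a))).card < N := by
        rw [hl₂, e₂h, e₂w]
        exact hlt _ _ (fun m hm => by omega) (by omega)
      have s₂ := ih _ c₁ o₁ v (by rw [e₁v, e₁h]; exact hwh) rfl
      have s₃ := ih _ c₂ o₂ w (by rw [e₂h, e₂w]; exact hwv.symm) rfl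
      have h3 : o₂.swap (Γ.flip a) w = o.swap (Γ.flip a) v := by
        refine Orientation.ext' (fun x => ?_) fun x => rfl
        change Equiv.swap (o₂.label (Γ.flip a)) (o₂.label w) (o₂.label x) =
          Equiv.swap (L (Γ.flip a)) (L v) (L x)
        rw [e₂h, e₂w, h₂, h₁]
        simp only [Equiv.swap_apply_def]
        split_ifs <;> omega
      rw [← h3, s₃, s₂, s₁, neg_neg]
    · push Not at h
      have hhead : (o.swap (Γ.flip a) v).label (Γ.flip a) = o.label v :=
        Equiv.swap_apply_left _ _
      have htc : OrientedRibbonGraph.toChain k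
          ⟨Γ.contract a ha, (o.swap (Γ.flip a) v).contract a ha⟩ =
          OrientedRibbonGraph.toChain k ⟨Γ.contract a ha, o.contract a ha⟩ := by
        refine (toChain_order (Γ := Γ.contract a ha) k (o := o.contract a ha)
          (o' := (o.swap (Γ.flip a) v).contract a ha) (fun x y => ?_) fun x _ => rfl).symm
        have hval : ∀ x : (Γ.contract a ha).H,
            ((o.swap (Γ.flip a) v).contract a ha).label x =
              Equiv.swap (o.label (Γ.flip a)) (o.label v) ((o.contract a ha).label x) ∧
            (o.contract a ha).label x ≠ o.label (Γ.flip a) ∧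
            ∃ z, (o.contract a ha).label x = o.label z := by
          intro x
          have hiff : (o.swap (Γ.flip a) v).label x.1 = (o.swap (Γ.flip a) v).label (Γ.flip a) ↔
              o.label x.1 = o.label (Γ.flip a) := by
            rw [(o.swap (Γ.flip a) v).label_eq_iff, ← o.label_eq_iff]
          rw [o.contract_label, (o.swap (Γ.flip a) v).contract_label]
          by_cases hx : o.label x.1 = o.label (Γ.flip a)
          · rw [if_pos hx, if_pos (hiff.mpr hx)]
            exact ⟨rfl, fun h => ha ((o.label_eq_iff _ _).mp h), ⟨a, rfl⟩⟩
          · rw [if_neg hx, if_neg (mt hiff.mp hx)]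
            exact ⟨rfl, hx, ⟨x.1, rfl⟩⟩
        obtain ⟨hx1, hx2, zx, hx3⟩ := hval x
        obtain ⟨hy1, hy2, zy, hy3⟩ := hval y
        rw [hx1, hy1]
        have hzx := h zx
        have hzy := h zy
        rw [← hx3] at hzx
        rw [← hy3] at hzy
        simp only [Equiv.swap_apply_def]
        split_ifs <;> omega
      unfold edgeBoundary
      rw [htc, ← neg_smul]
      congr 1
      rw [Orientation.after_eq, Orientation.after_eq, hhead, o.labels_swap]
      have ht : (o.swap (Γ.flip a) v).tail a = o.tail a := rfl
      rw [ht]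
      rcases lt_or_gt_of_ne hv with hlt | hlt
      · have : o.labels.filter (fun m => o.label v < m) =
            insert (o.label (Γ.flip a)) (o.labels.filter fun m => o.label (Γ.flip a) < m) := by
          ext m
          rw [Finset.mem_insert, Finset.mem_filter, Finset.mem_filter]
          constructor
          · rintro ⟨hm, hm'⟩
            obtain ⟨z, rfl⟩ := Orientation.mem_labels.mp hm
            have := h z
            by_cases hz : o.label z = o.label (Γ.flip a)
            · exact Or.inl hz
            · exact Or.inr ⟨hm, by omega⟩
          · rintro (rfl | ⟨hm, hm'⟩)
            · exact ⟨o.label_mem _, hlt⟩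
            · exact ⟨hm, by omega⟩
        rw [this, Finset.card_insert_of_notMem (by simp)]
        ring
      · have : o.labels.filter (fun m => o.label (Γ.flip a) < m) =
            insert (o.label v) (o.labels.filter fun m => o.label v < m) := by
          ext m
          rw [Finset.mem_insert, Finset.mem_filter, Finset.mem_filter]
          constructor
          · rintro ⟨hm, hm'⟩
            obtain ⟨z, rfl⟩ := Orientation.mem_labels.mp hm
            have := h z
            by_cases hz : o.label z = o.label v
            · exact Or.inl hz
            · exact Or.inr ⟨hm, by omega⟩
          · rintro (rfl | ⟨hm, hm'⟩)
            · exact ⟨o.label_mem _, hlt⟩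
            · exact ⟨hm, by omega⟩
        rw [this, Finset.card_insert_of_notMem (by simp)]
        ring

theorem edgeBoundary_swap (o : Γ.Orientation) {a : Γ.H} (ha : ¬ Γ.IsLoop a) {u v : Γ.H}
    (huv : ¬ Γ.SameVertex u v) :
    edgeBoundary k (o.swap u v) a ha = -edgeBoundary k o a ha := by
  have hhead : ∀ u v, ¬ Γ.SameVertex u v → o.label u = o.label (Γ.flip a) →
      edgeBoundary k (o.swap u v) a ha = -edgeBoundary k o a ha := by
    intro u v huv hu
    have : o.swap u v = o.swap (Γ.flip a) v := by
      unfold Orientation.swap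
      simp only [hu]
    rw [this]
    refine edgeBoundary_swap_head k o ha v fun h => huv ?_
    rw [← o.label_eq_iff, hu, h]
  by_cases hu : o.label u = o.label (Γ.flip a)
  · exact hhead u v huv hu
  by_cases hv : o.label v = o.label (Γ.flip a)
  · rw [o.swap_comm]
    exact hhead v u (fun h => huv h.symm) hv
  exact edgeBoundary_swap_of_ne k o ha huv hu hv

/-- Contracting from the other half merges the vertices at the place of the other end. This matches
exchanging the two ends of the edge, and the resulting `-1` is compensated by the change of arrow
sign. -/
theorem edgeBoundary_flip (o : Γ.Orientation) {a : Γ.H} (ha : ¬ Γ.IsLoop a)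
    (ha' : ¬ Γ.IsLoop (Γ.flip a)) :
    edgeBoundary k o (Γ.flip a) ha' = edgeBoundary k o a ha := by
  have hs := edgeBoundary_swap k o ha (u := a) (v := Γ.flip a) ha
  rw [← neg_eq_iff_eq_neg] at hs
  rw [← hs]
  have hl : ∀ x, (o.swap a (Γ.flip a)).label x =
      Equiv.swap (o.label a) (o.label (Γ.flip a)) (o.label x) := fun x => rfl
  have hafter : (o.swap a (Γ.flip a)).after (Γ.flip a) = o.after (Γ.flip (Γ.flip a)) := by
    rw [Orientation.after_eq, Orientation.after_eq, o.labels_swap, Γ.flip_flip, hl,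
      Equiv.swap_apply_right]
  unfold edgeBoundary
  rw [hafter, ← neg_smul]
  congr 1
  · rw [o.tail_flip]
    change _ = -((if o.tail a = true then 1 else -1) * _)
    cases o.tail a <;> simp
  · refine toChain_iso k ((Iso.refl Γ).contract (Or.inr rfl) ha' ha) (fun x y => ?_) fun x _ => rfl
    have hval : ∀ x : (Γ.contract (Γ.flip a) ha').H, (o.contract (Γ.flip a) ha').label x =
        ((o.swap a (Γ.flip a)).contract a ha).label
          (((Iso.refl Γ).contract (Or.inr rfl) ha' ha).toEquiv x) := by
      have aux : ∀ z : Γ.H, (if o.label z = o.label (Γ.flip (Γ.flip a)) then o.label (Γ.flip a)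
          else o.label z) =
          if (o.swap a (Γ.flip a)).label z = (o.swap a (Γ.flip a)).label (Γ.flip a) then
            (o.swap a (Γ.flip a)).label a else (o.swap a (Γ.flip a)).label z := by
        intro z
        rw [Γ.flip_flip]
        simp only [hl, Equiv.swap_apply_left, Equiv.swap_apply_right]
        have hne : o.label a ≠ o.label (Γ.flip a) := fun h => ha ((o.label_eq_iff _ _).mp h)
        simp only [Equiv.swap_apply_def]
        split_ifs <;> omega
      exact fun x => aux x.1
    rw [hval, hval]

end RibbonGraph

/-! ### The boundary operator on chains. -/

namespace RibbonGraph

variable {Γ Δ : RibbonGraph} (k : Type*) [Field k]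

open Classical in
/-- The contribution of the edge of `a` to the boundary; loops do not contribute. -/
noncomputable def edgeBoundary' (o : Γ.Orientation) (a : Γ.H) : GraphChains k :=
  if ha : Γ.IsLoop a then 0 else edgeBoundary k o a ha

theorem edgeBoundary'_of_not_isLoop (o : Γ.Orientation) {a : Γ.H} (ha : ¬ Γ.IsLoop a) :
    edgeBoundary' k o a = edgeBoundary k o a ha := dif_neg ha

theorem edgeBoundary'_of_isLoop (o : Γ.Orientation) {a : Γ.H} (ha : Γ.IsLoop a) :
    edgeBoundary' k o a = 0 := dif_pos ha

theorem edgeBoundary'_iso {o : Γ.Orientation} {o' : Δ.Orientation} (φ : Γ.Iso Δ)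
    (horder : φ.PreservesOrder o o')
    (harrow : ∀ x, ¬ Γ.IsLoop x → o'.tail (φ.toEquiv x) = o.tail x) (a : Γ.H) :
    edgeBoundary' k o' (φ.toEquiv a) = edgeBoundary' k o a := by
  by_cases ha : Γ.IsLoop a
  · rw [edgeBoundary'_of_isLoop k o ha, edgeBoundary'_of_isLoop k o' (φ.isLoop_iff.mpr ha)]
  · rw [edgeBoundary'_of_not_isLoop k o ha,
      edgeBoundary'_of_not_isLoop k o' (mt φ.isLoop_iff.mp ha)]
    exact edgeBoundary_iso k φ horder harrow a ha _

theorem edgeBoundary'_reverse (o : Γ.Orientation) (x a : Γ.H) :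
    edgeBoundary' k (o.reverse x) a = -edgeBoundary' k o a := by
  by_cases ha : Γ.IsLoop a
  · simp [edgeBoundary'_of_isLoop k _ ha]
  · simp [edgeBoundary'_of_not_isLoop k _ ha, edgeBoundary_reverse]

theorem edgeBoundary'_swap (o : Γ.Orientation) (a : Γ.H) {u v : Γ.H}
    (huv : ¬ Γ.SameVertex u v) : edgeBoundary' k (o.swap u v) a = -edgeBoundary' k o a := by
  by_cases ha : Γ.IsLoop a
  · simp [edgeBoundary'_of_isLoop k _ ha]
  · simp [edgeBoundary'_of_not_isLoop k _ ha, edgeBoundary_swap k o ha huv]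

theorem edgeBoundary'_flip (o : Γ.Orientation) (a : Γ.H) :
    edgeBoundary' k o (Γ.flip a) = edgeBoundary' k o a := by
  by_cases ha : Γ.IsLoop a
  · rw [edgeBoundary'_of_isLoop k _ ha, edgeBoundary'_of_isLoop k _ (isLoop_flip.mpr ha)]
  · rw [edgeBoundary'_of_not_isLoop k _ ha,
      edgeBoundary'_of_not_isLoop k _ (mt isLoop_flip.mp ha), edgeBoundary_flip k o ha]

theorem boundary_eq_sum_tails (o : Γ.Orientation) :
    OrientedRibbonGraph.boundary k ⟨Γ, o⟩ =
      ∑ a ∈ Finset.univ.filter (fun a => o.tail a = true), edgeBoundary' k o a := by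
  classical
  have h : ∑ a ∈ Finset.univ.filter (fun a => o.tail a = true), edgeBoundary' k o a =
      ∑ a ∈ Finset.univ.filter (fun a => o.tail a = true ∧ ¬ Γ.IsLoop a), edgeBoundary' k o a := by
    symm
    refine Finset.sum_subset (fun a ha => ?_) fun a ha ha' => ?_
    · simp only [Finset.mem_filter, Finset.mem_univ, true_and] at ha ⊢
      exact ha.1
    · simp only [Finset.mem_filter, Finset.mem_univ, true_and, not_and, not_not] at ha ha'
      exact edgeBoundary'_of_isLoop k o (ha' ha)
  rw [h, OrientedRibbonGraph.boundary]
  rw [Finset.sum_subtype (p := fun a => o.tail a = true ∧ ¬ Γ.IsLoop a) _ (by simp)]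
  refine Finset.sum_congr (by congr) fun a _ => ?_
  rw [edgeBoundary'_of_not_isLoop k o a.2.2, edgeBoundary, if_pos a.2.1, one_mul]

/-- Both halves of an edge contribute equally. Summing over all half-edges makes the range of
summation independent of the arrows, so each relation can be checked term by term. -/
theorem two_smul_boundary (o : Γ.Orientation) :
    (2 : k) • OrientedRibbonGraph.boundary k ⟨Γ, o⟩ = ∑ a, edgeBoundary' k o a := by
  rw [← Finset.sum_filter_add_sum_filter_not Finset.univ (fun a => o.tail a = true),
    boundary_eq_sum_tails, two_smul]
  congr 1
  refine Finset.sum_bij (fun a _ => Γ.flip a) ?_ (fun a _ b _ h => Γ.flip.injective h) ?_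
    fun a _ => (edgeBoundary'_flip k o a).symm
  · intro a ha
    simp only [Finset.mem_filter, Finset.mem_univ, true_and] at ha ⊢
    rw [o.tail_flip, ha]
    decide
  · intro b hb
    simp only [Finset.mem_filter, Finset.mem_univ, true_and] at hb
    refine ⟨Γ.flip b, ?_, Γ.flip_flip b⟩
    simp only [Finset.mem_filter, Finset.mem_univ, true_and, o.tail_flip]
    simpa using hb

variable [CharZero k]

theorem boundary_eq (o : Γ.Orientation) :
    OrientedRibbonGraph.boundary k ⟨Γ, o⟩ = (2⁻¹ : k) • ∑ a, edgeBoundary' k o a := by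
  rw [← two_smul_boundary, smul_smul, inv_mul_cancel₀ two_ne_zero, one_smul]

theorem span_graphRelation_le_ker :
    Submodule.span k {r | GraphRelation k r} ≤
      LinearMap.ker (Finsupp.linearCombination k (OrientedRibbonGraph.boundary k)) := by
  rw [Submodule.span_le]
  intro r hr
  rw [Set.mem_ofPred_eq] at hr
  rw [SetLike.mem_coe, LinearMap.mem_ker]
  cases hr with
  | iso o o' φ horder harrow =>
    rw [map_sub, Finsupp.linearCombination_single, Finsupp.linearCombination_single, one_smul,
      one_smul, boundary_eq, boundary_eq, ← φ.toEquiv.sum_comp, sub_eq_zero]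
    simp only [edgeBoundary'_iso k φ horder harrow]
  | swap o u v huv =>
    rw [map_add, Finsupp.linearCombination_single, Finsupp.linearCombination_single, one_smul,
      one_smul, boundary_eq, boundary_eq, ← smul_add, ← Finset.sum_add_distrib]
    simp [edgeBoundary'_swap k o _ huv]
  | reverse o x =>
    rw [map_add, Finsupp.linearCombination_single, Finsupp.linearCombination_single, one_smul,
      one_smul, boundary_eq, boundary_eq, ← smul_add, ← Finset.sum_add_distrib]
    simp [edgeBoundary'_reverse k o]

/-- The boundary operator of the graph complex. -/
noncomputable def boundaryMap : GraphChains k →ₗ[k] GraphChains k :=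
  Submodule.liftQ _ (Finsupp.linearCombination k (OrientedRibbonGraph.boundary k))
    (span_graphRelation_le_ker k)

theorem boundaryMap_toChain (X : OrientedRibbonGraph) :
    boundaryMap k (X.toChain k) = X.boundary k := by
  rw [boundaryMap, OrientedRibbonGraph.toChain, Submodule.liftQ_apply,
    Finsupp.linearCombination_single, one_smul]

end RibbonGraph

/-! ### Products that do not depend on the orientation. -/

namespace CyclicAInfinity

open RibbonGraph

variable {k : Type*} [Field k] {W : Type*} [AddCommGroup W] [Module k W]
  {𝒲 : ZMod 2 → Submodule k W} (A : CyclicAInfinity 𝒲) {ι : Type*} [Fintype ι] [DecidableEq ι]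
  {e : Module.Basis ι k W} {p : ι → ZMod 2} (he : ∀ i, e i ∈ 𝒲 (p i))
include he

theorem partitionFunction_order {Γ : RibbonGraph} {o o' : Γ.Orientation}
    (horder : ∀ x y, o.label x < o.label y ↔ o'.label x < o'.label y)
    (harrow : ∀ x, o.tail x = o'.tail x) :
    A.partitionFunction e p ⟨Γ, o⟩ = A.partitionFunction e p ⟨Γ, o'⟩ :=
  A.partitionFunction_iso he (Iso.refl Γ) horder fun x => (harrow x).symm

/-- Both factors change sign under an exchange of vertices or a reversal, so the product is
invariant under the moves that connect any two orientations. -/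
theorem partitionFunction_smul_toChain {Γ : RibbonGraph} (o o' : Γ.Orientation) :
    A.partitionFunction e p ⟨Γ, o⟩ • OrientedRibbonGraph.toChain k ⟨Γ, o⟩ =
      A.partitionFunction e p ⟨Γ, o'⟩ • OrientedRibbonGraph.toChain k ⟨Γ, o'⟩ := by
  refine Orientation.eq_of_invariant (fun o : Γ.Orientation =>
    A.partitionFunction e p ⟨Γ, o⟩ • OrientedRibbonGraph.toChain k ⟨Γ, o⟩) ?_ ?_ ?_ o o'
  · intro o u v huv
    simp only [A.partitionFunction_swap he o huv, toChain_swap k o huv, neg_smul, smul_neg, neg_neg]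
  · intro o x
    simp only [A.partitionFunction_reverse he o x, toChain_reverse k o x, neg_smul, smul_neg,
      neg_neg]
  · intro o o' h1 h2
    simp only [A.partitionFunction_order he h1 h2,
      toChain_order k h1 fun x _ => (h2 x).symm]

theorem partitionFunction_smul_edgeBoundary {Γ : RibbonGraph} (o o' : Γ.Orientation) (a : Γ.H) :
    A.partitionFunction e p ⟨Γ, o⟩ • edgeBoundary' k o a =
      A.partitionFunction e p ⟨Γ, o'⟩ • edgeBoundary' k o' a := by
  refine Orientation.eq_of_invariant (fun o : Γ.Orientation =>
    A.partitionFunction e p ⟨Γ, o⟩ • edgeBoundary' k o a) ?_ ?_ ?_ o o'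
  · intro o u v huv
    simp only [A.partitionFunction_swap he o huv, edgeBoundary'_swap k o a huv, neg_smul, smul_neg,
      neg_neg]
  · intro o x
    simp only [A.partitionFunction_reverse he o x, edgeBoundary'_reverse k o x a, neg_smul,
      smul_neg, neg_neg]
  · intro o o' h1 h2
    simp only [A.partitionFunction_order he h1 h2]
    congr 1
    exact (edgeBoundary'_iso k (Iso.refl Γ) h1 (fun x _ => (h2 x).symm) a).symm

omit he in
/-- The orientation transported along an isomorphism. -/
def _root_.RibbonGraph.Orientation.map {Γ Δ : RibbonGraph} (o : Γ.Orientation) (φ : Γ.Iso Δ) :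
    Δ.Orientation where
  label x := o.label (φ.toEquiv.symm x)
  label_eq_iff x y := by
    rw [o.label_eq_iff, ← φ.sameVertex_iff, Equiv.apply_symm_apply, Equiv.apply_symm_apply]
  tail x := o.tail (φ.toEquiv.symm x)
  tail_flip x := by
    rw [← o.tail_flip]
    congr 1
    exact φ.symm.map_flip x

omit he in
theorem _root_.RibbonGraph.Orientation.preservesOrder_map {Γ Δ : RibbonGraph} (o : Γ.Orientation)
    (φ : Γ.Iso Δ) : φ.PreservesOrder o (o.map φ) := by
  intro x y
  simp [RibbonGraph.Orientation.map]

omit he in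
theorem _root_.RibbonGraph.Orientation.map_tail {Γ Δ : RibbonGraph} (o : Γ.Orientation)
    (φ : Γ.Iso Δ) (x : Γ.H) : (o.map φ).tail (φ.toEquiv x) = o.tail x := by
  simp [RibbonGraph.Orientation.map]

theorem partitionFunction_smul_toChain_iso {Γ Δ : RibbonGraph} (o : Γ.Orientation)
    (o' : Δ.Orientation) (φ : Γ.Iso Δ) :
    A.partitionFunction e p ⟨Γ, o⟩ • OrientedRibbonGraph.toChain k ⟨Γ, o⟩ =
      A.partitionFunction e p ⟨Δ, o'⟩ • OrientedRibbonGraph.toChain k ⟨Δ, o'⟩ := by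
  rw [A.partitionFunction_smul_toChain he o' (o.map φ),
    A.partitionFunction_iso he φ (o.preservesOrder_map φ) (o.map_tail φ),
    toChain_iso k φ (o.preservesOrder_map φ) fun x _ => o.map_tail φ x]

theorem partitionFunction_smul_edgeBoundary_iso {Γ Δ : RibbonGraph} (o : Γ.Orientation)
    (o' : Δ.Orientation) (φ : Γ.Iso Δ) (a : Γ.H) :
    A.partitionFunction e p ⟨Γ, o⟩ • edgeBoundary' k o a =
      A.partitionFunction e p ⟨Δ, o'⟩ • edgeBoundary' k o' (φ.toEquiv a) := by
  rw [A.partitionFunction_smul_edgeBoundary he o' (o.map φ),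
    A.partitionFunction_iso he φ (o.preservesOrder_map φ) (o.map_tail φ),
    edgeBoundary'_iso k φ (o.preservesOrder_map φ) fun x _ => o.map_tail φ x]

end CyclicAInfinity

/-! ### Genus, boundary circuits and finiteness. -/

namespace RibbonGraph

variable {Γ Δ : RibbonGraph}

theorem nonempty_orientation (Γ : RibbonGraph) : Nonempty Γ.Orientation := by
  classical
  let c : Γ.H → Quotient (Equiv.Perm.SameCycle.setoid Γ.rot) := Quotient.mk _
  refine ⟨⟨fun x => Fintype.equivFin _ (c x), fun x y => ?_,
    fun x => decide (Fintype.equivFin _ x < Fintype.equivFin _ (Γ.flip x)), fun x => ?_⟩⟩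
  · rw [Fin.val_inj, EmbeddingLike.apply_eq_iff_eq]
    exact Quotient.eq
  · rw [Γ.flip_flip]
    have hne : Fintype.equivFin _ x ≠ Fintype.equivFin _ (Γ.flip x) :=
      fun h => Γ.flip_ne x ((Fintype.equivFin _).injective h).symm
    rcases lt_or_gt_of_ne hne with h | h
    · simp [h, h.not_gt]
    · simp [h, h.not_gt]

theorem cycleCount_eq_card_image {H : Type} [Fintype H] {T : Type*} [DecidableEq T]
    {σ : Equiv.Perm H} (f : H → T) (h : ∀ x y, f x = f y ↔ σ.SameCycle x y) :
    cycleCount σ = (Finset.univ.image f).card := by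
  rw [cycleCount, ← Fintype.card_coe, ← Nat.card_eq_fintype_card]
  refine Nat.card_congr (Equiv.ofBijective (Quotient.lift
    (fun x => (⟨f x, Finset.mem_image_of_mem f (Finset.mem_univ x)⟩ :
      {m // m ∈ Finset.univ.image f})) fun x y hxy => Subtype.ext ((h x y).mpr hxy)) ⟨?_, ?_⟩)
  · intro a b
    refine Quotient.inductionOn₂ a b fun x y hxy => Quotient.sound ?_
    exact (h x y).mp (congrArg Subtype.val hxy)
  · rintro ⟨m, hm⟩
    obtain ⟨x, -, rfl⟩ := Finset.mem_image.mp hm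
    exact ⟨Quotient.mk _ x, rfl⟩

theorem sameCycle_map {H H' : Type} [Finite H] {σ : Equiv.Perm H} {σ' : Equiv.Perm H'} (f : H → H')
    (h : ∀ x, f (σ x) = σ' (f x)) {x y : H} (hxy : σ.SameCycle x y) : σ'.SameCycle (f x) (f y) := by
  obtain ⟨n, -, rfl⟩ := hxy.exists_pow_eq'
  refine ⟨n, ?_⟩
  rw [zpow_natCast]
  clear hxy
  induction n with
  | zero => rfl
  | succ n ih => rw [pow_succ', pow_succ', Equiv.Perm.mul_apply, Equiv.Perm.mul_apply, ih, h]

theorem cycleCount_congr {H H' : Type} [Finite H] [Finite H'] {σ : Equiv.Perm H}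
    {σ' : Equiv.Perm H'} (f : H ≃ H') (h : ∀ x, f (σ x) = σ' (f x)) :
    cycleCount σ = cycleCount σ' := by
  refine Nat.card_congr (Quotient.congr f fun x y => ⟨sameCycle_map f h, fun hxy => ?_⟩)
  have := sameCycle_map (σ := σ') (σ' := σ) f.symm
    (fun z => by rw [Equiv.symm_apply_eq, h, Equiv.apply_symm_apply]) hxy
  rwa [Equiv.symm_apply_apply, Equiv.symm_apply_apply] at this

theorem Iso.hasType_iff (φ : Γ.Iso Δ) {g n : ℕ} : Γ.HasType g n ↔ Δ.HasType g n := by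
  unfold HasType
  rw [cycleCount_congr φ.toEquiv φ.map_rot, cycleCount_congr φ.toEquiv φ.map_flip,
    cycleCount_congr (σ := Γ.rot * Γ.flip) (σ' := Δ.rot * Δ.flip) φ.toEquiv fun x => by
      rw [Equiv.Perm.mul_apply, Equiv.Perm.mul_apply, φ.map_rot, φ.map_flip]]

theorem Orientation.cycleCount_rot (o : Γ.Orientation) : cycleCount Γ.rot = o.labels.card :=
  cycleCount_eq_card_image o.label o.label_eq_iff

theorem cycleCount_rot_contract {a : Γ.H} (ha : ¬ Γ.IsLoop a) :
    cycleCount Γ.rot = cycleCount (Γ.contract a ha).rot + 1 := by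
  obtain ⟨o⟩ := nonempty_orientation Γ
  rw [o.cycleCount_rot, (o.contract a ha).cycleCount_rot]
  have hne : o.label a ≠ o.label (Γ.flip a) := fun h => ha ((o.label_eq_iff _ _).mp h)
  have : (o.contract a ha).labels = o.labels.erase (o.label (Γ.flip a)) := by
    ext m
    rw [Finset.mem_erase, Orientation.mem_labels, Orientation.mem_labels]
    constructor
    · rintro ⟨x, rfl⟩
      rw [o.contract_label]
      split_ifs with h
      · exact ⟨hne, a, rfl⟩
      · exact ⟨h, x.1, rfl⟩
    · rintro ⟨hm, x, rfl⟩
      obtain ⟨x', hx', -⟩ := exists_rest_label o ha hm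
      exact ⟨x', hx'⟩
  rw [this, Finset.card_erase_add_one (o.label_mem _)]

theorem sameCycle_flip_iff {H : Type} [Finite H] {σ : Equiv.Perm H} (h : ∀ x, σ (σ x) = x)
    {x y : H} : σ.SameCycle x y ↔ y = x ∨ y = σ x := by
  constructor
  · intro hxy
    obtain ⟨n, -, rfl⟩ := hxy.exists_pow_eq'
    clear hxy
    induction n with
    | zero => exact Or.inl rfl
    | succ n ih =>
      rw [pow_succ', Equiv.Perm.mul_apply]
      rcases ih with ih | ih
      · rw [ih]; exact Or.inr rfl
      · rw [ih, h]; exact Or.inl rfl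
  · rintro (rfl | rfl)
    · exact Equiv.Perm.SameCycle.refl _ _
    · exact ⟨1, by simp⟩

theorem cycleCount_flip_contract {a : Γ.H} (ha : ¬ Γ.IsLoop a) :
    cycleCount Γ.flip = cycleCount (Γ.contract a ha).flip + 1 := by
  classical
  let ℓ : Γ.H → Quotient (Equiv.Perm.SameCycle.setoid Γ.flip) := Quotient.mk _
  have hℓ : ∀ x y, ℓ x = ℓ y ↔ Γ.flip.SameCycle x y := fun x y => Quotient.eq
  have hℓ' : ∀ x y : (Γ.contract a ha).H, ℓ x.1 = ℓ y.1 ↔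
      (Γ.contract a ha).flip.SameCycle x y := by
    intro x y
    have h1 : y = x ↔ y.1 = x.1 := Subtype.ext_iff
    have h2 : y = (Γ.contract a ha).flip x ↔ y.1 = Γ.flip x.1 := Subtype.ext_iff
    rw [hℓ, sameCycle_flip_iff Γ.flip_flip, sameCycle_flip_iff (Γ.contract a ha).flip_flip, h1, h2]
  rw [cycleCount_eq_card_image ℓ hℓ, cycleCount_eq_card_image (fun x => ℓ x.1) hℓ']
  have : Finset.univ.image (fun x : (Γ.contract a ha).H => ℓ x.1) =
      (Finset.univ.image ℓ).erase (ℓ a) := by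
    ext m
    simp only [Finset.mem_erase, Finset.mem_image, Finset.mem_univ, true_and]
    constructor
    · rintro ⟨x, rfl⟩
      refine ⟨fun h => ?_, x.1, rfl⟩
      rw [eq_comm, hℓ, sameCycle_flip_iff Γ.flip_flip] at h
      exact h.elim x.2.1 x.2.2
    · rintro ⟨hm, x, rfl⟩
      refine ⟨⟨x, fun h => hm (by rw [h]), fun h => hm ?_⟩, rfl⟩
      rw [eq_comm, hℓ, sameCycle_flip_iff Γ.flip_flip]
      exact Or.inr h
  rw [this, Finset.card_erase_add_one (Finset.mem_image_of_mem ℓ (Finset.mem_univ a))]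

theorem contract_boundary_apply {a : Γ.H} (ha : ¬ Γ.IsLoop a) (x : (Γ.contract a ha).H) :
    (((Γ.contract a ha).rot * (Γ.contract a ha).flip) x).1 =
      if (Γ.rot * Γ.flip) x.1 = a ∨ (Γ.rot * Γ.flip) x.1 = Γ.flip a then
        (Γ.rot * Γ.flip) ((Γ.rot * Γ.flip) x.1)
      else (Γ.rot * Γ.flip) x.1 := by
  change Γ.nextFun a (Γ.flip x.1) = _
  simp only [Equiv.Perm.mul_apply, nextFun]
  by_cases h1 : Γ.rot (Γ.flip x.1) = a
  · simp [h1]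
  · by_cases h2 : Γ.rot (Γ.flip x.1) = Γ.flip a
    · simp [h2, Γ.flip_ne a, Γ.flip_flip]
    · simp [h1, h2]

/-- The boundary permutation of the contracted graph is the first-return map of that of `Γ`,
skipping `a` and `flip a`. No circuit disappears, because the successor of either skipped half-edge
remains. -/
theorem cycleCount_boundary_contract {a : Γ.H} (ha : ¬ Γ.IsLoop a) :
    cycleCount (Γ.rot * Γ.flip) =
      cycleCount ((Γ.contract a ha).rot * (Γ.contract a ha).flip) := by
  classical
  set φ := Γ.rot * Γ.flip with hφ
  set φ' := (Γ.contract a ha).rot * (Γ.contract a ha).flip with hφ'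
  have happ : ∀ x : (Γ.contract a ha).H, (φ' x).1 =
      if φ x.1 = a ∨ φ x.1 = Γ.flip a then φ (φ x.1) else φ x.1 := contract_boundary_apply ha
  let ℓ : Γ.H → Quotient (Equiv.Perm.SameCycle.setoid φ) := Quotient.mk _
  have hℓ : ∀ x y, ℓ x = ℓ y ↔ φ.SameCycle x y := fun x y => Quotient.eq
  have hforw : ∀ x : (Γ.contract a ha).H, ∀ n : ℕ, φ.SameCycle x.1 ((φ' ^ n) x).1 := by
    intro x n
    induction n with
    | zero => exact Equiv.Perm.SameCycle.refl _ _
    | succ n ih =>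
      rw [pow_succ', Equiv.Perm.mul_apply, happ]
      split_ifs
      · rw [Equiv.Perm.sameCycle_apply_right, Equiv.Perm.sameCycle_apply_right]
        exact ih
      · rw [Equiv.Perm.sameCycle_apply_right]
        exact ih
  -- Strong induction, because one step after contraction may absorb two steps in `Γ`.
  have hback : ∀ n : ℕ, ∀ x y : (Γ.contract a ha).H, (φ ^ n) x.1 = y.1 → φ'.SameCycle x y := by
    intro n
    induction n using Nat.strong_induction_on with
    | _ n ih =>
      intro x y hxy
      match n, ih, hxy with
      | 0, _, hxy =>
        have : x = y := Subtype.ext hxy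
        rw [this]
      | n + 1, ih, hxy =>
        rw [pow_succ, Equiv.Perm.mul_apply] at hxy
        have hx := happ x
        by_cases hc : φ x.1 = a ∨ φ x.1 = Γ.flip a
        · rw [if_pos hc] at hx
          match n, ih, hxy with
          | 0, _, hxy =>
            exfalso
            have hxy' : φ x.1 = y.1 := hxy
            rw [hxy'] at hc
            exact hc.elim y.2.1 y.2.2
          | n + 1, ih, hxy =>
            rw [pow_succ, Equiv.Perm.mul_apply, ← hx] at hxy
            exact Equiv.Perm.sameCycle_apply_left.mp (ih n (by omega) _ y hxy)
        · rw [if_neg hc] at hx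
          rw [← hx] at hxy
          exact Equiv.Perm.sameCycle_apply_left.mp (ih n (by omega) _ y hxy)
  have hℓ' : ∀ x y : (Γ.contract a ha).H, ℓ x.1 = ℓ y.1 ↔ φ'.SameCycle x y := by
    intro x y
    rw [hℓ]
    constructor
    · intro h
      obtain ⟨n, -, hn⟩ := h.exists_pow_eq'
      exact hback n x y hn
    · intro h
      obtain ⟨n, -, rfl⟩ := h.exists_pow_eq'
      exact hforw x n
  rw [cycleCount_eq_card_image ℓ hℓ, cycleCount_eq_card_image (fun x => ℓ x.1) hℓ']
  congr 1
  ext m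
  simp only [Finset.mem_image, Finset.mem_univ, true_and]
  constructor
  · rintro ⟨x, rfl⟩
    by_cases hx : x ≠ a ∧ x ≠ Γ.flip a
    · exact ⟨⟨x, hx⟩, rfl⟩
    · have hx' : φ x ≠ a ∧ φ x ≠ Γ.flip a := by
        rw [not_and_or, not_not, not_not] at hx
        rcases hx with rfl | rfl
        · exact ⟨Γ.rot_flip_ne x ha, (Γ.trivalent _).1⟩
        · rw [hφ, Equiv.Perm.mul_apply, Γ.flip_flip]
          exact ⟨(Γ.trivalent _).1, Γ.rot_ne_flip a ha⟩
      refine ⟨⟨φ x, hx'⟩, ?_⟩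
      rw [hℓ, Equiv.Perm.sameCycle_apply_left]
  · rintro ⟨x, rfl⟩
    exact ⟨x.1, rfl⟩

theorem hasType_contract_iff {a : Γ.H} (ha : ¬ Γ.IsLoop a) {g n : ℕ} :
    (Γ.contract a ha).HasType g n ↔ Γ.HasType g n := by
  unfold HasType
  rw [cycleCount_boundary_contract ha, cycleCount_rot_contract ha, cycleCount_flip_contract ha]
  have : cycleCount (Γ.contract a ha).rot + 1 + n + 2 * g =
      cycleCount (Γ.contract a ha).flip + 1 + 2 ↔ cycleCount (Γ.contract a ha).rot + n + 2 * g =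
      cycleCount (Γ.contract a ha).flip + 2 := by omega
  rw [this]

theorem three_mul_cycleCount_rot_le (Γ : RibbonGraph) : 3 * cycleCount Γ.rot ≤ Fintype.card Γ.H := by
  have hinj : Function.Injective
      fun q : Quotient (Equiv.Perm.SameCycle.setoid Γ.rot) × Fin 3 => (Γ.rot ^ (q.2 : ℕ)) q.1.out := by
    rintro ⟨q, i⟩ ⟨r, j⟩ h
    simp only at h
    have hs : ∀ (q : Quotient (Equiv.Perm.SameCycle.setoid Γ.rot)) (i : ℕ),
        Γ.rot.SameCycle q.out ((Γ.rot ^ i) q.out) := fun q i => ⟨i, by simp⟩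
    have hqr : q = r := by
      have h1 := hs q i
      rw [h] at h1
      have h2 : Γ.rot.SameCycle q.out r.out := h1.trans (hs r j).symm
      rw [← q.out_eq, ← r.out_eq]
      exact Quotient.sound h2
    subst hqr
    obtain ⟨h1, h2⟩ := Γ.trivalent q.out
    have hinj := Γ.rot.injective
    fin_cases i <;> fin_cases j <;>
      simp only [pow_zero, pow_one, pow_two, Equiv.Perm.mul_apply, Equiv.Perm.one_apply] at h <;>
      first
        | rfl
        | exact absurd h h1
        | exact absurd h.symm h1
        | exact absurd h h2
        | exact absurd h.symm h2
        | exact absurd (hinj h) h1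
        | exact absurd (hinj h.symm) h1
  have := Nat.card_le_card_of_injective _ hinj
  rw [Nat.card_prod, Nat.card_eq_fintype_card (α := Fin 3), Fintype.card_fin,
    Nat.card_eq_fintype_card (α := Γ.H)] at this
  unfold cycleCount
  omega

theorem card_le_two_mul_cycleCount_flip (Γ : RibbonGraph) :
    Fintype.card Γ.H ≤ 2 * cycleCount Γ.flip := by
  classical
  have hinj : Function.Injective fun x : Γ.H =>
      ((Quotient.mk (Equiv.Perm.SameCycle.setoid Γ.flip) x,
        decide (x = (Quotient.mk (Equiv.Perm.SameCycle.setoid Γ.flip) x).out)) :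
        Quotient (Equiv.Perm.SameCycle.setoid Γ.flip) × Bool) := by
    intro x y h
    rw [Prod.mk.injEq, decide_eq_decide] at h
    obtain ⟨h1, h2⟩ := h
    rw [← h1] at h2
    have hx : Γ.flip.SameCycle (Quotient.mk (Equiv.Perm.SameCycle.setoid Γ.flip) x).out x :=
      Quotient.mk_out (s := Equiv.Perm.SameCycle.setoid Γ.flip) x
    have hy : Γ.flip.SameCycle (Quotient.mk (Equiv.Perm.SameCycle.setoid Γ.flip) x).out y := by
      rw [h1]
      exact Quotient.mk_out (s := Equiv.Perm.SameCycle.setoid Γ.flip) y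
    rw [sameCycle_flip_iff Γ.flip_flip] at hx hy
    rcases hx with hx | hx
    · exact hx.trans (h2.mp hx).symm
    · rcases hy with hy | hy
      · exact (h2.mpr hy).trans hy.symm
      · rw [hx, hy]
  have := Nat.card_le_card_of_injective _ hinj
  rw [Nat.card_prod, Nat.card_eq_fintype_card (α := Bool), Fintype.card_bool,
    Nat.card_eq_fintype_card (α := Γ.H)] at this
  unfold cycleCount
  omega

/-- Trivalence gives `3V ≤ |H|` and the edges give `|H| ≤ 2E`; inserting `V + n + 2g = E + 2` bounds
`|H|`. -/
theorem card_le_of_hasType {g n : ℕ} (h : Γ.HasType g n) : Fintype.card Γ.H ≤ 6 * n + 12 * g := by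
  have h1 := three_mul_cycleCount_rot_le Γ
  have h2 := card_le_two_mul_cycleCount_flip Γ
  have h3 := h.2
  omega

theorem nonempty_iso_of_eq {B : ℕ} {N N' : Fin B} {r f : Equiv.Perm (Fin N)}
    {r' f' : Equiv.Perm (Fin N')}
    (h : (⟨N, (r, f)⟩ : (N : Fin B) × (Equiv.Perm (Fin N) × Equiv.Perm (Fin N))) = ⟨N', (r', f')⟩)
    (i : Γ.H ≃ Fin N) (i' : Δ.H ≃ Fin N') (hr : ∀ x, i (Γ.rot x) = r (i x))
    (hf : ∀ x, i (Γ.flip x) = f (i x)) (hr' : ∀ x, i' (Δ.rot x) = r' (i' x))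
    (hf' : ∀ x, i' (Δ.flip x) = f' (i' x)) : Nonempty (Γ.Iso Δ) := by
  cases h
  refine ⟨⟨i.trans i'.symm, fun x => ?_, fun x => ?_⟩⟩
  · rw [Equiv.trans_apply, Equiv.symm_apply_eq, hr', hr]
    simp
  · rw [Equiv.trans_apply, Equiv.symm_apply_eq, hf', hf]
    simp

/-- Isomorphism of ribbon graphs of given genus and number of boundary circuits. -/
def isoSetoid (g n : ℕ) : Setoid {Γ : RibbonGraph // Γ.HasType g n} where
  r Γ Δ := Nonempty (Γ.1.Iso Δ.1)
  iseqv := ⟨fun Γ => ⟨Iso.refl Γ.1⟩, fun ⟨φ⟩ => ⟨φ.symm⟩, fun ⟨φ⟩ ⟨ψ⟩ => ⟨φ.trans ψ⟩⟩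

/-- Numbering the half-edges turns a graph into two permutations of a set of bounded size, and this
datum determines the isomorphism class. -/
instance finite_isoSetoid (g n : ℕ) : Finite (Quotient (isoSetoid g n)) := by
  let D : {Γ : RibbonGraph // Γ.HasType g n} → (N : Fin (6 * n + 12 * g + 1)) ×
      (Equiv.Perm (Fin N) × Equiv.Perm (Fin N)) := fun Γ =>
    ⟨⟨Fintype.card Γ.1.H, Nat.lt_succ_of_le (card_le_of_hasType Γ.2)⟩,
      ((Fintype.equivFin Γ.1.H).permCongr Γ.1.rot, (Fintype.equivFin Γ.1.H).permCongr Γ.1.flip)⟩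
  refine Finite.of_injective (fun q : Quotient (isoSetoid g n) => D q.out) fun q r h => ?_
  rw [← q.out_eq, ← r.out_eq]
  refine Quotient.sound (nonempty_iso_of_eq h (Fintype.equivFin _) (Fintype.equivFin _) ?_ ?_ ?_ ?_)
  all_goals
    intro x
    simp

instance finite_iso (Γ Δ : RibbonGraph) : Finite (Γ.Iso Δ) :=
  Finite.of_injective (fun φ => φ.toEquiv) fun φ ψ h => Iso.ext fun x => by
    rw [show φ.toEquiv = ψ.toEquiv from h]

/-- The isomorphisms between two isomorphic graphs form a torsor under the automorphisms of either
one. -/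
theorem Iso.card_eq (φ : Γ.Iso Δ) : Nat.card (Γ.Iso Δ) = Nat.card (Δ.Iso Δ) :=
  Nat.card_congr ⟨fun ψ => φ.symm.trans ψ, fun ψ => φ.trans ψ,
    fun ψ => Iso.ext fun x => by simp [Iso.trans, Iso.symm],
    fun ψ => Iso.ext fun x => by simp [Iso.trans, Iso.symm]⟩

theorem Iso.card_eq' (φ : Γ.Iso Δ) : Nat.card (Γ.Iso Δ) = Nat.card (Γ.Iso Γ) :=
  Nat.card_congr ⟨fun ψ => ψ.trans φ.symm, fun ψ => ψ.trans φ,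
    fun ψ => Iso.ext fun x => by simp [Iso.trans, Iso.symm],
    fun ψ => Iso.ext fun x => by simp [Iso.trans, Iso.symm]⟩

theorem card_iso_self_ne_zero (Γ : RibbonGraph) : Nat.card (Γ.Iso Γ) ≠ 0 := by
  have : Nonempty (Γ.Iso Γ) := ⟨Iso.refl Γ⟩
  exact Nat.card_pos.ne'

end RibbonGraph

/-! ### Representatives of the isomorphism classes. -/

namespace OrientedRibbonGraph

open RibbonGraph

theorem exists_isRepresentatives (g n : ℕ) : ∃ S, IsRepresentatives g n S := by
  classical
  have := Fintype.ofFinite (Quotient (isoSetoid g n))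
  let F : Quotient (isoSetoid g n) → OrientedRibbonGraph := fun q =>
    ⟨q.out.1, Classical.choice (nonempty_orientation _)⟩
  refine ⟨Finset.univ.image F, ?_, ?_⟩
  · intro X hX
    obtain ⟨q, -, rfl⟩ := Finset.mem_image.mp hX
    exact q.out.2
  · intro Γ hΓ
    let q : Quotient (isoSetoid g n) := Quotient.mk _ ⟨Γ, hΓ⟩
    refine ⟨F q, ⟨Finset.mem_image_of_mem F (Finset.mem_univ q), ?_⟩, ?_⟩
    · exact (isoSetoid g n).symm (Quotient.mk_out (s := isoSetoid g n) ⟨Γ, hΓ⟩)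
    · rintro X ⟨hX, hiso⟩
      obtain ⟨r, -, rfl⟩ := Finset.mem_image.mp hX
      have : q = r := by
        rw [← r.out_eq]
        exact Quotient.sound (s := isoSetoid g n) hiso
      rw [this]

theorem IsRepresentatives.eq_of_iso {g n : ℕ} {S : Finset OrientedRibbonGraph}
    (hS : IsRepresentatives g n S) {X Y : OrientedRibbonGraph} (hX : X ∈ S) (hY : Y ∈ S)
    (h : Nonempty (X.graph.Iso Y.graph)) : X = Y :=
  (hS.2 X.graph (hS.1 X hX)).unique ⟨hX, ⟨Iso.refl _⟩⟩ ⟨hY, h⟩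

theorem IsRepresentatives.sum_eq {M : Type*} [AddCommMonoid M] {g n : ℕ}
    {S S' : Finset OrientedRibbonGraph} (hS : IsRepresentatives g n S)
    (hS' : IsRepresentatives g n S') (f : OrientedRibbonGraph → M)
    (hf : ∀ X Y : OrientedRibbonGraph, X.graph.Iso Y.graph → f X = f Y) :
    ∑ X ∈ S, f X = ∑ X ∈ S', f X := by
  choose! i hi using fun X (hX : X ∈ S) => (hS'.2 X.graph (hS.1 X hX)).exists
  refine Finset.sum_bij (fun X _ => i X) (fun X hX => (hi X hX).1) ?_ ?_ ?_
  · intro X hX Y hY hXY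
    obtain ⟨φ⟩ := (hi X hX).2
    obtain ⟨ψ⟩ := (hi Y hY).2
    rw [← show i X = i Y from hXY] at ψ
    exact hS.eq_of_iso hX hY ⟨φ.trans ψ.symm⟩
  · intro Y hY
    obtain ⟨X, hX, ⟨φ⟩⟩ := (hS.2 Y.graph (hS'.1 Y hY)).exists
    obtain ⟨ψ⟩ := (hi X hX).2
    exact ⟨X, hX, (hS'.eq_of_iso hY (hi X hX).1 ⟨φ.trans ψ⟩).symm⟩
  · intro X hX
    obtain ⟨φ⟩ := (hi X hX).2
    exact hf X _ φ

end OrientedRibbonGraph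

namespace CyclicAInfinity

open RibbonGraph

variable {k : Type*} [Field k] {W : Type*} [AddCommGroup W] [Module k W]
  {𝒲 : ZMod 2 → Submodule k W} (A : CyclicAInfinity 𝒲) {ι : Type*} [Fintype ι] [DecidableEq ι]
  {e : Module.Basis ι k W} {p : ι → ZMod 2} (he : ∀ i, e i ∈ 𝒲 (p i))
include he

theorem cycleChain_eq {g n : ℕ} {S S' : Finset OrientedRibbonGraph}
    (hS : OrientedRibbonGraph.IsRepresentatives g n S)
    (hS' : OrientedRibbonGraph.IsRepresentatives g n S') :
    A.cycleChain e p S = A.cycleChain e p S' := by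
  refine hS.sum_eq hS' _ fun X Y φ => ?_
  rw [div_eq_inv_mul, div_eq_inv_mul, mul_smul, mul_smul, ← φ.card_eq, φ.card_eq']
  congr 1
  exact A.partitionFunction_smul_toChain_iso he _ _ φ

end CyclicAInfinity

/-! ### Expanding a vertex into an edge. -/

namespace RibbonGraph

variable (Γ : RibbonGraph)

/-- The half-edges `x` and `y` cut their vertex into two parts with at least two half-edges each,
so that the vertex can be expanded into an edge. -/
def IsCut (x y : Γ.H) : Prop := Γ.SameVertex x y ∧ x ≠ y ∧ Γ.rot x ≠ y ∧ Γ.rot y ≠ x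

/-- The successor of a half-edge in the cyclic order after expanding a vertex into an edge. -/
def expandFun (x y : Γ.H) : Γ.H ⊕ Bool → Γ.H ⊕ Bool
  | Sum.inl z => if Γ.rot z = y then Sum.inr true else if Γ.rot z = x then Sum.inr false
      else Sum.inl (Γ.rot z)
  | Sum.inr true => Sum.inl x
  | Sum.inr false => Sum.inl y

variable {Γ} {x y : Γ.H}

theorem expandFun_injective (hxy : x ≠ y) : Function.Injective (Γ.expandFun x y) := by
  have hi := Γ.rot.injective
  rintro (z | _ | _) (w | _ | _) h <;> simp only [expandFun] at h <;> grind

variable (Γ) in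
/-- The edges after expanding a vertex into an edge. -/
def expandFlip : Equiv.Perm (Γ.H ⊕ Bool) := Equiv.sumCongr Γ.flip Equiv.boolNot

/-- Expand the vertex of `x` and `y` into an edge, with halves `Sum.inr true`, which is placed
before `x`, and `Sum.inr false`, which is placed before `y`. -/
noncomputable def expand (h : Γ.IsCut x y) : RibbonGraph where
  H := Γ.H ⊕ Bool
  rot := Equiv.ofBijective _ (Finite.injective_iff_bijective.mp (expandFun_injective h.2.1))
  flip := Γ.expandFlip
  flip_flip z := by
    rcases z with z | b
    · exact congrArg Sum.inl (Γ.flip_flip z)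
    · exact congrArg Sum.inr (Bool.not_not b)
  flip_ne z := by
    rcases z with z | b
    · exact fun h => Γ.flip_ne z (Sum.inl_injective h)
    · exact fun h => Bool.not_ne_self b (Sum.inr_injective h)
  trivalent z := by
    obtain ⟨-, h1, h2, h3⟩ := h
    change Γ.expandFun x y z ≠ z ∧ Γ.expandFun x y (Γ.expandFun x y z) ≠ z
    rcases z with z | _ | _
    · have ht := Γ.trivalent z
      simp only [expandFun]
      split_ifs <;> grind [expandFun]
    · simp only [expandFun]
      grind
    · simp only [expandFun]
      grind
  connected S hS hcl := by
    change ∀ z ∈ S, Γ.expandFun x y z ∈ S ∧ Γ.expandFlip z ∈ S at hcl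
    have hb : ∀ b, Sum.inr b ∈ S → Sum.inr (!b) ∈ S := fun b hb => (hcl _ hb).2
    have htx : Sum.inr true ∈ S → Sum.inl x ∈ S := fun h => (hcl _ h).1
    have hfy : Sum.inr false ∈ S → Sum.inl y ∈ S := fun h => (hcl _ h).1
    have huniv : Sum.inl ⁻¹' S = Set.univ := by
      refine Γ.connected _ ?_ fun z hz => ⟨?_, (hcl _ hz).2⟩
      · obtain ⟨z | _ | _, hz⟩ := hS
        exacts [⟨z, hz⟩, ⟨y, hfy hz⟩, ⟨x, htx hz⟩]
      · have := (hcl _ hz).1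
        simp only [expandFun] at this
        change Sum.inl (Γ.rot z) ∈ S
        split_ifs at this with h1 h2
        · rw [h1]
          exact hfy (hb true this)
        · rw [h2]
          exact htx (hb false this)
        · exact this
    have hl : ∀ z, Sum.inl z ∈ S := fun z => by
      have : z ∈ Sum.inl ⁻¹' S := by rw [huniv]; trivial
      exact this
    have ht : Sum.inr true ∈ S := by
      have := (hcl _ (hl (Γ.rot.symm y))).1
      simpa [expandFun] using this
    ext z
    simp only [Set.mem_univ, iff_true]
    rcases z with z | _ | _
    exacts [hl z, hb true ht, ht]

theorem IsCut.exists_block (h : Γ.IsCut x y) : ∃ X Y, Γ.block x = X ++ y :: Y :=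
  List.append_of_mem (Γ.mem_block.mpr h.1)

variable (h : Γ.IsCut x y)

/-- The half-edges of a graph, as half-edges of its expansion. -/
def old (z : Γ.H) : (expand h).H := Sum.inl z

/-- The two halves of the edge introduced by an expansion. -/
def new (b : Bool) : (expand h).H := Sum.inr b

theorem old_injective : Function.Injective (old h) := Sum.inl_injective

theorem new_injective : Function.Injective (new h) := Sum.inr_injective

theorem old_ne_new (z : Γ.H) (b : Bool) : old h z ≠ new h b := Sum.inl_ne_inr

theorem expand_cases {P : (expand h).H → Prop} (hl : ∀ z, P (old h z)) (ht : P (new h true))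
    (hf : P (new h false)) (z) : P z := by
  rcases z with z | _ | _
  exacts [hl z, hf, ht]

theorem expand_rot_old (z : Γ.H) : (expand h).rot (old h z) =
    if Γ.rot z = y then new h true else if Γ.rot z = x then new h false
      else old h (Γ.rot z) := rfl

theorem expand_rot_true : (expand h).rot (new h true) = old h x := rfl

theorem expand_rot_false : (expand h).rot (new h false) = old h y := rfl

theorem expand_flip_old (z : Γ.H) : (expand h).flip (old h z) = old h (Γ.flip z) := rfl

theorem expand_flip_new (b : Bool) : (expand h).flip (new h b) = new h (!b) := rfl

/-- Along a stretch that does not run into `x` or `y` the successor is unchanged by the expansion.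
Only the step out of the stretch is altered, where `t` takes the place of `w`. -/
theorem expand_chain {w : Γ.H} {t : (expand h).H}
    (ht : ∀ u, Γ.rot u = w → (expand h).rot (old h u) = t) {L : List Γ.H} {u : Γ.H}
    (hL : ∀ z ∈ L, z ≠ x ∧ z ≠ y) (hc : List.IsChain (fun a b => Γ.rot a = b) (u :: L ++ [w])) :
    List.IsChain (fun a b => (expand h).rot a = b) ((u :: L).map (old h) ++ [t]) := by
  induction L generalizing u with
  | nil =>
    simp only [List.cons_append, List.nil_append, List.isChain_cons_cons] at hc
    simp only [List.map_cons, List.map_nil, List.cons_append, List.nil_append,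
      List.isChain_cons_cons]
    exact ⟨ht u hc.1, List.isChain_singleton _⟩
  | cons v L ih =>
    simp only [List.cons_append, List.isChain_cons_cons] at hc
    simp only [List.map_cons, List.cons_append, List.isChain_cons_cons]
    refine ⟨?_, ih (fun z hz => hL z (List.mem_cons_of_mem _ hz)) hc.2⟩
    have hv := hL v List.mem_cons_self
    rw [expand_rot_old, hc.1, if_neg hv.2, if_neg hv.1]

theorem block_expand_of_not_sameVertex {z : Γ.H} (hz : ¬ Γ.SameVertex z x) :
    (expand h).block (old h z) = (Γ.block z).map (old h) := by
  obtain ⟨t, ht⟩ := Γ.exists_block_eq_cons z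
  have hc := Γ.block_chain z
  have hn := Γ.nodup_block z
  have hm : ∀ w, w ∈ z :: t → w ≠ x ∧ w ≠ y := by
    intro w hw
    rw [← ht, mem_block] at hw
    refine ⟨?_, ?_⟩
    · rintro rfl
      exact hz hw
    · rintro rfl
      exact hz (hw.trans h.1.symm)
  rw [ht] at hc hn ⊢
  refine (expand h).block_eq_of_chain ?_ ?_
  · rw [← List.map_cons]
    exact hn.map (old_injective h)
  · rw [← List.map_cons]
    refine expand_chain h (fun u hu => ?_) (fun w hw => hm w (List.mem_cons_of_mem _ hw)) hc
    have := hm z List.mem_cons_self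
    rw [expand_rot_old, hu, if_neg this.2, if_neg this.1]

/-- The cycle at `x` is cut before `x` and before `y`. The arc from `x` is closed up by the new half
`true`, which now follows the last half-edge before `y`; the arc from `y` is closed up by the new
half `false`. -/
theorem block_expand {X Y : List Γ.H} (hb : Γ.block x = X ++ y :: Y) :
    (expand h).block (new h true) = new h true :: X.map (old h) ∧
      (expand h).block (new h false) = new h false :: (y :: Y).map (old h) := by
  obtain ⟨t, ht⟩ := Γ.exists_block_eq_cons x
  have hc := Γ.block_chain x
  have hn := Γ.nodup_block x
  obtain ⟨X, rfl⟩ : ∃ X', X = x :: X' := by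
    rcases X with _ | ⟨x', X⟩
    · rw [ht] at hb
      exact absurd (List.cons.inj hb).1 h.2.1
    · rw [ht] at hb
      exact ⟨X, by rw [(List.cons.inj hb).1]⟩
  rw [hb] at hc hn
  rw [List.nodup_append] at hn
  obtain ⟨hn1, hn2, hn3⟩ := hn
  constructor
  · refine (expand h).block_eq_of_chain ?_ ?_
    · rw [List.nodup_cons]
      exact ⟨fun hm => (List.mem_map.mp hm).elim fun z hz => old_ne_new h _ _ hz.2,
        hn1.map (old_injective h)⟩
    · rw [List.map_cons, List.cons_append, List.cons_append, List.isChain_cons_cons]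
      refine ⟨expand_rot_true h, ?_⟩
      rw [← List.cons_append, ← List.map_cons]
      refine expand_chain h (w := y) (fun u hu => by rw [expand_rot_old, if_pos hu]) ?_ ?_
      · intro z hz
        refine ⟨?_, fun hzy => hn3 z (List.mem_cons_of_mem _ hz) y List.mem_cons_self hzy⟩
        rintro rfl
        exact (List.nodup_cons.mp hn1).1 hz
      · have : x :: X ++ y :: Y ++ [x] = (x :: X ++ [y]) ++ (Y ++ [x]) := by simp
        rw [this] at hc
        exact hc.left_of_append
  · refine (expand h).block_eq_of_chain ?_ ?_
    · rw [List.nodup_cons]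
      exact ⟨fun hm => (List.mem_map.mp hm).elim fun z hz => old_ne_new h _ _ hz.2,
        hn2.map (old_injective h)⟩
    · rw [List.map_cons, List.cons_append, List.cons_append, List.isChain_cons_cons]
      refine ⟨expand_rot_false h, ?_⟩
      rw [← List.cons_append, ← List.map_cons]
      refine expand_chain h (w := x) (fun u hu => ?_) ?_ ?_
      · rw [expand_rot_old, hu, if_neg h.2.1, if_pos rfl]
      · intro z hz
        refine ⟨fun hzx => hn3 x List.mem_cons_self z (List.mem_cons_of_mem _ hz) hzx.symm, ?_⟩
        rintro rfl
        exact (List.nodup_cons.mp hn2).1 hz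
      · rw [List.append_assoc] at hc
        exact hc.right_of_append

theorem not_isLoop_expand : ¬ (expand h).IsLoop (new h true) := by
  obtain ⟨X, Y, hb⟩ := h.exists_block
  unfold IsLoop
  rw [← mem_block, (block_expand h hb).1, expand_flip_new]
  simp [old_ne_new, (new_injective h).eq_iff]

/-- Contracting the edge introduced by an expansion gives back the original graph. -/
noncomputable def expandIso :
    Γ.Iso ((expand h).contract (new h true) (not_isLoop_expand h)) where
  toEquiv := Equiv.ofBijective (fun z => (⟨old h z, old_ne_new h _ _, old_ne_new h _ _⟩ :
    (expand h).Rest (new h true))) ⟨fun z w hzw => old_injective h (congrArg Subtype.val hzw), by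
      rintro ⟨z, hz⟩
      induction z using expand_cases with
      | hl z => exact ⟨z, rfl⟩
      | ht => exact absurd rfl hz.1
      | hf => exact absurd rfl hz.2⟩
  map_rot z := by
    refine Subtype.ext ?_
    change old h (Γ.rot z) = (expand h).nextFun (new h true) (old h z)
    unfold nextFun
    rw [expand_flip_new, Bool.not_true, expand_rot_true, expand_rot_false]
    rw [expand_rot_old]
    have hi := (new_injective h).eq_iff (a := true) (b := false)
    have hi' := (new_injective h).eq_iff (a := false) (b := true)
    have ho := old_ne_new h
    split_ifs <;> simp_all
  map_flip z := rfl

theorem expandIso_coe (z : Γ.H) : ((expandIso h).toEquiv z).1 = old h z := rfl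

end RibbonGraph

/-! ### Contractions and expansions are inverse to each other. -/

namespace RibbonGraph

variable {Γ Δ : RibbonGraph}

theorem nextFun_eq_rot_flip_iff {a z : Γ.H} (hz : z ≠ a ∧ z ≠ Γ.flip a) :
    Γ.nextFun a z = Γ.rot (Γ.flip a) ↔ Γ.rot z = a := by
  unfold nextFun
  have hi := Γ.rot.injective.eq_iff (a := a) (b := Γ.flip a)
  have hi' := Γ.rot.injective.eq_iff (a := z) (b := Γ.flip a)
  have := Γ.flip_ne a
  split_ifs with h1 h2
  · simp [h1]
  · rw [hi]
    exact ⟨fun h => absurd h.symm this, fun h => absurd h h1⟩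
  · rw [hi']
    exact ⟨fun h => absurd h hz.2, fun h => absurd h h1⟩

theorem nextFun_eq_rot_iff {a z : Γ.H} (hz : z ≠ a ∧ z ≠ Γ.flip a) :
    Γ.nextFun a z = Γ.rot a ↔ Γ.rot z = Γ.flip a := by
  unfold nextFun
  have hi := Γ.rot.injective.eq_iff (a := Γ.flip a) (b := a)
  have hi' := Γ.rot.injective.eq_iff (a := z) (b := a)
  have := Γ.flip_ne a
  split_ifs with h1 h2
  · rw [hi, h1]
    exact ⟨fun h => absurd h this, fun h => absurd h.symm this⟩
  · simp [h2]
  · rw [hi']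
    exact ⟨fun h => absurd h hz.1, fun h => absurd h h2⟩

section

variable {a : Γ.H} (ha : ¬ Γ.IsLoop a)

/-- The half-edge that follows `a`, in the contracted graph. -/
def afterTail : (Γ.contract a ha).H := ⟨Γ.rot a, (Γ.trivalent a).1, Γ.rot_ne_flip a ha⟩

/-- The half-edge that follows the other half of the edge of `a`, in the contracted graph. -/
def afterHead : (Γ.contract a ha).H :=
  ⟨Γ.rot (Γ.flip a), Γ.rot_flip_ne a ha, (Γ.trivalent (Γ.flip a)).1⟩

theorem contract_rot_coe (z : (Γ.contract a ha).H) :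
    ((Γ.contract a ha).rot z).1 = Γ.nextFun a z.1 := rfl

theorem rot_eq_afterHead_iff {z : (Γ.contract a ha).H} :
    (Γ.contract a ha).rot z = afterHead ha ↔ Γ.rot z.1 = a := by
  rw [← nextFun_eq_rot_flip_iff z.2]
  exact Subtype.ext_iff

theorem rot_eq_afterTail_iff {z : (Γ.contract a ha).H} :
    (Γ.contract a ha).rot z = afterTail ha ↔ Γ.rot z.1 = Γ.flip a := by
  rw [← nextFun_eq_rot_iff z.2]
  exact Subtype.ext_iff

/-- The vertices at the two ends of `a` have valence at least three, so each leaves at least two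
half-edges on its side of the merged vertex. -/
theorem isCut_contract : (Γ.contract a ha).IsCut (afterTail ha) (afterHead ha) := by
  refine ⟨(sameVertex_contract_iff ha _ _).mpr (Or.inr ⟨Or.inl (Γ.sameVertex_rot a),
    Or.inr (Γ.sameVertex_rot _)⟩), fun h => ?_, ?_, ?_⟩
  · exact Γ.flip_ne a (Γ.rot.injective (congrArg Subtype.val h)).symm
  · rw [ne_eq, rot_eq_afterHead_iff]
    exact (Γ.trivalent a).2
  · rw [ne_eq, rot_eq_afterTail_iff]
    exact (Γ.trivalent (Γ.flip a)).2

end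

theorem IsCut.map {x y : Γ.H} (h : Γ.IsCut x y) (φ : Γ.Iso Δ) :
    Δ.IsCut (φ.toEquiv x) (φ.toEquiv y) := by
  unfold IsCut
  rw [φ.sameVertex_iff, ← φ.map_rot, ← φ.map_rot]
  simp only [ne_eq, φ.toEquiv.injective.eq_iff]
  exact h

/-- A graph `Γ` is an expansion of each of its contractions. -/
theorem exists_iso_expand {a : Γ.H} (ha : ¬ Γ.IsLoop a) (θ : (Γ.contract a ha).Iso Δ) :
    ∃ φ : (expand ((isCut_contract ha).map θ)).Iso Γ,
      (∀ z, φ.toEquiv (old _ (θ.toEquiv z)) = z.1) ∧ φ.toEquiv (new _ true) = a ∧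
        φ.toEquiv (new _ false) = Γ.flip a := by
  set h := (isCut_contract ha).map θ
  let f : (expand h).H → Γ.H := Sum.elim (fun z => (θ.toEquiv.symm z).1)
    fun b => if b then a else Γ.flip a
  have hold : ∀ z, f (old h (θ.toEquiv z)) = z.1 := fun z =>
    congrArg Subtype.val (θ.toEquiv.symm_apply_apply z)
  have ht : f (new h true) = a := rfl
  have hf : f (new h false) = Γ.flip a := rfl
  have hbij : Function.Bijective f := by
    constructor
    · intro z w
      induction z using expand_cases with
      | hl z =>
        obtain ⟨z, rfl⟩ := θ.toEquiv.surjective z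
        induction w using expand_cases with
        | hl w =>
          obtain ⟨w, rfl⟩ := θ.toEquiv.surjective w
          rw [hold, hold]
          intro hzw
          rw [show z = w from Subtype.ext hzw]
        | ht =>
          rw [hold, ht]
          exact fun hz => absurd hz z.2.1
        | hf =>
          rw [hold, hf]
          exact fun hz => absurd hz z.2.2
      | ht =>
        induction w using expand_cases with
        | hl w =>
          obtain ⟨w, rfl⟩ := θ.toEquiv.surjective w
          rw [hold, ht]
          exact fun hz => absurd hz.symm w.2.1
        | ht => exact fun _ => rfl
        | hf =>
          rw [ht, hf]
          exact fun hz => absurd hz.symm (Γ.flip_ne a)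
      | hf =>
        induction w using expand_cases with
        | hl w =>
          obtain ⟨w, rfl⟩ := θ.toEquiv.surjective w
          rw [hold, hf]
          exact fun hz => absurd hz.symm w.2.2
        | ht =>
          rw [ht, hf]
          exact fun hz => absurd hz (Γ.flip_ne a)
        | hf => exact fun _ => rfl
    · intro z
      by_cases hz : z ≠ a ∧ z ≠ Γ.flip a
      · exact ⟨_, hold ⟨z, hz⟩⟩
      · rw [not_and_or, not_not, not_not] at hz
        rcases hz with rfl | rfl
        exacts [⟨_, ht⟩, ⟨_, hf⟩]
  refine ⟨⟨Equiv.ofBijective f hbij, fun z => ?_, fun z => ?_⟩, hold, ht, hf⟩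
  · change f _ = Γ.rot (f z)
    induction z using expand_cases with
    | hl z =>
      obtain ⟨z, rfl⟩ := θ.toEquiv.surjective z
      rw [hold, expand_rot_old]
      simp only [← θ.map_rot, θ.toEquiv.injective.eq_iff, rot_eq_afterHead_iff,
        rot_eq_afterTail_iff]
      split_ifs with h1 h2
      · rw [ht, h1]
      · rw [hf, h2]
      · rw [hold, contract_rot_coe, nextFun, if_neg h1, if_neg h2]
    | ht => rw [expand_rot_true, hold, ht]; rfl
    | hf => rw [expand_rot_false, hold, hf]; rfl
  · change f _ = Γ.flip (f z)
    induction z using expand_cases with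
    | hl z =>
      obtain ⟨z, rfl⟩ := θ.toEquiv.surjective z
      rw [hold, expand_flip_old, ← θ.map_flip, hold]
      rfl
    | ht => rw [expand_flip_new, ht]; exact hf
    | hf => rw [expand_flip_new, hf, Γ.flip_flip]; exact ht

variable (Γ Δ)

/-- The ways of obtaining `Δ` from `Γ` by contracting an edge. -/
abbrev Contractions : Type := (a : {a : Γ.H // ¬ Γ.IsLoop a}) × (Γ.contract a.1 a.2).Iso Δ

/-- The ways of obtaining `Γ` from `Δ` by expanding a vertex. -/
abbrev Expansions : Type := (c : {c : Δ.H × Δ.H // Δ.IsCut c.1 c.2}) × (expand c.2).Iso Γ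

variable {Γ Δ}

theorem Contractions.ext' {P Q : Contractions Γ Δ} (h1 : P.1.1 = Q.1.1)
    (h2 : ∀ z, (P.2.toEquiv.symm z).1 = (Q.2.toEquiv.symm z).1) : P = Q := by
  obtain ⟨⟨a, ha⟩, θ⟩ := P
  obtain ⟨⟨b, hb⟩, τ⟩ := Q
  obtain rfl : a = b := h1
  have : θ = τ := Iso.ext fun z => by
    have := h2 (θ.toEquiv z)
    simp only [Equiv.symm_apply_apply] at this
    rw [show z = τ.toEquiv.symm (θ.toEquiv z) from Subtype.ext this, Equiv.apply_symm_apply,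
      ← show z = τ.toEquiv.symm (θ.toEquiv z) from Subtype.ext this]
  rw [this]

/-- The contraction that undoes an expansion. -/
noncomputable def Expansions.contraction (Q : Expansions Γ Δ) : Contractions Γ Δ :=
  ⟨⟨Q.2.toEquiv (new Q.1.2 true), mt Q.2.isLoop_iff.mp (not_isLoop_expand Q.1.2)⟩,
    (Q.2.symm.contract (Or.inl (Equiv.symm_apply_apply _ _)) _
      (not_isLoop_expand Q.1.2)).trans (expandIso Q.1.2).symm⟩

theorem Expansions.contraction_symm (Q : Expansions Γ Δ) (z : Δ.H) :
    (Q.contraction.2.toEquiv.symm z).1 = Q.2.toEquiv (old Q.1.2 z) := rfl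

/-- An expansion is recovered from its contraction: `x` and `y` are the successors of the two new
halves, and the isomorphism is known on the old half-edges and on the contracted edge. Surjectivity
is `exists_iso_expand`. -/
theorem Expansions.bijective_contraction :
    Function.Bijective (Expansions.contraction : Expansions Γ Δ → Contractions Γ Δ) := by
  constructor
  · intro P Q hPQ
    have h1 : P.2.toEquiv (new P.1.2 true) = Q.2.toEquiv (new Q.1.2 true) :=
      congrArg (fun R : Contractions Γ Δ => R.1.1) hPQ
    have h2 : ∀ z, P.2.toEquiv (old P.1.2 z) = Q.2.toEquiv (old Q.1.2 z) := fun z => by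
      rw [← P.contraction_symm, ← Q.contraction_symm, hPQ]
    have h3 : P.2.toEquiv (new P.1.2 false) = Q.2.toEquiv (new Q.1.2 false) := by
      have := congrArg Γ.flip h1
      rwa [← P.2.map_flip, ← Q.2.map_flip] at this
    obtain ⟨⟨⟨x, y⟩, hc⟩, φ⟩ := P
    obtain ⟨⟨⟨x', y'⟩, hc'⟩, ψ⟩ := Q
    simp only at h1 h2 h3
    obtain rfl : x = x' := by
      have := congrArg Γ.rot h1
      rw [← φ.map_rot, ← ψ.map_rot, expand_rot_true, expand_rot_true, ← h2] at this
      exact old_injective hc (φ.toEquiv.injective this)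
    obtain rfl : y = y' := by
      have := congrArg Γ.rot h3
      rw [← φ.map_rot, ← ψ.map_rot, expand_rot_false, expand_rot_false, ← h2] at this
      exact old_injective hc (φ.toEquiv.injective this)
    have : φ = ψ := Iso.ext fun z => by
      induction z using expand_cases with
      | hl z => exact h2 z
      | ht => exact h1
      | hf => exact h3
    rw [this]
  · rintro ⟨⟨a, ha⟩, θ⟩
    obtain ⟨φ, h1, h2, -⟩ := exists_iso_expand ha θ
    refine ⟨⟨⟨(_, _), (isCut_contract ha).map θ⟩, φ⟩, Contractions.ext' h2 fun z => ?_⟩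
    rw [Expansions.contraction_symm]
    have := h1 (θ.toEquiv.symm z)
    rwa [Equiv.apply_symm_apply] at this

end RibbonGraph

/-! ### Counting edges of graphs as cuts of their contractions. -/

namespace OrientedRibbonGraph

open RibbonGraph

/-- Exactly one representative `X` is isomorphic to `Γ`, through `|Aut X|` isomorphisms, so
averaging over them inserts a sum over identifications with representatives. -/
theorem IsRepresentatives.eq_sum_iso {k M : Type*} [Field k] [CharZero k] [AddCommGroup M]
    [Module k M] {g n : ℕ} {S : Finset OrientedRibbonGraph} (hS : IsRepresentatives g n S)
    [∀ Γ Δ : RibbonGraph, Fintype (Γ.Iso Δ)] {Γ : RibbonGraph} (hΓ : Γ.HasType g n) (m : M) :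
    m = ∑ X ∈ S, ∑ _φ : Γ.Iso X.graph, (Nat.card (X.graph.Iso X.graph) : k)⁻¹ • m := by
  obtain ⟨X, ⟨hX, ⟨φ⟩⟩, huniq⟩ := hS.2 Γ hΓ
  rw [Finset.sum_eq_single_of_mem X hX, Finset.sum_const, Finset.card_univ,
    ← Nat.card_eq_fintype_card, ← Nat.cast_smul_eq_nsmul k, smul_smul, φ.card_eq, mul_inv_cancel₀,
    one_smul]
  · exact_mod_cast card_iso_self_ne_zero X.graph
  · intro Y hY hYX
    have : IsEmpty (Γ.Iso Y.graph) := ⟨fun ψ => hYX (huniq Y ⟨hY, ⟨ψ⟩⟩)⟩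
    exact Fintype.sum_empty _

open Classical in
theorem sum_eq_sum_not_isLoop {M : Type*} [AddCommMonoid M] {Γ : RibbonGraph} (f : Γ.H → M)
    (hloop : ∀ a, Γ.IsLoop a → f a = 0) : ∑ a, f a = ∑ a : {a // ¬ Γ.IsLoop a}, f a.1 := by
  rw [← Finset.sum_subtype (Finset.univ.filter fun a => ¬ Γ.IsLoop a) (by simp)]
  refine (Finset.sum_subset (Finset.filter_subset _ _) fun a _ ha => hloop a ?_).symm
  simpa using ha

open Classical in
/-- Summing over all edges of all graphs is the same as summing over all expansions of vertices of
all graphs. -/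
theorem IsRepresentatives.sum_edges_eq_sum_cuts {k M : Type*} [Field k] [CharZero k]
    [AddCommGroup M] [Module k M] {g n : ℕ} {S : Finset OrientedRibbonGraph}
    (hS : IsRepresentatives g n S) (F : (Γ : RibbonGraph) → Γ.H → M)
    (hF : ∀ {Γ Δ : RibbonGraph} (φ : Γ.Iso Δ) (a : Γ.H), F Δ (φ.toEquiv a) = F Γ a)
    (hloop : ∀ {Γ : RibbonGraph} (a : Γ.H), Γ.IsLoop a → F Γ a = 0) :
    ∑ X ∈ S, (Nat.card (X.graph.Iso X.graph) : k)⁻¹ • ∑ a, F X.graph a =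
      ∑ X ∈ S, (Nat.card (X.graph.Iso X.graph) : k)⁻¹ •
        ∑ c : {c : X.graph.H × X.graph.H // X.graph.IsCut c.1 c.2},
          F (expand c.2) (new c.2 true) := by
  have := fun Γ Δ : RibbonGraph => Fintype.ofFinite (Γ.Iso Δ)
  let w : OrientedRibbonGraph → k := fun X => (Nat.card (X.graph.Iso X.graph) : k)⁻¹
  have h1 : ∀ X ∈ S, ∑ a, F X.graph a =
      ∑ Y ∈ S, ∑ P : Contractions X.graph Y.graph, w Y • F X.graph P.1.1 := by
    intro X hX
    simp only [Fintype.sum_sigma]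
    rw [Finset.sum_comm, sum_eq_sum_not_isLoop _ hloop]
    exact Finset.sum_congr rfl fun a _ =>
      hS.eq_sum_iso ((hasType_contract_iff a.2).mpr (hS.1 X hX)) _
  have h2 : ∀ Y ∈ S, ∑ c : {c : Y.graph.H × Y.graph.H // Y.graph.IsCut c.1 c.2},
      F (expand c.2) (new c.2 true) =
      ∑ X ∈ S, ∑ P : Expansions X.graph Y.graph, w X • F (expand P.1.2) (new P.1.2 true) := by
    intro Y hY
    simp only [Fintype.sum_sigma]
    rw [Finset.sum_comm]
    exact Finset.sum_congr rfl fun c _ => hS.eq_sum_iso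
      ((hasType_contract_iff (not_isLoop_expand c.2)).mp
        ((expandIso c.2).hasType_iff.mp (hS.1 Y hY))) _
  -- Both sides become sums over pairs of representatives with weight `1/(|Aut X||Aut Y|)`: on one
  -- side over contractions of `X` to `Y`, on the other over expansions of `Y` to `X`. The bijection
  -- between these matches the terms.
  trans ∑ X ∈ S, ∑ Y ∈ S, ∑ P : Contractions X.graph Y.graph, w X • w Y • F X.graph P.1.1
  · refine Finset.sum_congr rfl fun X hX => ?_
    rw [h1 X hX]
    simp only [Finset.smul_sum, w]
  trans ∑ Y ∈ S, ∑ X ∈ S, ∑ P : Expansions X.graph Y.graph,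
    w Y • w X • F (expand P.1.2) (new P.1.2 true)
  · rw [Finset.sum_comm]
    refine Finset.sum_congr rfl fun Y _ => Finset.sum_congr rfl fun X _ => ?_
    rw [← (Equiv.ofBijective _ Expansions.bijective_contraction).sum_comp]
    refine Finset.sum_congr rfl fun P _ => ?_
    rw [smul_comm, ← hF P.2]
    rfl
  · refine Finset.sum_congr rfl fun Y hY => ?_
    rw [h2 Y hY]
    simp only [Finset.smul_sum, w]

end OrientedRibbonGraph

/-! ### Orientation and writing of an expansion of the last vertex. -/

namespace RibbonGraph

variable {Γ : RibbonGraph} {x y : Γ.H} (h : Γ.IsCut x y)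

/-- A half-edge of the original graph at the same vertex. -/
def oldRep : (expand h).H → Γ.H := Sum.elim id fun b => if b then x else y

theorem oldRep_old (z : Γ.H) : oldRep h (old h z) = z := rfl

theorem sameVertex_oldRep (z : (expand h).H) : (expand h).SameVertex z (old h (oldRep h z)) := by
  induction z using expand_cases with
  | hl z => exact Equiv.Perm.SameCycle.refl _ _
  | ht => exact (expand h).sameVertex_rot (new h true)
  | hf => exact (expand h).sameVertex_rot (new h false)

theorem sameVertex_oldRep_iff (z w : (expand h).H) :
    Γ.SameVertex (oldRep h z) (oldRep h w) ↔ (expand h).SameVertex z w ∨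
      ((expand h).AtEnds (new h true) z ∧ (expand h).AtEnds (new h true) w) := by
  have hz := sameVertex_oldRep h z
  have hw := sameVertex_oldRep h w
  rw [← (expandIso h).sameVertex_iff, sameVertex_contract_iff, expandIso_coe, expandIso_coe]
  refine or_congr ⟨fun h' => (hz.trans h').trans hw.symm, fun h' => (hz.symm.trans h').trans hw⟩
    (and_congr ?_ ?_)
  · exact ⟨(expand h).atEnds_of_sameVertex _ hz.symm, (expand h).atEnds_of_sameVertex _ hz⟩
  · exact ⟨(expand h).atEnds_of_sameVertex _ hw.symm, (expand h).atEnds_of_sameVertex _ hw⟩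

section

variable {o : Γ.Orientation} (hlast : ∀ z, o.label z ≤ o.label x)

open Classical in
/-- The orientation of an expansion of the last vertex: the end of the new edge before `y` comes
last, the other end comes before it, and the arrow leads from the latter to the former. -/
noncomputable def expandOrientation : (expand h).Orientation where
  label z := if (expand h).SameVertex (new h false) z then o.label x + 1
    else o.label (oldRep h z)
  label_eq_iff z w := by
    by_cases hz : (expand h).SameVertex (new h false) z <;>
      by_cases hw : (expand h).SameVertex (new h false) w
    · simp only [if_pos hz, if_pos hw, true_iff]
      exact hz.symm.trans hw
    · simp only [if_pos hz, if_neg hw]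
      have := hlast (oldRep h w)
      exact ⟨fun h' => by omega, fun h' => absurd (hz.trans h') hw⟩
    · simp only [if_neg hz, if_pos hw]
      have := hlast (oldRep h z)
      exact ⟨fun h' => by omega, fun h' => absurd (hw.trans h'.symm) hz⟩
    · simp only [if_neg hz, if_neg hw]
      rw [o.label_eq_iff, sameVertex_oldRep_iff]
      refine ⟨?_, Or.inl⟩
      rintro (h' | ⟨h1 | h1, h2 | h2⟩)
      exacts [h', h1.symm.trans h2, absurd h2 hw, absurd h1 hz, absurd h1 hz]
  tail := Sum.elim o.tail id
  tail_flip z := by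
    induction z using expand_cases with
    | hl z => exact o.tail_flip z
    | ht => rfl
    | hf => rfl

open Classical in
theorem expandOrientation_label (z : (expand h).H) : (expandOrientation h hlast).label z =
    if (expand h).SameVertex (new h false) z then o.label x + 1 else o.label (oldRep h z) := rfl

theorem expandOrientation_label_new_false :
    (expandOrientation h hlast).label (new h false) = o.label x + 1 := by
  rw [expandOrientation_label, if_pos (show (expand h).SameVertex _ _ from .refl _ _)]

theorem not_sameVertex_new : ¬ (expand h).SameVertex (new h false) (new h true) := fun h' =>
  not_isLoop_expand h h'.symm

theorem expandOrientation_label_new_true :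
    (expandOrientation h hlast).label (new h true) = o.label x := by
  rw [expandOrientation_label, if_neg (not_sameVertex_new h)]
  rfl

theorem expandOrientation_after : (expandOrientation h hlast).after (new h false) = 0 := by
  rw [Orientation.after_eq, Finset.card_eq_zero, Finset.filter_eq_empty_iff]
  intro m hm
  obtain ⟨z, rfl⟩ := Orientation.mem_labels.mp hm
  rw [expandOrientation_label_new_false, expandOrientation_label]
  have := hlast (oldRep h z)
  split_ifs <;> omega

/-- The head is the last vertex and the arrow starts at the half `true`, so both signs are 1. The
merged vertex gets back the label it had in `o`, hence contraction returns `o` exactly. -/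
theorem edgeBoundary'_expand (k : Type*) [Field k] :
    edgeBoundary' k (expandOrientation h hlast) (new h true) =
      OrientedRibbonGraph.toChain k ⟨Γ, o⟩ := by
  rw [edgeBoundary'_of_not_isLoop k _ (not_isLoop_expand h), edgeBoundary, expand_flip_new,
    Bool.not_true, expandOrientation_after,
    if_pos (show (expandOrientation h hlast).tail (new h true) = true from rfl), pow_zero, one_mul, one_smul]
  refine (toChain_iso k (expandIso h) (fun z w => ?_) fun _ _ => rfl).symm
  have hval : ∀ z, ((expandOrientation h hlast).contract (new h true)
      (not_isLoop_expand h)).label ((expandIso h).toEquiv z) = o.label z := by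
    intro z
    rw [Orientation.contract_label, expandIso_coe, expand_flip_new, Bool.not_true,
      expandOrientation_label_new_false, expandOrientation_label_new_true,
      expandOrientation_label, oldRep_old]
    have := hlast z
    by_cases hz : (expand h).SameVertex (new h false) (old h z)
    · rw [if_pos hz, if_pos rfl, o.label_eq_iff]
      exact (sameVertex_oldRep_iff h (new h true) (old h z)).mpr
        (Or.inr ⟨Or.inl (Equiv.Perm.SameCycle.refl _ _), Or.inr hz⟩)
    · rw [if_neg hz, if_neg (by omega)]
  rw [hval, hval]

/-- A way of writing down the tensor of an expansion. -/
def expandWriting (w : OrientedRibbonGraph.Writing ⟨Γ, o⟩) {S : List Γ.H} {s : Γ.H}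
    (hS : w.starts = S ++ [s]) (hs : Γ.SameVertex s x) :
    OrientedRibbonGraph.Writing ⟨expand h, expandOrientation h hlast⟩ where
  starts := S.map (old h) ++ [new h true, new h false]
  starts_sorted := by
    have hsort := w.starts_sorted
    rw [hS, List.map_append, List.pairwise_append] at hsort
    obtain ⟨h1, -, h3⟩ := hsort
    have hlt : ∀ z ∈ S, o.label z < o.label x := by
      intro z hz
      rw [← (o.label_eq_iff s x).mpr hs]
      exact h3 _ (List.mem_map_of_mem hz) _ (by simp)
    have hlab : ∀ z ∈ S, (expandOrientation h hlast).label (old h z) = o.label z := by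
      intro z hz
      rw [expandOrientation_label, if_neg, oldRep_old]
      intro hz'
      have : o.label z = o.label x := (o.label_eq_iff _ _).mpr
        ((sameVertex_oldRep_iff h (old h z) (new h true)).mpr
          (Or.inr ⟨Or.inr hz', Or.inl (Equiv.Perm.SameCycle.refl _ _)⟩))
      have := hlt z hz
      omega
    change ((S.map (old h) ++ [new h true, new h false]).map
      (expandOrientation h hlast).label).Pairwise (· < ·)
    have hm : (S.map (old h)).map (expandOrientation h hlast).label = S.map o.label := by
      rw [List.map_map]
      exact List.map_congr_left hlab
    rw [List.map_append, hm, List.pairwise_append, List.map_cons, List.map_cons, List.map_nil,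
      expandOrientation_label_new_false, expandOrientation_label_new_true]
    refine ⟨h1, by simp, ?_⟩
    intro a ha b hb
    obtain ⟨z, hz, rfl⟩ := List.mem_map.mp ha
    have := hlt z hz
    simp only [List.mem_cons, List.not_mem_nil, or_false] at hb
    rcases hb with rfl | rfl <;> omega
  starts_cover z := by
    change ∃ t ∈ S.map (old h) ++ [new h true, new h false], (expand h).SameVertex t z
    by_cases hz : (expand h).AtEnds (new h true) z
    · rcases hz with hz | hz
      · exact ⟨new h true, by simp, hz⟩
      · exact ⟨new h false, by simp, hz⟩
    · obtain ⟨t, ht, htz⟩ := w.starts_cover (oldRep h z)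
      have key : ∀ u, Γ.SameVertex (oldRep h u) (oldRep h z) → (expand h).SameVertex u z :=
        fun u hu => ((sameVertex_oldRep_iff h u z).mp hu).resolve_right fun h' => hz h'.2
      rw [hS, List.mem_append, List.mem_singleton] at ht
      rcases ht with ht | rfl
      · exact ⟨old h t, List.mem_append_left _ (List.mem_map_of_mem ht), key (old h t) htz⟩
      · exact absurd (Or.inl (key (new h true) (hs.symm.trans htz))) hz
  edges := new h true :: w.edges.map (old h)
  edges_nodup := List.nodup_cons.mpr ⟨fun hm => (List.mem_map.mp hm).elim fun z hz =>
    old_ne_new h _ _ hz.2, w.edges_nodup.map (old_injective h)⟩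
  mem_edges z := by
    change z ∈ new h true :: w.edges.map (old h) ↔ (expandOrientation h hlast).tail z = true
    rw [List.mem_cons, List.mem_map]
    induction z using expand_cases (h := h) with
    | hl z =>
      rw [show (expandOrientation h hlast).tail (old h z) = o.tail z from rfl]
      rw [← w.mem_edges z]
      constructor
      · rintro (hz | ⟨u, hu, huz⟩)
        · exact absurd hz (old_ne_new h _ _)
        · rwa [← old_injective h huz]
      · exact fun hz => Or.inr ⟨z, hz, rfl⟩
    | ht => exact ⟨fun _ => rfl, fun _ => Or.inl rfl⟩
    | hf =>
      refine ⟨?_, fun hf => absurd hf Bool.false_ne_true⟩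
      rintro (hz | ⟨u, -, huz⟩)
      · exact absurd (new_injective h hz) Bool.false_ne_true
      · exact absurd huz (old_ne_new h _ _)

end

end RibbonGraph

/-! ### The number `Z` of an expansion. -/

namespace CyclicAInfinity

open RibbonGraph

variable {k : Type*} [Field k] {W : Type*} [AddCommGroup W] [Module k W]
  {𝒲 : ZMod 2 → Submodule k W} (A : CyclicAInfinity 𝒲) {ι : Type*} [Fintype ι] [DecidableEq ι]
  {e : Module.Basis ι k W} {p : ι → ZMod 2} (he : ∀ i, e i ∈ 𝒲 (p i))
include he

/-- With the expanded vertex last, the two new blocks come at the end and the new arrow can be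
written first, which is the shape required by `diagramSum_expand`. -/
theorem partitionFunction_expand {Γ : RibbonGraph} {x y : Γ.H} (h : Γ.IsCut x y)
    {o : Γ.Orientation} (hlast : ∀ z, o.label z ≤ o.label x)
    (w : OrientedRibbonGraph.Writing ⟨Γ, o⟩) {S : List Γ.H} {s : Γ.H}
    (hS : w.starts = S ++ [s]) (hs : Γ.SameVertex s x) {X Y : List Γ.H}
    (hXY : Γ.block x = X ++ y :: Y) (hd : IsDiagram (S.map Γ.block ++ [X ++ y :: Y]) w.arrows) :
    A.partitionFunction e p ⟨expand h, expandOrientation h hlast⟩ =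
      -∑ j, A.compositeTerm e p (S.map Γ.block) X (y :: Y) w.arrows j := by
  rw [A.partitionFunction_eq he (expandWriting h hlast w hS hs), ← A.diagramSum_expand he hd]
  have hb := block_expand h hXY
  have h1 : (expandWriting h hlast w hS hs).blocks =
      (S.map Γ.block).map (List.map (old h)) ++
        [new h true :: X.map (old h), new h false :: (y :: Y).map (old h)] := by
    change (S.map (old h) ++ [new h true, new h false]).map (expand h).block = _
    rw [List.map_append, List.map_cons, List.map_cons, List.map_nil, hb.1, hb.2, List.map_map,
      List.map_map]
    congr 1
    refine List.map_congr_left fun z hz => ?_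
    refine block_expand_of_not_sameVertex h fun hzx => ?_
    have hsort := w.starts_sorted
    rw [hS, List.map_append, List.pairwise_append] at hsort
    have := hsort.2.2 _ (List.mem_map_of_mem hz) (o.label s) (by simp)
    exact this.ne ((o.label_eq_iff _ _).mpr (hzx.trans hs.symm))
  have h2 : (expandWriting h hlast w hS hs).arrows =
      (new h true, new h false) :: w.arrows.map (Prod.map (old h) (old h)) := by
    change (new h true :: w.edges.map (old h)).map (fun a => (a, (expand h).flip a)) = _
    rw [List.map_cons, List.map_map]
    change _ :: _ = _ :: (w.edges.map fun a => (a, Γ.flip a)).map _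
    rw [List.map_map]
    rfl
  rw [h1, h2]
  rfl

end CyclicAInfinity

theorem Finset.sum_range_sum_range_eq {M : Type*} [AddCommMonoid M] (f : ℕ → ℕ → M)
    (hf : ∀ n, f n n = 0) (N : ℕ) :
    ∑ i ∈ Finset.range N, ∑ j ∈ Finset.range N, f i j =
      ∑ n ∈ Finset.range N, ∑ m ∈ Finset.range n, (f m n + f n m) := by
  induction N with
  | zero => rfl
  | succ N ih =>
    rw [Finset.sum_range_succ, Finset.sum_range_succ (n := N) (f := fun n => ∑ m ∈ range n, _), ← ih,
      Finset.sum_range_succ, hf, add_zero]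
    simp only [Finset.sum_range_succ, Finset.sum_add_distrib]
    rw [add_assoc]

/-! ### Placing a vertex last, and sums over the half-edges at a vertex. -/

namespace RibbonGraph

variable {Γ : RibbonGraph}

theorem exists_orientation_last (x : Γ.H) :
    ∃ o : Γ.Orientation, ∀ z, o.label z ≤ o.label x := by
  obtain ⟨o⟩ := nonempty_orientation Γ
  obtain ⟨y, hy⟩ := Finite.exists_max o.label
  refine ⟨o.swap x y, fun z => ?_⟩
  have h1 : (o.swap x y).label x = o.label y := Equiv.swap_apply_left _ _
  have h2 := (o.swap x y).label_mem z
  rw [o.labels_swap] at h2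
  obtain ⟨u, hu⟩ := Orientation.mem_labels.mp h2
  rw [h1, ← hu]
  exact hy u

theorem exists_starts_eq {o : Γ.Orientation} {x : Γ.H} (hlast : ∀ z, o.label z ≤ o.label x)
    (w : OrientedRibbonGraph.Writing ⟨Γ, o⟩) :
    ∃ S s, w.starts = S ++ [s] ∧ Γ.SameVertex s x := by
  obtain ⟨t, ht, htx⟩ := w.starts_cover x
  rcases List.eq_nil_or_concat w.starts with h | ⟨S, s, h⟩
  · rw [h] at ht
    exact absurd ht List.not_mem_nil
  · rw [List.concat_eq_append] at h
    refine ⟨S, s, h, ?_⟩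
    rw [h, List.mem_append, List.mem_singleton] at ht
    rcases ht with ht | rfl
    · have hsort := w.starts_sorted
      rw [h, List.map_append, List.pairwise_append] at hsort
      have h1 := hsort.2.2 _ (List.mem_map_of_mem ht) (o.label s) (by simp)
      have h2 : o.label t = o.label x := (o.label_eq_iff _ _).mpr htx
      have h3 := hlast s
      change o.label t < o.label s at h1
      omega
    · exact htx

theorem length_eq_one_of_rot_eq {x y : Γ.H} {X Y : List Γ.H} (h : Γ.block x = X ++ y :: Y)
    (hxy : x ≠ y) (hr : Γ.rot x = y) : X.length = 1 := by
  obtain ⟨t, ht⟩ := Γ.exists_block_eq_cons x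
  have hc := Γ.block_chain x
  have hn := Γ.nodup_block x
  rcases X with _ | ⟨x', _ | ⟨z, X⟩⟩
  · rw [ht] at h
    exact absurd (List.cons.inj h).1 hxy
  · rfl
  · rw [ht] at h
    obtain rfl := (List.cons.inj h).1
    rw [ht, h] at hc hn
    simp only [List.cons_append, List.isChain_cons_cons] at hc
    rw [← hc.1, hr] at hn
    simp at hn

theorem sum_sameVertex {M : Type*} [AddCommMonoid M] (f : Γ.H → M) {s : Γ.H}
    [DecidablePred (Γ.SameVertex s)] :
    ∑ x ∈ Finset.univ.filter (Γ.SameVertex s), f x =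
      ∑ i ∈ Finset.range (Γ.valence s), f ((Γ.rot ^ i) s) := by
  have h : Finset.univ.filter (Γ.SameVertex s) = (Γ.block s).toFinset := by
    ext x
    simp [mem_block]
  rw [h, List.sum_toFinset _ (Γ.nodup_block s), block, List.map_map]
  rfl

end RibbonGraph

/-! ### The boundary of `Z` vanishes. -/

namespace CyclicAInfinity

open RibbonGraph

variable {k : Type*} [Field k] {W : Type*} [AddCommGroup W] [Module k W]
  {𝒲 : ZMod 2 → Submodule k W} (A : CyclicAInfinity 𝒲) {ι : Type*} [Fintype ι] [DecidableEq ι]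
  (e : Module.Basis ι k W) (p : ι → ZMod 2)

/-- The contribution of the edge of `a` to the boundary of the cycle; it does not depend on the
orientation used to define it. -/
noncomputable def edgeWeight (Γ : RibbonGraph) (a : Γ.H) : GraphChains k :=
  A.partitionFunction e p ⟨Γ, Classical.choice (nonempty_orientation Γ)⟩ •
    edgeBoundary' k (Classical.choice (nonempty_orientation Γ)) a

open Classical in
/-- The contribution of the expansion of a vertex at `x` and `y`. -/
noncomputable def cutWeight (Γ : RibbonGraph) (x y : Γ.H) : GraphChains k :=
  if h : Γ.IsCut x y then A.edgeWeight e p (expand h) (new h true) else 0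

variable {e p} (he : ∀ i, e i ∈ 𝒲 (p i))
include he

theorem edgeWeight_eq {Γ : RibbonGraph} (o : Γ.Orientation) (a : Γ.H) :
    A.edgeWeight e p Γ a = A.partitionFunction e p ⟨Γ, o⟩ • edgeBoundary' k o a :=
  A.partitionFunction_smul_edgeBoundary he _ o a

theorem edgeWeight_iso {Γ Δ : RibbonGraph} (φ : Γ.Iso Δ) (a : Γ.H) :
    A.edgeWeight e p Δ (φ.toEquiv a) = A.edgeWeight e p Γ a :=
  (A.partitionFunction_smul_edgeBoundary_iso he _ _ φ a).symm

/-- For a cut this combines the two computations for expansions. If `x` and `y` do not form a cut,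
they are neighbours, one side has a single element, and the right side vanishes because `d_1 = 0`.
The sum over cuts may thus be taken over all pairs `x ≠ y` at the vertex. -/
theorem cutWeight_eq (hd₁ : A.d 1 = 0) {Γ : RibbonGraph} {o : Γ.Orientation} {s : Γ.H}
    (hlast : ∀ z, o.label z ≤ o.label s)
    (w : OrientedRibbonGraph.Writing ⟨Γ, o⟩) {S : List Γ.H} {s' : Γ.H} (hS : w.starts = S ++ [s'])
    (hs : Γ.SameVertex s' s) {x y : Γ.H} (hx : Γ.SameVertex s x) (hxy : x ≠ y) {X Y : List Γ.H}
    (hXY : Γ.block x = X ++ y :: Y) (hd : IsDiagram (S.map Γ.block ++ [X ++ y :: Y]) w.arrows) :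
    A.cutWeight e p Γ x y = -(∑ j, A.compositeTerm e p (S.map Γ.block) X (y :: Y) w.arrows j) •
      OrientedRibbonGraph.toChain k ⟨Γ, o⟩ := by
  unfold cutWeight
  split_ifs with h
  · have hlast' : ∀ z, o.label z ≤ o.label x := by
      rw [← (o.label_eq_iff s x).mpr hx]
      exact hlast
    rw [A.edgeWeight_eq he (expandOrientation h hlast'), edgeBoundary'_expand,
      A.partitionFunction_expand he h hlast' w hS (hs.trans hx) hXY hd]
  · have hy : Γ.SameVertex x y := by
      rw [← mem_block, hXY]
      simp
    have hone : X.length = 1 ∨ (y :: Y).length = 1 := by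
      by_cases h1 : Γ.rot x = y
      · exact Or.inl (length_eq_one_of_rot_eq hXY hxy h1)
      · have h2 : Γ.rot y = x := not_not.mp fun h2 => h ⟨hy, hxy, h1, h2⟩
        obtain ⟨t, ht⟩ := Γ.exists_block_eq_cons x
        rcases X with _ | ⟨x', X⟩
        · rw [ht] at hXY
          exact absurd (List.cons.inj hXY).1 hxy
        · obtain rfl := (List.cons.inj (ht.symm.trans hXY)).1
          exact Or.inr (length_eq_one_of_rot_eq (Γ.block_rotate hXY) hxy.symm h2)
    rw [Finset.sum_eq_zero fun j _ => A.compositeTerm_eq_zero hd₁ j hone, neg_zero, zero_smul]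

/-- The pairs `(m, n)` and `(n, m)` give the cuts `(X, Y)` and `(Y, X)`, whose composites agree by
`compositeTerm_comm`. The whole sum is therefore `-2` times the codifferential relation at this
vertex. -/
theorem sum_cutWeight_vertex (hd₁ : A.d 1 = 0) {Γ : RibbonGraph} (s : Γ.H) :
    ∑ i ∈ Finset.range (Γ.valence s), ∑ j ∈ Finset.range (Γ.valence s),
      A.cutWeight e p Γ ((Γ.rot ^ i) s) ((Γ.rot ^ j) s) = 0 := by
  obtain ⟨o, hlast⟩ := exists_orientation_last s
  obtain ⟨w⟩ := OrientedRibbonGraph.nonempty_writing ⟨Γ, o⟩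
  obtain ⟨S, s', hS, hs⟩ := exists_starts_eq hlast w
  have hd : IsDiagram (S.map Γ.block ++ [Γ.block s]) w.arrows := by
    have := w.isDiagram
    unfold OrientedRibbonGraph.Writing.blocks at this
    rw [hS, List.map_append] at this
    refine this.of_perm ?_ (List.Perm.refl _)
    obtain ⟨u, v, h1, h2⟩ := Γ.exists_block_rotate hs
    simp only [List.map_cons, List.map_nil, List.flatten_append, List.flatten_cons,
      List.flatten_nil, List.append_nil]
    rw [h1, h2]
    exact List.perm_append_comm.append_left _
  set b := Γ.block s with hc
  have hlen : b.length = Γ.valence s := Γ.length_block s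
  have hget : ∀ i (hi : i < b.length), b[i] = (Γ.rot ^ i) s := by
    intro i hi
    simp [hc, block]
  have hne : ∀ m n, m < n → n < b.length → (Γ.rot ^ m) s ≠ (Γ.rot ^ n) s := by
    intro m n hmn hn h
    rw [← hget m (by omega), ← hget n hn, (Γ.nodup_block s).getElem_inj_iff] at h
    omega
  have hsame : ∀ i : ℕ, Γ.SameVertex s ((Γ.rot ^ i) s) := fun i => ⟨i, by simp⟩
  -- The diagonal terms are zero because a cut requires two distinct half-edges.
  rw [Finset.sum_range_sum_range_eq _ fun n => dif_neg fun h => h.2.1 rfl, ← hlen]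
  have key : ∀ n ∈ Finset.range b.length, ∀ m ∈ Finset.range n,
      A.cutWeight e p Γ ((Γ.rot ^ m) s) ((Γ.rot ^ n) s) +
        A.cutWeight e p Γ ((Γ.rot ^ n) s) ((Γ.rot ^ m) s) =
      -((2 * ∑ j, A.compositeTerm e p (S.map Γ.block) ((b.drop m).take (n - m))
        (b.drop n ++ b.take m) w.arrows j) • OrientedRibbonGraph.toChain k ⟨Γ, o⟩) := by
    intro n hn m hm
    rw [Finset.mem_range] at hn hm
    have hne' := hne m n hm hn
    have hcm : b.drop m = (Γ.rot ^ m) s :: b.drop (m + 1) := by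
      rw [← hget m (by omega)]
      exact List.drop_eq_getElem_cons (by omega)
    have hcn : b.drop n = (Γ.rot ^ n) s :: b.drop (n + 1) := by
      rw [← hget n hn]
      exact List.drop_eq_getElem_cons hn
    have hdn : b.drop n = (b.drop m).drop (n - m) := by rw [List.drop_drop]; congr 1; omega
    set X := (b.drop m).take (n - m) with hX
    set Y := b.drop n ++ b.take m with hY
    have hbm : Γ.block ((Γ.rot ^ m) s) = X ++ Y := by
      have h1 : Γ.block s = b.take m ++ (Γ.rot ^ m) s :: b.drop (m + 1) := by
        rw [← hcm, List.take_append_drop]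
      rw [Γ.block_rotate h1, ← hcm, hX, hY, ← List.append_assoc, hdn, List.take_append_drop]
    have hYe : Y = (Γ.rot ^ n) s :: (b.drop (n + 1) ++ b.take m) := by
      rw [hY, hcn, List.cons_append]
    obtain ⟨X', hXe⟩ : ∃ X', X = (Γ.rot ^ m) s :: X' := by
      obtain ⟨l, hl⟩ : ∃ l, n - m = l + 1 := ⟨n - m - 1, by omega⟩
      rw [hX, hcm, hl, List.take_succ_cons]
      exact ⟨_, rfl⟩
    have hperm : b.Perm (X ++ Y) := by
      rw [← hbm]
      obtain ⟨u, v, h1, h2⟩ := Γ.exists_block_rotate (hsame m)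
      rw [hc, h1, h2]
      exact List.perm_append_comm
    have hd1 : IsDiagram (S.map Γ.block ++ [X ++ Y]) w.arrows := by
      refine hd.of_perm ?_ (List.Perm.refl _)
      simpa using hperm.append_left _
    have hd2 : IsDiagram (S.map Γ.block ++ [Y ++ X]) w.arrows := by
      refine hd1.of_perm ?_ (List.Perm.refl _)
      simpa using (List.perm_append_comm (l₁ := X) (l₂ := Y)).append_left _
    have hbn : Γ.block ((Γ.rot ^ n) s) = Y ++ X := by
      rw [hYe] at hbm ⊢
      exact Γ.block_rotate hbm
    have e1 := A.cutWeight_eq he hd₁ hlast w hS hs (hsame m) hne' (hYe ▸ hbm) (hYe ▸ hd1)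
    have e2 := A.cutWeight_eq he hd₁ hlast w hS hs (hsame n) hne'.symm (hXe ▸ hbn) (hXe ▸ hd2)
    rw [← hYe] at e1
    rw [← hXe] at e2
    rw [e1, e2, Finset.sum_congr rfl fun j _ => A.compositeTerm_comm he hd2 j, ← add_smul,
      ← neg_smul]
    congr 1
    ring
  rw [Finset.sum_congr rfl fun n hn => Finset.sum_congr rfl (key n hn)]
  simp only [Finset.sum_neg_distrib, ← Finset.sum_smul, ← Finset.mul_sum]
  have hswap : ∑ n ∈ Finset.range b.length, ∑ m ∈ Finset.range n,
      ∑ j, A.compositeTerm e p (S.map Γ.block) ((b.drop m).take (n - m))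
        (b.drop n ++ b.take m) w.arrows j = 0 := by
    simp only [Finset.sum_comm (t := Finset.univ)]
    exact Finset.sum_eq_zero fun j _ => A.sum_compositeTerm he hd j
  rw [hswap, mul_zero, zero_smul, neg_zero]

/-- Half-edges at different vertices form no cut, so the double sum splits into one sum for each
vertex. -/
theorem sum_cutWeight (hd₁ : A.d 1 = 0) (Γ : RibbonGraph) :
    ∑ x, ∑ y, A.cutWeight e p Γ x y = 0 := by
  classical
  obtain ⟨o⟩ := nonempty_orientation Γ
  rw [← Finset.sum_fiberwise_of_maps_to (t := o.labels) (g := o.label) fun x _ => o.label_mem x]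
  refine Finset.sum_eq_zero fun m hm => ?_
  obtain ⟨s, rfl⟩ := Orientation.mem_labels.mp hm
  have hfilter : Finset.univ.filter (fun x => o.label x = o.label s) =
      Finset.univ.filter (Γ.SameVertex s) := by
    ext x
    rw [Finset.mem_filter, Finset.mem_filter, eq_comm, o.label_eq_iff]
  rw [hfilter, sum_sameVertex]
  rw [← A.sum_cutWeight_vertex he hd₁ s]
  refine Finset.sum_congr rfl fun i _ => ?_
  rw [← sum_sameVertex]
  refine (Finset.sum_subset (Finset.filter_subset _ _) fun y _ hy => dif_neg fun h => hy ?_).symm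
  rw [Finset.mem_filter]
  exact ⟨Finset.mem_univ _, Equiv.Perm.SameCycle.trans ⟨i, by simp⟩ h.1⟩

/-- The boundary of the chain is half the weighted sum of `edgeWeight` over all half-edges of all
representatives. As these weights are isomorphism invariants and vanish on loops, the sum may be
regrouped over cuts, and it then vanishes on each contracted graph separately. -/
theorem boundaryMap_cycleChain [CharZero k] (hd₁ : A.d 1 = 0) {g n : ℕ}
    {S : Finset OrientedRibbonGraph} (hS : OrientedRibbonGraph.IsRepresentatives g n S) :
    boundaryMap k (A.cycleChain e p S) = 0 := by
  classical
  have h1 : boundaryMap k (A.cycleChain e p S) = (2⁻¹ : k) •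
      ∑ X ∈ S, (Nat.card (X.graph.Iso X.graph) : k)⁻¹ • ∑ a, A.edgeWeight e p X.graph a := by
    rw [cycleChain, map_sum, Finset.smul_sum]
    refine Finset.sum_congr rfl fun X _ => ?_
    rw [map_smul, boundaryMap_toChain, boundary_eq, Finset.smul_sum, Finset.smul_sum,
      Finset.smul_sum, Finset.smul_sum]
    refine Finset.sum_congr rfl fun a _ => ?_
    rw [A.edgeWeight_eq he X.orientation, smul_smul, smul_smul, smul_smul]
    congr 1
    rw [div_eq_mul_inv]
    ring
  rw [h1, hS.sum_edges_eq_sum_cuts _ (A.edgeWeight_iso he) fun a ha => by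
    rw [edgeWeight, edgeBoundary'_of_isLoop k _ ha, smul_zero]]
  rw [Finset.sum_eq_zero, smul_zero]
  intro X _
  have h2 : ∑ c : {c : X.graph.H × X.graph.H // X.graph.IsCut c.1 c.2},
      A.edgeWeight e p (expand c.2) (new c.2 true) = ∑ x, ∑ y, A.cutWeight e p X.graph x y := by
    have h3 : ∑ x, ∑ y, A.cutWeight e p X.graph x y =
        ∑ c ∈ Finset.univ.filter fun c : X.graph.H × X.graph.H => X.graph.IsCut c.1 c.2,
          A.cutWeight e p X.graph c.1 c.2 := by
      rw [← Fintype.sum_prod_type']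
      refine (Finset.sum_subset (Finset.filter_subset _ _) fun c _ hc => dif_neg fun h => hc ?_).symm
      exact Finset.mem_filter.mpr ⟨Finset.mem_univ _, h⟩
    rw [h3, Finset.sum_subtype (p := fun c : X.graph.H × X.graph.H => X.graph.IsCut c.1 c.2) _
      (by simp) fun c => A.cutWeight e p X.graph c.1 c.2]
    exact Finset.sum_congr rfl fun c _ => by rw [cutWeight, dif_pos c.2]
  rw [h2, A.sum_cutWeight he hd₁, smul_zero]

end CyclicAInfinity

theorem mainTheorem2 {k : Type*} [Field k] [CharZero k] {W : Type*} [AddCommGroup W] [Module k W]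
    (𝒲 : ZMod 2 → Submodule k W) (h𝒲 : DirectSum.IsInternal 𝒲)
    (A : CyclicAInfinity 𝒲) (hd₁ : A.d 1 = 0)
    {ι ι' : Type*} [Fintype ι] [DecidableEq ι] [Fintype ι'] [DecidableEq ι']
    (e : Module.Basis ι k W) (p : ι → ZMod 2) (he : ∀ i, e i ∈ 𝒲 (p i))
    (e' : Module.Basis ι' k W) (p' : ι' → ZMod 2) (he' : ∀ i, e' i ∈ 𝒲 (p' i)) :
    -- the number `Z` does not depend on the choices made in writing down the tensor
    (∀ (X : OrientedRibbonGraph) (w : X.Writing),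
      A.contraction e p w = A.partitionFunction e p X) ∧
    -- it does not depend on the homogeneous basis
    (∀ X : OrientedRibbonGraph, A.partitionFunction e' p' X = A.partitionFunction e p X) ∧
    -- it is invariant under isomorphisms of oriented graphs
    (∀ (Γ Δ : RibbonGraph) (o : Γ.Orientation) (o' : Δ.Orientation) (φ : Γ.Iso Δ),
      φ.PreservesOrder o o' → (∀ x, o'.tail (φ.toEquiv x) = o.tail x) →
      A.partitionFunction e p ⟨Γ, o⟩ = A.partitionFunction e p ⟨Δ, o'⟩) ∧
    -- it changes sign when two vertices are exchanged or an arrow is reversed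
    (∀ (Γ : RibbonGraph) (o : Γ.Orientation) (u v : Γ.H), ¬ Γ.SameVertex u v →
      A.partitionFunction e p ⟨Γ, o.swap u v⟩ = - A.partitionFunction e p ⟨Γ, o⟩) ∧
    (∀ (Γ : RibbonGraph) (o : Γ.Orientation) (x : Γ.H),
      A.partitionFunction e p ⟨Γ, o.reverse x⟩ = - A.partitionFunction e p ⟨Γ, o⟩) ∧
    -- there are finitely many classes of graphs of given genus and number of marked points, and
    -- the chain `Z` does not depend on the choice of oriented representatives
    (∀ g n : ℕ, (∃ S, OrientedRibbonGraph.IsRepresentatives g n S) ∧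
      ∀ S S', OrientedRibbonGraph.IsRepresentatives g n S →
        OrientedRibbonGraph.IsRepresentatives g n S' →
        A.cycleChain e p S = A.cycleChain e p S') ∧
    -- the boundary operator of the graph complex is well defined, and `Z` is a cycle for it
    ∃ bd : GraphChains k →ₗ[k] GraphChains k,
      (∀ X : OrientedRibbonGraph, bd (X.toChain k) = X.boundary k) ∧
      ∀ (g n : ℕ) (S : Finset OrientedRibbonGraph),
        OrientedRibbonGraph.IsRepresentatives g n S → bd (A.cycleChain e p S) = 0 := by
  exact ⟨fun X w => A.contraction_eq_contraction he w _,
    fun X => A.partitionFunction_change_basis he h𝒲 he' X,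
    fun Γ Δ o o' φ hφ ht => A.partitionFunction_iso he φ hφ ht,
    fun Γ o u v huv => A.partitionFunction_swap he o huv,
    fun Γ o x => A.partitionFunction_reverse he o x,
    fun g n => ⟨OrientedRibbonGraph.exists_isRepresentatives g n,
      fun S S' hS hS' => A.cycleChain_eq he hS hS'⟩,
    RibbonGraph.boundaryMap k, RibbonGraph.boundaryMap_toChain k,
    fun g n S hS => A.boundaryMap_cycleChain he hd₁ hS⟩
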